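/- Consider the Boiti–Leon–Pempinelli system $$u_{ty}=(u^2-u_x)_{xy}+2v_{xxx},\qquad v_t=v_{xx}+2uv_x$$ for real functions $u,v$ of real variables $(t,x,y)$. A point transformation on an open set $\Omega\subseteq\mathbb R^5$ with coordinates $(t,x,y,u,v)$ is a $C^\infty$ map $\Phi\colon\Omega\to\mathbb R^5$ with nowhere vanishing Jacobian determinant. It is a point symmetry of the system, i.e. an element of the complete point-symmetry pseudogroup $G$ of the system, if, whenever $\Phi$ maps the graph of a smooth pair $(u,v)$ over an open set $D\subseteq\mathbb R^3$ (this graph being contained in $\Omega$) onto the graph of a smooth pair $(\tilde u,\tilde v)$ over an open set $\tilde D\subseteq\mathbb R^3$, the pair $(u,v)$ is a solution of the system on $D$ if and only if $(\tilde u,\tilde v)$ is a solution of the system on $\tilde D$. Say that a map $\Phi$ is of the form $(*)$ on an open set $\Omega$ if there on $$\tilde t=T(t),\quad \tilde x=\varepsilon T_t^{1/2}x+X^0(t),\quad \tilde y=Y(y),\quad \tilde u=\frac{\varepsilon}{T_t^{1/2}}u-\frac{\varepsilon T_{tt}}{4T_t^{3/2}}x-\frac{X^0_t}{2T_t},\quad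 \tilde v=\frac{1}{Y_y}v+V^0(y)\qquad(*)$$ for some $\varepsilon\in\{1,-1\}$ and some smooth functions $T,X^0$ on the projection of $\Omega$ to the $t$-axis and $Y,V^0$ on the projection of $\Omega$ to the $y$-axis, with $T_t>0$ and $Y_y\ne0$. Then the complete point-symmetry pseudogroup $G$ consists exactly of the transformations of the form $(*)$: for every open $\Omega\subseteq\mathbb R^5$, a map $\Phi\colon\Omega\to\mathbb R^5$ is a point symmetry of the system on $\Omega$ if and only if every point of $\Omega$ has an open neighbourhood in $\Omega$ on which $\Phi$ is of the form $(*)$; and if $\Omega$ is moreover convex, $\Phi$ is a point symmetry on $\Omega$ if and only if it is of the form $(*)$ on all of $\Omega$. -/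

import Mathlib

open scoped ContDiff

namespace BLP

/-- The space of the independent variables `(t, x, y)`. -/
abbrev Base : Type := ℝ × ℝ × ℝ

/-- The space of the independent and dependent variables `(t, x, y, u, v)`. -/
abbrev Total : Type := ℝ × ℝ × ℝ × ℝ × ℝ

/-- Partial derivative with respect to `t`. -/
noncomputable def dt (f : Base → ℝ) : Base → ℝ := fun z => fderiv ℝ f z (1, 0, 0)

/-- Partial derivative with respect to `x`. -/
noncomputable def dx (f : Base → ℝ) : Base → ℝ := fun z => fderiv ℝ f z (0, 1, 0)

/-- Partial derivative with respect to `y`. -/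
noncomputable def dy (f : Base → ℝ) : Base → ℝ := fun z => fderiv ℝ f z (0, 0, 1)

/-- The pair `(u, v)` satisfies the Boiti–Leon–Pempinelli system
`u_{ty} = (u² - u_x)_{xy} + 2 v_{xxx}`, `v_t = v_{xx} + 2 u v_x` at every point of `D`.
It is used for open sets `D` and functions that are smooth on `D`. -/
def SolvesOn (D : Set Base) (u v : Base → ℝ) : Prop :=
  ∀ z ∈ D,
    dy (dt u) z = dy (dx (fun w => u w ^ 2 - dx u w)) z + 2 * dx (dx (dx v)) z ∧
    dt v z = dx (dx v) z + 2 * u z * dx v z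

/-- The point over `z` of the graph of the pair `(u, v)`. -/
def graphPoint (u v : Base → ℝ) (z : Base) : Total := (z.1, z.2.1, z.2.2, u z, v z)

/-- A point transformation on the open set `Ω` of the space with coordinates `(t, x, y, u, v)`:
a tuple of five smooth functions on `Ω` with nonvanishing Jacobian. -/
structure IsPointTransformation (Ω : Set Total) (Φ : Total → Total) : Prop where
  isOpen : IsOpen Ω
  smooth : ContDiffOn ℝ ∞ Φ Ω
  jacobian_ne_zero : ∀ p ∈ Ω, (fderiv ℝ Φ p).det ≠ 0

/-- A point symmetry of the Boiti–Leon–Pempinelli system on `Ω`, that is, an element of its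
complete point-symmetry pseudogroup: a point transformation that maps the system to the system of
the same form in the new variables. Whenever `Φ` carries the graph over an open set `D` of a smooth
pair `(u, v)` onto the graph over an open set `D'` of a smooth pair `(u', v')`, one pair is a
solution if and only if the other one is. -/
structure IsPointSymmetry (Ω : Set Total) (Φ : Total → Total) : Prop
    extends IsPointTransformation Ω Φ where
  solves_iff : ∀ (D D' : Set Base) (u v u' v' : Base → ℝ),
    IsOpen D → IsOpen D' →
    ContDiffOn ℝ ∞ u D → ContDiffOn ℝ ∞ v D →
    ContDiffOn ℝ ∞ u' D' → ContDiffOn ℝ ∞ v' D' →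
    (∀ z ∈ D, graphPoint u v z ∈ Ω) →
    (fun z => Φ (graphPoint u v z)) '' D = graphPoint u' v' '' D' →
    (SolvesOn D u v ↔ SolvesOn D' u' v')

/-- On `Ω`, the map `Φ` is given by
`t̃ = T(t)`, `x̃ = ε T_t^{1/2} x + X⁰(t)`, `ỹ = Y(y)`,
`ũ = ε T_t^{-1/2} u - ε T_{tt} T_t^{-3/2} x / 4 - X⁰_t / (2 T_t)`, `ṽ = v / Y_y + V⁰(y)`
with `ε = ±1` and smooth parameter functions `T`, `X⁰` on the projection of `Ω` to the `t`-axis and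
`Y`, `V⁰` on its projection to the `y`-axis, where `T_t > 0` and `Y_y ≠ 0`. -/
def HasForm (Ω : Set Total) (Φ : Total → Total) : Prop :=
  ∃ (ε : ℝ) (T X₀ Y V₀ : ℝ → ℝ),
    (ε = 1 ∨ ε = -1) ∧
    ContDiffOn ℝ ∞ T ((fun p : Total => p.1) '' Ω) ∧
    ContDiffOn ℝ ∞ X₀ ((fun p : Total => p.1) '' Ω) ∧
    ContDiffOn ℝ ∞ Y ((fun p : Total => p.2.2.1) '' Ω) ∧
    ContDiffOn ℝ ∞ V₀ ((fun p : Total => p.2.2.1) '' Ω) ∧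
    ∀ t x y u v : ℝ, (t, x, y, u, v) ∈ Ω →
      0 < deriv T t ∧ deriv Y y ≠ 0 ∧
      Φ (t, x, y, u, v) =
        (T t,
         ε * deriv T t ^ (1 / 2 : ℝ) * x + X₀ t,
         Y y,
         ε / deriv T t ^ (1 / 2 : ℝ) * u
           - ε * deriv (deriv T) t / (4 * deriv T t ^ (3 / 2 : ℝ)) * x
           - deriv X₀ t / (2 * deriv T t),
         v / deriv Y y + V₀ y)

end BLP

/-! Write B(u) = u_t − 2u u_x + u_xx. The first equation is ∂_y B(u) = 2 v_xxx; the second says that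
the operator ∂_t − ∂_x² − 2u ∂_x annihilates v.

Sufficiency. Let τ = τ(t,y), ψ = ψ(y), χ_x = σ, σ_x = 0 and τ_t = σ². Substituting (τ, χ, ψ)
multiplies that operator by σ² exactly when u = σ ũ + χ_t/(2σ); this explains the root of T_t and
the two lower-order terms of ũ in (*). Moreover B(u) = σ³ B(ũ) + (terms free of ũ). If τ and χ do
not involve y, those terms have zero y-derivative, and the two sides of the first equation scale
alike once ṽ_v ỹ_y = 1. The check is pointwise, so the form is only needed locally.

Necessity. Enough explicit solutions are needed to test a symmetry. By the Hopf–Cole substitution, W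
= log(1 + Q(y)(R₁(x) + R₂(t))) with u₀ = (R₂' − R₁'')/(2R₁') yields the solution u = W_x + u₀, v =
W_y + V₀(y). Through any point such solutions realise every first jet with u_y = v_x ≠ 0, and u_tt,
u_xx, u_yy, v_yy stay free (`exists_solution`).

For a solution whose image is again a graph, the second equation in the new variables is expressed
at one point in old variables: subtract from ṽ its linearisation a t̃ + b x̃ + c ỹ along the graph;
the remaining function has zero differential on the graph, so its second x̃-derivative is a second
derivative along the lift of ξ = ∂/∂x̃ (`IsPointSymmetry.second_order_identity`). Comparing
coefficients of the free jet parameters gives, in turn: t̃, x̃, ỹ, ṽ do not depend on u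
(`IsPointSymmetry.pd_Eu_eq_zero`); ξ is a multiple of ∂/∂x, so t̃ and ỹ depend on t, y only; ỹ_t =
0, x̃_v = 0 and x̃_x² = t̃_t (`IsPointSymmetry.x_component`); ṽ_vv = ṽ_x = ṽ_t = 0 and the formula
for ũ (`IsPointSymmetry.u_v_components`).

The first equation supplies the rest. Pulling back solutions with constant ṽ and with ũ a function
of t̃ or of x̃ alone shows that t̃ and x̃ do not involve y; a single solution with v_xxx ≠ 0 gives
ṽ_v ỹ_y = 1. On a convex set these derivative conditions integrate to (*), with ε the constant sign
of x̃_x. -/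

namespace BLP

/-! ### Calculus of directional derivatives on open sets. -/

section DirectionalDerivative

variable {E F : Type*} [NormedAddCommGroup E] [NormedSpace ℝ E]
  [NormedAddCommGroup F] [NormedSpace ℝ F]

/-- The derivative of `f` in the direction `w`. -/
noncomputable def pd (w : E) (f : E → ℝ) : E → ℝ := fun z => fderiv ℝ f z w

variable {D : Set E} {f g : E → ℝ} {w w' z : E}

theorem contDiffAt_of_mem (hD : IsOpen D) {G : E → F} (hG : ContDiffOn ℝ ∞ G D) (hz : z ∈ D) :
    ContDiffAt ℝ ∞ G z :=
  hG.contDiffAt (hD.mem_nhds hz)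

theorem differentiableAt_of_mem (hD : IsOpen D) {G : E → F} (hG : ContDiffOn ℝ ∞ G D)
    (hz : z ∈ D) : DifferentiableAt ℝ G z :=
  (contDiffAt_of_mem hD hG hz).differentiableAt (by simp)

theorem contDiffOn_pd (hD : IsOpen D) (w : E) (hf : ContDiffOn ℝ ∞ f D) :
    ContDiffOn ℝ ∞ (pd w f) D :=
  (hf.fderiv_of_isOpen hD (by simp)).clm_apply contDiffOn_const

theorem pd_congr (hD : IsOpen D) (w : E) (h : ∀ z ∈ D, f z = g z) :
    ∀ z ∈ D, pd w f z = pd w g z := by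
  intro z hz
  have : f =ᶠ[nhds z] g := Filter.eventuallyEq_of_mem (hD.mem_nhds hz) h
  simp only [pd, this.fderiv_eq]

theorem pd_const (w : E) (c : ℝ) (z : E) : pd w (fun _ => c) z = 0 := by
  simp [pd]

theorem pd_eq_zero_of_const (hD : IsOpen D) (w : E) {c : ℝ} (h : ∀ z ∈ D, f z = c) :
    ∀ z ∈ D, pd w f z = 0 := fun z hz => by
  rw [pd_congr hD w h z hz, pd_const]

theorem pd_add (hD : IsOpen D) (hf : ContDiffOn ℝ ∞ f D) (hg : ContDiffOn ℝ ∞ g D)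
    (hz : z ∈ D) : pd w (fun z => f z + g z) z = pd w f z + pd w g z := by
  simp [pd, fderiv_fun_add (differentiableAt_of_mem hD hf hz) (differentiableAt_of_mem hD hg hz)]

theorem pd_sub (hD : IsOpen D) (hf : ContDiffOn ℝ ∞ f D) (hg : ContDiffOn ℝ ∞ g D)
    (hz : z ∈ D) : pd w (fun z => f z - g z) z = pd w f z - pd w g z := by
  simp [pd, fderiv_fun_sub (differentiableAt_of_mem hD hf hz) (differentiableAt_of_mem hD hg hz)]

theorem pd_mul (hD : IsOpen D) (hf : ContDiffOn ℝ ∞ f D) (hg : ContDiffOn ℝ ∞ g D)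
    (hz : z ∈ D) : pd w (fun z => f z * g z) z = f z * pd w g z + g z * pd w f z := by
  simp [pd, fderiv_fun_mul (differentiableAt_of_mem hD hf hz) (differentiableAt_of_mem hD hg hz)]

theorem pd_const_mul (hD : IsOpen D) (c : ℝ) (hf : ContDiffOn ℝ ∞ f D)
    (hz : z ∈ D) : pd w (fun z => c * f z) z = c * pd w f z := by
  rw [pd_mul hD contDiffOn_const hf hz, pd_const]; ring

theorem pd_inv (hD : IsOpen D) (hf : ContDiffOn ℝ ∞ f D) (hz : z ∈ D) (h0 : f z ≠ 0) :
    pd w (fun z => (f z)⁻¹) z = - pd w f z / f z ^ 2 := by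
  have h := (hasDerivAt_inv h0).comp_hasFDerivAt z (differentiableAt_of_mem hD hf hz).hasFDerivAt
  have h' : fderiv ℝ (fun z => (f z)⁻¹) z = _ := h.fderiv
  simp only [pd, h']
  simp
  ring

theorem contDiffOn_fun_div (hf : ContDiffOn ℝ ∞ f D) (hg : ContDiffOn ℝ ∞ g D)
    (h0 : ∀ z ∈ D, g z ≠ 0) : ContDiffOn ℝ ∞ (fun z => f z / g z) D :=
  hf.div hg h0

theorem pd_div (hD : IsOpen D) (hf : ContDiffOn ℝ ∞ f D) (hg : ContDiffOn ℝ ∞ g D)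
    (hz : z ∈ D) (h0 : ∀ z ∈ D, g z ≠ 0) :
    pd w (fun z => f z / g z) z = (pd w f z * g z - f z * pd w g z) / g z ^ 2 := by
  have hi : ContDiffOn ℝ ∞ (fun z => (g z)⁻¹) D := hg.inv h0
  simp only [div_eq_mul_inv]
  rw [pd_mul hD hf hi hz, pd_inv hD hg hz (h0 z hz)]
  have := h0 z hz
  field_simp
  ring

theorem pd_comm (hD : IsOpen D) (hf : ContDiffOn ℝ ∞ f D) (w w' : E) (hz : z ∈ D) :
    pd w (pd w' f) z = pd w' (pd w f) z := by
  have hd : DifferentiableAt ℝ (fderiv ℝ f) z :=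
    differentiableAt_of_mem hD (hf.fderiv_of_isOpen hD (m := ∞) (by simp)) hz
  have key : ∀ a b : E, pd a (pd b f) z = fderiv ℝ (fderiv ℝ f) z a b := by
    intro a b
    have : fderiv ℝ (fun z => fderiv ℝ f z b) z = (fderiv ℝ (fderiv ℝ f) z).flip b := by
      rw [fderiv_clm_apply hd (differentiableAt_const b)]
      simp
    change fderiv ℝ (fun z => fderiv ℝ f z b) z a = _
    rw [this]; simp
  rw [key, key]
  exact ((contDiffAt_of_mem hD hf hz).isSymmSndFDerivAt
    (by rw [minSmoothness_of_isRCLikeNormedField]; exact WithTop.coe_le_coe.2 le_top)) w w'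

theorem pd_add_dir (w w' : E) (f : E → ℝ) (z : E) : pd (w + w') f z = pd w f z + pd w' f z := by
  simp [pd]

theorem pd_smul_dir (c : ℝ) (w : E) (f : E → ℝ) (z : E) : pd (c • w) f z = c * pd w f z := by
  simp [pd]

/-- If the derivative in the direction `e` vanishes on an open set, so does the derivative in this
direction of every directional derivative. -/
theorem pd_pd_eq_zero (hD : IsOpen D) (hf : ContDiffOn ℝ ∞ f D) {e : E}
    (h : ∀ z ∈ D, pd e f z = 0) (w : E) : ∀ z ∈ D, pd e (pd w f) z = 0 := fun z hz => by
  rw [pd_comm hD hf e w hz, pd_eq_zero_of_const hD w h z hz]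

/-- The chain rule of second order along a direction. -/
theorem pd_pd_comp {D' : Set F} {h : F → ℝ} {G : E → F} (hD : IsOpen D) (hD' : IsOpen D')
    (hG : ContDiffOn ℝ ∞ G D) (hh : ContDiffOn ℝ ∞ h D') (hm : ∀ z ∈ D, G z ∈ D') (hz : z ∈ D) :
    pd w (pd w (fun z => h (G z))) z =
      pd (fderiv ℝ G z w) (pd (fderiv ℝ G z w) h) (G z) +
        fderiv ℝ h (G z) (fderiv ℝ (fun z => fderiv ℝ G z w) z w) := by
  have h1 : ∀ z ∈ D, pd w (fun z => h (G z)) z = fderiv ℝ h (G z) (fderiv ℝ G z w) := by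
    intro z hz
    have := fderiv_comp z (differentiableAt_of_mem hD' hh (hm z hz))
      (differentiableAt_of_mem hD hG hz)
    change fderiv ℝ (h ∘ G) z w = _
    rw [this]; rfl
  rw [pd_congr hD w h1 z hz]
  have hd : DifferentiableAt ℝ (fderiv ℝ h) (G z) :=
    differentiableAt_of_mem hD' (hh.fderiv_of_isOpen hD' (m := ∞) (by simp)) (hm z hz)
  have hGd := differentiableAt_of_mem hD hG hz
  have hd2 : DifferentiableAt ℝ (fun z => fderiv ℝ G z w) z :=
    differentiableAt_of_mem hD
      ((hG.fderiv_of_isOpen hD (m := ∞) (by simp)).clm_apply contDiffOn_const) hz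
  have hd3 : HasFDerivAt (fun z => fderiv ℝ h (G z)) _ z := hd.hasFDerivAt.comp z hGd.hasFDerivAt
  have h2 := (hd3.clm_apply hd2.hasFDerivAt).fderiv
  have h3 : ∀ b : F, pd b (pd b h) (G z) = fderiv ℝ (fderiv ℝ h) (G z) b b := by
    intro b
    change fderiv ℝ (fun y => fderiv ℝ h y b) (G z) b = _
    rw [fderiv_clm_apply hd (differentiableAt_const b)]
    simp
  rw [h3]
  change fderiv ℝ _ z w = _
  rw [h2]
  simp
  ring

end DirectionalDerivative

/-! ### The system in Burgers form and its solutions from a potential. -/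

/-- The direction of the `t`-axis. -/
abbrev et : Base := (1, 0, 0)

/-- The direction of the `x`-axis. -/
abbrev ex : Base := (0, 1, 0)

/-- The direction of the `y`-axis. -/
abbrev ey : Base := (0, 0, 1)

theorem dt_eq : dt = pd et := rfl

theorem dx_eq : dx = pd ex := rfl

theorem dy_eq : dy = pd ey := rfl

/-- The left-hand side of the backward Burgers equation `u_t - 2 u u_x + u_{xx}`. -/
noncomputable def burgers (u : Base → ℝ) : Base → ℝ :=
  fun z => pd et u z - 2 * (u z * pd ex u z) + pd ex (pd ex u) z

/-- The Boiti–Leon–Pempinelli system at the point `z`. -/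
def SolvesAt (u v : Base → ℝ) (z : Base) : Prop :=
  pd ey (burgers u) z = 2 * pd ex (pd ex (pd ex v)) z ∧
    pd et v z = pd ex (pd ex v) z + 2 * u z * pd ex v z

section Base

variable {D : Set Base} {u v : Base → ℝ} {z : Base}

theorem contDiffOn_burgers (hD : IsOpen D) (hu : ContDiffOn ℝ ∞ u D) :
    ContDiffOn ℝ ∞ (burgers u) D := by
  have h1 := contDiffOn_pd hD et hu
  have h2 := contDiffOn_pd hD ex hu
  have h3 := contDiffOn_pd hD ex h2
  exact (h1.sub (contDiffOn_const.mul (hu.mul h2))).add h3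

/-- The Burgers expression is u_t − (u² − u_x)_x, so its y-derivative collects all the terms in u of
the first equation. -/
theorem solvesOn_iff (hD : IsOpen D) (hu : ContDiffOn ℝ ∞ u D) :
    SolvesOn D u v ↔ ∀ z ∈ D, SolvesAt u v z := by
  have ht := contDiffOn_pd hD et hu
  have hx := contDiffOn_pd hD ex hu
  have hxx := contDiffOn_pd hD ex hx
  have hsq : ContDiffOn ℝ ∞ (fun z => u z ^ 2) D := hu.pow 2
  have h1 : ∀ z ∈ D, pd ex (fun w => u w ^ 2 - pd ex u w) z =
      2 * (u z * pd ex u z) - pd ex (pd ex u) z := by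
    intro z hz
    rw [pd_sub hD hsq hx hz]
    simp only [pow_two]
    rw [pd_mul hD hu hu hz]
    ring
  have hxm : ContDiffOn ℝ ∞ (fun z => 2 * (u z * pd ex u z)) D := contDiffOn_const.mul (hu.mul hx)
  have h2 : ∀ z ∈ D, pd ey (pd ex (fun w => u w ^ 2 - pd ex u w)) z =
      pd ey (pd et u) z - pd ey (burgers u) z := by
    intro z hz
    rw [pd_congr hD ey h1 z hz, pd_sub hD hxm hxx hz]
    unfold burgers
    rw [pd_add hD (ht.sub hxm) hxx hz, pd_sub hD ht hxm hz]
    ring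
  refine forall₂_congr fun z hz => ?_
  simp only [dt_eq, dx_eq, dy_eq, SolvesAt]
  rw [h2 z hz]
  refine and_congr_left' ⟨fun h => by linarith, fun h => by linarith⟩

/-- Solutions with `u_y = v_x`: a function `W` with `W_t = W_{xx} + W_x² + 2 u₀ W_x`, where `u₀` does
not depend on `y`, yields the solution `(W_x + u₀, W_y + V₀)` for every `V₀` that depends only
on `y`. -/
theorem solvesAt_of_potential {W u₀ V₀ : Base → ℝ} (hD : IsOpen D) (hW : ContDiffOn ℝ ∞ W D)
    (hu₀ : ContDiffOn ℝ ∞ u₀ D) (hV₀ : ContDiffOn ℝ ∞ V₀ D)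
    (heq : ∀ z ∈ D, pd et W z =
      pd ex (pd ex W) z + pd ex W z * pd ex W z + 2 * (u₀ z * pd ex W z))
    (hu₀y : ∀ z ∈ D, pd ey u₀ z = 0) (hV₀t : ∀ z ∈ D, pd et V₀ z = 0)
    (hV₀x : ∀ z ∈ D, pd ex V₀ z = 0) :
    ∀ z ∈ D, SolvesAt (fun z => pd ex W z + u₀ z) (fun z => pd ey W z + V₀ z) z := by
  have hx := contDiffOn_pd hD ex hW
  have hy := contDiffOn_pd hD ey hW
  have hxx := contDiffOn_pd hD ex hx
  have hxxx := contDiffOn_pd hD ex hxx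
  have hyx := contDiffOn_pd hD ex hy
  have hyxx := contDiffOn_pd hD ex hyx
  have h0x := contDiffOn_pd hD ex hu₀
  have h0t := contDiffOn_pd hD et hu₀
  have h0xx := contDiffOn_pd hD ex h0x
  have hu : ContDiffOn ℝ ∞ (fun z => pd ex W z + u₀ z) D := hx.add hu₀
  -- The potential equation differentiated in an arbitrary direction. Along x it evaluates the
  -- Burgers expression of W_x + u₀ as 2 W_xxx plus that of u₀; along y it is the second equation
  -- for W_y.
  have hrhs : ∀ w : Base, ∀ z ∈ D, pd w (pd et W) z = pd w (pd ex (pd ex W)) z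
      + 2 * (pd ex W z * pd w (pd ex W) z)
      + 2 * (u₀ z * pd w (pd ex W) z + pd ex W z * pd w u₀ z) := by
    intro w z hz
    rw [pd_congr hD w heq z hz, pd_add hD (hxx.add (hx.mul hx)) (contDiffOn_const.mul (hu₀.mul hx)) hz,
      pd_add hD hxx (hx.mul hx) hz, pd_mul hD hx hx hz, pd_const_mul hD 2 (hu₀.mul hx) hz,
      pd_mul hD hu₀ hx hz]
    ring
  have hvx : ∀ z ∈ D, pd ex (fun z => pd ey W z + V₀ z) z = pd ex (pd ey W) z := fun z hz => by
    rw [pd_add hD hy hV₀ hz, hV₀x z hz, add_zero]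
  have hvxx : ∀ z ∈ D, pd ex (pd ex (fun z => pd ey W z + V₀ z)) z = pd ex (pd ex (pd ey W)) z :=
    pd_congr hD ex hvx
  have hvxxx := pd_congr hD ex hvxx
  have c1 : ∀ z ∈ D, pd ex (pd ey W) z = pd ey (pd ex W) z := fun z hz => pd_comm hD hW _ _ hz
  have c2 : ∀ z ∈ D, pd ex (pd ex (pd ey W)) z = pd ey (pd ex (pd ex W)) z := fun z hz => by
    rw [pd_congr hD ex c1 z hz, pd_comm hD hx _ _ hz]
  have c3 : ∀ z ∈ D, pd ex (pd ex (pd ex (pd ey W))) z = pd ey (pd ex (pd ex (pd ex W))) z :=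
    fun z hz => by rw [pd_congr hD ex c2 z hz, pd_comm hD hxx _ _ hz]
  have hux : ∀ z ∈ D, pd ex (fun z => pd ex W z + u₀ z) z = pd ex (pd ex W) z + pd ex u₀ z :=
    fun z hz => pd_add hD hx hu₀ hz
  have huxx : ∀ z ∈ D, pd ex (pd ex (fun z => pd ex W z + u₀ z)) z =
      pd ex (pd ex (pd ex W)) z + pd ex (pd ex u₀) z := fun z hz => by
    rw [pd_congr hD ex hux z hz, pd_add hD hxx h0x hz]
  have hb : ∀ z ∈ D, burgers (fun z => pd ex W z + u₀ z) z =
      2 * pd ex (pd ex (pd ex W)) z + burgers u₀ z := by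
    intro z hz
    simp only [burgers]
    rw [hux z hz, huxx z hz, pd_add hD hx hu₀ hz, pd_comm hD hW et ex hz, hrhs ex z hz]
    ring
  have hb0 : ∀ z ∈ D, pd ey (burgers u₀) z = 0 := by
    intro z hz
    unfold burgers
    rw [pd_add hD (h0t.sub (contDiffOn_const.mul (hu₀.mul h0x))) h0xx hz,
      pd_sub hD h0t (contDiffOn_const.mul (hu₀.mul h0x)) hz, pd_const_mul hD 2 (hu₀.mul h0x) hz,
      pd_mul hD hu₀ h0x hz, hu₀y z hz, pd_pd_eq_zero hD hu₀ hu₀y et z hz,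
      pd_pd_eq_zero hD hu₀ hu₀y ex z hz,
      pd_pd_eq_zero hD h0x (pd_pd_eq_zero hD hu₀ hu₀y ex) ex z hz]
    ring
  intro z hz
  refine ⟨?_, ?_⟩
  · rw [pd_congr hD ey hb z hz, hvxxx z hz, c3 z hz,
      pd_add hD (contDiffOn_const.mul hxxx) (contDiffOn_burgers hD hu₀) hz,
      pd_const_mul hD 2 hxxx hz, hb0 z hz, add_zero]
  · rw [hvxx z hz, hvx z hz, pd_add hD hy hV₀ hz, hV₀t z hz, pd_comm hD hW et ey hz, hrhs ey z hz,
      c2 z hz, c1 z hz, hu₀y z hz]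
    ring

/-- The chain rule for a map of the base written in components. -/
theorem pd_comp_base {D' : Set Base} {τ χ ψ g : Base → ℝ} (hD : IsOpen D) (hD' : IsOpen D')
    (hτ : ContDiffOn ℝ ∞ τ D) (hχ : ContDiffOn ℝ ∞ χ D) (hψ : ContDiffOn ℝ ∞ ψ D)
    (hg : ContDiffOn ℝ ∞ g D') (hm : ∀ z ∈ D, (τ z, χ z, ψ z) ∈ D') (w : Base) (hz : z ∈ D) :
    pd w (fun z => g (τ z, χ z, ψ z)) z =
      pd w τ z * pd et g (τ z, χ z, ψ z) + pd w χ z * pd ex g (τ z, χ z, ψ z)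
        + pd w ψ z * pd ey g (τ z, χ z, ψ z) := by
  have h1 := (differentiableAt_of_mem hD' hg (hm z hz)).hasFDerivAt
  have h2 := (differentiableAt_of_mem hD hτ hz).hasFDerivAt.prodMk
    ((differentiableAt_of_mem hD hχ hz).hasFDerivAt.prodMk
      (differentiableAt_of_mem hD hψ hz).hasFDerivAt)
  have h3 : fderiv ℝ (fun z => g (τ z, χ z, ψ z)) z = _ := (h1.comp z h2).fderiv
  have h4 : ((fderiv ℝ τ z w, fderiv ℝ χ z w, fderiv ℝ ψ z w) : Base) =
      fderiv ℝ τ z w • et + fderiv ℝ χ z w • ex + fderiv ℝ ψ z w • ey := by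
    simp [et, ex, ey]
  simp only [pd, h3]
  simp only [ContinuousLinearMap.comp_apply, ContinuousLinearMap.prod_apply, h4, map_add, map_smul,
    smul_eq_mul]

end Base

/-! ### Behaviour of both equations under a change of the independent variables. -/

/-- Smooth functions `τ`, `χ`, `ψ`, `σ` on `D` with `τ = τ(t, y)`, `ψ = ψ(y)`, `χ_x = σ`, `σ_x = 0`,
`σ ≠ 0` and `τ_t = σ²`, the components of a change of the independent variables that is compatible
with the second equation of the system. -/
structure IsBaseChange (D : Set Base) (τ χ ψ σ : Base → ℝ) : Prop where
  isOpen : IsOpen D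
  smooth_τ : ContDiffOn ℝ ∞ τ D
  smooth_χ : ContDiffOn ℝ ∞ χ D
  smooth_ψ : ContDiffOn ℝ ∞ ψ D
  smooth_σ : ContDiffOn ℝ ∞ σ D
  σ_ne_zero : ∀ z ∈ D, σ z ≠ 0
  pd_ex_τ : ∀ z ∈ D, pd ex τ z = 0
  pd_ex_ψ : ∀ z ∈ D, pd ex ψ z = 0
  pd_et_ψ : ∀ z ∈ D, pd et ψ z = 0
  pd_ex_χ : ∀ z ∈ D, pd ex χ z = σ z
  pd_ex_σ : ∀ z ∈ D, pd ex σ z = 0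
  pd_et_τ : ∀ z ∈ D, pd et τ z = σ z ^ 2

namespace IsBaseChange

variable {D D' : Set Base} {τ χ ψ σ g u u' v v' a b : Base → ℝ} {z : Base}

theorem contDiffOn_comp (h : IsBaseChange D τ χ ψ σ)
    (hm : ∀ z ∈ D, (τ z, χ z, ψ z) ∈ D') (hg : ContDiffOn ℝ ∞ g D') :
    ContDiffOn ℝ ∞ (fun z => g (τ z, χ z, ψ z)) D :=
  hg.comp (h.smooth_τ.prodMk (h.smooth_χ.prodMk h.smooth_ψ)) hm

theorem pd_et_comp (h : IsBaseChange D τ χ ψ σ) (hD' : IsOpen D')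
    (hm : ∀ z ∈ D, (τ z, χ z, ψ z) ∈ D') (hg : ContDiffOn ℝ ∞ g D') (hz : z ∈ D) :
    pd et (fun z => g (τ z, χ z, ψ z)) z =
      σ z ^ 2 * pd et g (τ z, χ z, ψ z) + pd et χ z * pd ex g (τ z, χ z, ψ z) := by
  rw [pd_comp_base h.isOpen hD' h.smooth_τ h.smooth_χ h.smooth_ψ hg hm et hz, h.pd_et_τ z hz,
    h.pd_et_ψ z hz]
  ring

theorem pd_ex_comp (h : IsBaseChange D τ χ ψ σ) (hD' : IsOpen D')
    (hm : ∀ z ∈ D, (τ z, χ z, ψ z) ∈ D') (hg : ContDiffOn ℝ ∞ g D') (hz : z ∈ D) :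
    pd ex (fun z => g (τ z, χ z, ψ z)) z = σ z * pd ex g (τ z, χ z, ψ z) := by
  rw [pd_comp_base h.isOpen hD' h.smooth_τ h.smooth_χ h.smooth_ψ hg hm ex hz, h.pd_ex_τ z hz,
    h.pd_ex_ψ z hz, h.pd_ex_χ z hz]
  ring

/-- The transformation rule of the Burgers expression. -/
theorem burgers_eq (h : IsBaseChange D τ χ ψ σ) (hD' : IsOpen D')
    (hm : ∀ z ∈ D, (τ z, χ z, ψ z) ∈ D') (hu' : ContDiffOn ℝ ∞ u' D')
    (hu : ∀ z ∈ D, u z = σ z * u' (τ z, χ z, ψ z) + pd et χ z / (2 * σ z)) :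
    ∀ z ∈ D, burgers u z = σ z ^ 3 * burgers u' (τ z, χ z, ψ z)
      + (pd et (fun z => pd et χ z / (2 * σ z)) z - pd et χ z * pd et σ z / (2 * σ z ^ 2)) := by
  have hD := h.isOpen
  have hσ := h.smooth_σ
  have hG := h.contDiffOn_comp hm hu'
  have hu'x := contDiffOn_pd hD' ex hu'
  have hGx := h.contDiffOn_comp hm hu'x
  have hχt := contDiffOn_pd hD et h.smooth_χ
  have hσt := contDiffOn_pd hD et hσ
  have h2σ : ContDiffOn ℝ ∞ (fun z => 2 * σ z) D := contDiffOn_const.mul hσ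
  have h2σ0 : ∀ z ∈ D, 2 * σ z ≠ 0 := fun z hz => mul_ne_zero two_ne_zero (h.σ_ne_zero z hz)
  have hq : ContDiffOn ℝ ∞ (fun z => pd et χ z / (2 * σ z)) D := hχt.div h2σ h2σ0
  have hχtx : ∀ z ∈ D, pd ex (pd et χ) z = pd et σ z := fun z hz => by
    rw [pd_comm hD h.smooth_χ ex et hz, pd_congr hD et h.pd_ex_χ z hz]
  have hσtx : ∀ z ∈ D, pd ex (pd et σ) z = 0 := pd_pd_eq_zero hD hσ h.pd_ex_σ et
  have hux : ∀ z ∈ D, pd ex u z = σ z ^ 2 * pd ex u' (τ z, χ z, ψ z) + pd et σ z / (2 * σ z) := by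
    intro z hz
    have h0 := h.σ_ne_zero z hz
    rw [pd_congr hD ex hu z hz, pd_add hD (hσ.mul hG) hq hz, pd_mul hD hσ hG hz,
      h.pd_ex_comp hD' hm hu' hz, pd_div hD hχt h2σ hz h2σ0, pd_const_mul hD 2 hσ hz,
      h.pd_ex_σ z hz, hχtx z hz]
    field_simp
    ring
  -- The shift χ_t/(2σ) contributes σ_t/(2σ) to u_x, which is free of x, hence nothing to u_xx.
  have huxx : ∀ z ∈ D, pd ex (pd ex u) z = σ z ^ 3 * pd ex (pd ex u') (τ z, χ z, ψ z) := by
    intro z hz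
    have h0 := h.σ_ne_zero z hz
    have hσ2 : ContDiffOn ℝ ∞ (fun z => σ z ^ 2) D := hσ.pow 2
    have hσ2x : pd ex (fun z => σ z ^ 2) z = 0 := by
      simp only [pow_two]
      rw [pd_mul hD hσ hσ hz, h.pd_ex_σ z hz]; ring
    rw [pd_congr hD ex hux z hz, pd_add hD (hσ2.mul hGx) (contDiffOn_fun_div hσt h2σ h2σ0) hz,
      pd_mul hD hσ2 hGx hz, h.pd_ex_comp hD' hm hu'x hz, hσ2x, pd_div hD hσt h2σ hz h2σ0,
      pd_const_mul hD 2 hσ hz, h.pd_ex_σ z hz, hσtx z hz]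
    ring
  intro z hz
  have h0 := h.σ_ne_zero z hz
  simp only [burgers]
  rw [huxx z hz, hux z hz, hu z hz, pd_congr hD et hu z hz, pd_add hD (hσ.mul hG) hq hz,
    pd_mul hD hσ hG hz, h.pd_et_comp hD' hm hu' hz]
  field_simp
  ring

/-- The transformation rule of the second equation. -/
theorem second_eq (h : IsBaseChange D τ χ ψ σ) (hD' : IsOpen D')
    (hm : ∀ z ∈ D, (τ z, χ z, ψ z) ∈ D') (hv' : ContDiffOn ℝ ∞ v' D')
    (hu : ∀ z ∈ D, u z = σ z * u' (τ z, χ z, ψ z) + pd et χ z / (2 * σ z))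
    (ha : ContDiffOn ℝ ∞ a D) (hb : ContDiffOn ℝ ∞ b D)
    (hat : ∀ z ∈ D, pd et a z = 0) (hax : ∀ z ∈ D, pd ex a z = 0)
    (hbt : ∀ z ∈ D, pd et b z = 0) (hbx : ∀ z ∈ D, pd ex b z = 0)
    (hv : ∀ z ∈ D, v z = a z * v' (τ z, χ z, ψ z) + b z) :
    ∀ z ∈ D, pd ex (pd ex (pd ex v)) z = a z * σ z ^ 3 * pd ex (pd ex (pd ex v')) (τ z, χ z, ψ z) ∧
      pd et v z - (pd ex (pd ex v) z + 2 * u z * pd ex v z) =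
        a z * σ z ^ 2 * (pd et v' (τ z, χ z, ψ z) - (pd ex (pd ex v') (τ z, χ z, ψ z)
          + 2 * u' (τ z, χ z, ψ z) * pd ex v' (τ z, χ z, ψ z))) := by
  have hD := h.isOpen
  have hσ := h.smooth_σ
  have hG := h.contDiffOn_comp hm hv'
  have hv'x := contDiffOn_pd hD' ex hv'
  have hv'xx := contDiffOn_pd hD' ex hv'x
  have hGx := h.contDiffOn_comp hm hv'x
  have hGxx := h.contDiffOn_comp hm hv'xx
  have step : ∀ {c g : Base → ℝ}, ContDiffOn ℝ ∞ c D → (∀ z ∈ D, pd ex c z = 0) →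
      ContDiffOn ℝ ∞ g D' → ∀ z ∈ D, pd ex (fun z => c z * g (τ z, χ z, ψ z)) z =
        c z * σ z * pd ex g (τ z, χ z, ψ z) := by
    intro c g hc hcx hg z hz
    rw [pd_mul hD hc (h.contDiffOn_comp hm hg) hz, h.pd_ex_comp hD' hm hg hz, hcx z hz]
    ring
  have hmulx : ∀ {c : Base → ℝ}, ContDiffOn ℝ ∞ c D → (∀ z ∈ D, pd ex c z = 0) →
      ∀ z ∈ D, pd ex (fun z => c z * σ z) z = 0 := by
    intro c hc hcx z hz
    rw [pd_mul hD hc hσ hz, hcx z hz, h.pd_ex_σ z hz]; ring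
  have haσ : ContDiffOn ℝ ∞ (fun z => a z * σ z) D := ha.mul hσ
  have haσσ : ContDiffOn ℝ ∞ (fun z => a z * σ z * σ z) D := haσ.mul hσ
  have hvx : ∀ z ∈ D, pd ex v z = a z * σ z * pd ex v' (τ z, χ z, ψ z) := fun z hz => by
    rw [pd_congr hD ex hv z hz, pd_add hD (ha.mul hG) hb hz, hbx z hz, step ha hax hv' z hz, add_zero]
  have hvxx : ∀ z ∈ D, pd ex (pd ex v) z = a z * σ z * σ z * pd ex (pd ex v') (τ z, χ z, ψ z) :=
    fun z hz => by rw [pd_congr hD ex hvx z hz, step haσ (hmulx ha hax) hv'x z hz]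
  have hvxxx : ∀ z ∈ D, pd ex (pd ex (pd ex v)) z =
      a z * σ z * σ z * σ z * pd ex (pd ex (pd ex v')) (τ z, χ z, ψ z) :=
    fun z hz => by
      rw [pd_congr hD ex hvxx z hz, step haσσ (hmulx haσ (hmulx ha hax)) hv'xx z hz]
  intro z hz
  have h0 := h.σ_ne_zero z hz
  refine ⟨by rw [hvxxx z hz]; ring, ?_⟩
  -- The term χ_t v'_x produced by the t-derivative is cancelled by the shift χ_t/(2σ) in u.
  rw [hvxx z hz, hvx z hz, hu z hz, pd_congr hD et hv z hz, pd_add hD (ha.mul hG) hb hz, hbt z hz,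
    pd_mul hD ha hG hz, hat z hz, h.pd_et_comp hD' hm hv' hz]
  field_simp
  ring

/-- The transformation rule of the first equation for a change of variables in which `t` and `x`
do not mix with `y`. -/
theorem first_eq (h : IsBaseChange D τ χ ψ σ) (hD' : IsOpen D')
    (hm : ∀ z ∈ D, (τ z, χ z, ψ z) ∈ D') (hτy : ∀ z ∈ D, pd ey τ z = 0) (hχy : ∀ z ∈ D, pd ey χ z = 0)
    (hu' : ContDiffOn ℝ ∞ u' D')
    (hu : ∀ z ∈ D, u z = σ z * u' (τ z, χ z, ψ z) + pd et χ z / (2 * σ z)) :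
    ∀ z ∈ D, pd ey (burgers u) z =
      σ z ^ 3 * pd ey ψ z * pd ey (burgers u') (τ z, χ z, ψ z) := by
  have hD := h.isOpen
  have hσ := h.smooth_σ
  have hχt := contDiffOn_pd hD et h.smooth_χ
  have hσt := contDiffOn_pd hD et hσ
  have hB := contDiffOn_burgers hD' hu'
  have hGB := h.contDiffOn_comp hm hB
  -- Since σ = χ_x, it inherits independence of y from χ, and so does the inhomogeneous part of the
  -- Burgers rule; y then enters through ψ alone.
  have hσy : ∀ z ∈ D, pd ey σ z = 0 := fun z hz => by
    rw [← pd_congr hD ey h.pd_ex_χ z hz, pd_pd_eq_zero hD h.smooth_χ hχy ex z hz]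
  have hχty := pd_pd_eq_zero hD h.smooth_χ hχy et
  have hσty := pd_pd_eq_zero hD hσ hσy et
  have h2σ : ContDiffOn ℝ ∞ (fun z => 2 * σ z) D := contDiffOn_const.mul hσ
  have h2σ0 : ∀ z ∈ D, 2 * σ z ≠ 0 := fun z hz => mul_ne_zero two_ne_zero (h.σ_ne_zero z hz)
  have hq : ContDiffOn ℝ ∞ (fun z => pd et χ z / (2 * σ z)) D := hχt.div h2σ h2σ0
  have hqy : ∀ z ∈ D, pd ey (fun z => pd et χ z / (2 * σ z)) z = 0 := fun z hz => by
    rw [pd_div hD hχt h2σ hz h2σ0, pd_const_mul hD 2 hσ hz, hσy z hz, hχty z hz]; ring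
  have hq' := contDiffOn_pd hD et hq
  have hσ2 : ContDiffOn ℝ ∞ (fun z => 2 * (σ z * σ z)) D := contDiffOn_const.mul (hσ.mul hσ)
  have hσ20 : ∀ z ∈ D, 2 * (σ z * σ z) ≠ 0 := fun z hz =>
    mul_ne_zero two_ne_zero (mul_ne_zero (h.σ_ne_zero z hz) (h.σ_ne_zero z hz))
  have hσσ : ContDiffOn ℝ ∞ (fun z => σ z * σ z) D := hσ.mul hσ
  have hσ3 : ContDiffOn ℝ ∞ (fun z => σ z * σ z * σ z) D := hσσ.mul hσ
  have hR := contDiffOn_fun_div (hχt.mul hσt) hσ2 hσ20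
  have key : ∀ z ∈ D, burgers u z = σ z * σ z * σ z * burgers u' (τ z, χ z, ψ z)
      + (pd et (fun z => pd et χ z / (2 * σ z)) z - pd et χ z * pd et σ z / (2 * (σ z * σ z))) := by
    intro z hz
    rw [h.burgers_eq hD' hm hu' hu z hz]; ring
  intro z hz
  rw [pd_congr hD ey key z hz, pd_add hD (hσ3.mul hGB) (hq'.sub hR) hz,
    pd_sub hD hq' hR hz, pd_div hD (hχt.mul hσt) hσ2 hz hσ20,
    pd_pd_eq_zero hD hq hqy et z hz, pd_mul hD hχt hσt hz, hχty z hz, hσty z hz,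
    pd_const_mul hD 2 hσσ hz, pd_mul hD hσ3 hGB hz, pd_mul hD hσσ hσ hz, pd_mul hD hσ hσ hz,
    hσy z hz, pd_comp_base hD hD' h.smooth_τ h.smooth_χ h.smooth_ψ hB hm ey hz, hτy z hz, hχy z hz]
  ring

end IsBaseChange

/-! ### Coordinates, and sufficiency of the form (*). -/

/-- The projection to the space of the independent variables. -/
def proj (p : Total) : Base := (p.1, p.2.1, p.2.2.1)

section Components

variable {E : Type*} [NormedAddCommGroup E] [NormedSpace ℝ E]

theorem fderiv_total_eq {Ψ : E → Total} {p : E} (h : DifferentiableAt ℝ Ψ p) (w : E) :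
    fderiv ℝ Ψ p w = (pd w (fun q => (Ψ q).1) p, pd w (fun q => (Ψ q).2.1) p,
      pd w (fun q => (Ψ q).2.2.1) p, pd w (fun q => (Ψ q).2.2.2.1) p,
      pd w (fun q => (Ψ q).2.2.2.2) p) := by
  have h' := h.hasFDerivAt
  have h1 := h'.fst
  have h2 := h'.snd
  have h3 := h2.snd
  have h4 := h3.snd
  simp only [pd, h1.fderiv, h2.fst.fderiv, h3.fst.fderiv, h4.fst.fderiv, h4.snd.fderiv]
  rfl

theorem fderiv_base_eq {Ψ : E → Base} {p : E} (h : DifferentiableAt ℝ Ψ p) (w : E) :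
    fderiv ℝ Ψ p w = (pd w (fun q => (Ψ q).1) p, pd w (fun q => (Ψ q).2.1) p,
      pd w (fun q => (Ψ q).2.2) p) := by
  have h' := h.hasFDerivAt
  have h2 := h'.snd
  simp only [pd, h'.fst.fderiv, h2.fst.fderiv, h2.snd.fderiv]
  rfl

theorem pd_comp_clm {g : ℝ → ℝ} (L : E →L[ℝ] ℝ) {z : E} (hg : DifferentiableAt ℝ g (L z)) (w : E) :
    pd w (fun z => g (L z)) z = L w * deriv g (L z) := by
  have h : HasFDerivAt (fun z => g (L z)) _ z := hg.hasDerivAt.comp_hasFDerivAt z L.hasFDerivAt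
  simp only [pd, h.fderiv]
  simp
  ring

theorem pd_clm (L : E →L[ℝ] ℝ) (w z : E) : pd w (fun z => L z) z = L w := by
  simp [pd]

end Components

theorem graphPoint_contDiffOn {D : Set Base} {u v : Base → ℝ} (hu : ContDiffOn ℝ ∞ u D)
    (hv : ContDiffOn ℝ ∞ v D) : ContDiffOn ℝ ∞ (graphPoint u v) D :=
  contDiffOn_fst.prodMk ((contDiff_fst.comp contDiff_snd).contDiffOn.prodMk
    ((contDiff_snd.comp contDiff_snd).contDiffOn.prodMk (hu.prodMk hv)))

theorem isOpen_graph_preimage {D : Set Base} {u v : Base → ℝ} {Ω : Set Total} (hD : IsOpen D)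
    (hΩ : IsOpen Ω) (hu : ContDiffOn ℝ ∞ u D) (hv : ContDiffOn ℝ ∞ v D) :
    IsOpen (D ∩ graphPoint u v ⁻¹' Ω) :=
  (graphPoint_contDiffOn hu hv).continuousOn.isOpen_inter_preimage hD hΩ

/-- The coordinate `t` on the base. -/
abbrev tB : Base →L[ℝ] ℝ := ContinuousLinearMap.fst ℝ ℝ (ℝ × ℝ)

/-- The coordinate `x` on the base. -/
abbrev xB : Base →L[ℝ] ℝ :=
  (ContinuousLinearMap.fst ℝ ℝ ℝ).comp (ContinuousLinearMap.snd ℝ ℝ (ℝ × ℝ))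

/-- The coordinate `y` on the base. -/
abbrev yB : Base →L[ℝ] ℝ :=
  (ContinuousLinearMap.snd ℝ ℝ ℝ).comp (ContinuousLinearMap.snd ℝ ℝ (ℝ × ℝ))

/-- The coordinate `t` on the total space. -/
abbrev tT : Total →L[ℝ] ℝ := ContinuousLinearMap.fst ℝ ℝ (ℝ × ℝ × ℝ × ℝ)

/-- The coordinate `y` on the total space. -/
abbrev yT : Total →L[ℝ] ℝ :=
  (ContinuousLinearMap.fst ℝ ℝ (ℝ × ℝ)).comp ((ContinuousLinearMap.snd ℝ ℝ (ℝ × ℝ × ℝ)).comp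
    (ContinuousLinearMap.snd ℝ ℝ (ℝ × ℝ × ℝ × ℝ)))

theorem isOpen_image_tT {Ω : Set Total} (hΩ : IsOpen Ω) :
    IsOpen ((fun p : Total => p.1) '' Ω) :=
  isOpenMap_fst Ω hΩ

theorem isOpen_image_yT {Ω : Set Total} (hΩ : IsOpen Ω) :
    IsOpen ((fun p : Total => p.2.2.1) '' Ω) :=
  (isOpenMap_fst.comp (isOpenMap_snd.comp isOpenMap_snd)) Ω hΩ

theorem sq_rpow_half {s : ℝ} (hs : 0 < s) : (s ^ (1 / 2 : ℝ)) ^ 2 = s := by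
  rw [← Real.sqrt_eq_rpow, Real.sq_sqrt hs.le]

theorem rpow_three_halves {s : ℝ} (hs : 0 < s) : s ^ (3 / 2 : ℝ) = (s ^ (1 / 2 : ℝ)) ^ 3 := by
  rw [← Real.rpow_natCast, ← Real.rpow_mul hs.le]; norm_num

theorem hasDerivAt_rpow_half {g : ℝ → ℝ} {g' t : ℝ} (hg : HasDerivAt g g' t) (h0 : 0 < g t) :
    HasDerivAt (fun s => g s ^ (1 / 2 : ℝ)) (g' / (2 * g t ^ (1 / 2 : ℝ))) t := by
  simp only [← Real.sqrt_eq_rpow]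
  exact hg.sqrt (ne_of_gt h0)

/-- A transformation of the stated form maps the system at a point to the system at the image. -/
theorem solvesAt_iff_of_hasForm {Ω : Set Total} {Φ : Total → Total} (hΩ : IsOpen Ω)
    (hΦ : HasForm Ω Φ) {D D' : Set Base} {u v u' v' : Base → ℝ} (hD : IsOpen D) (hD' : IsOpen D')
    (hu : ContDiffOn ℝ ∞ u D) (hv : ContDiffOn ℝ ∞ v D) (hu' : ContDiffOn ℝ ∞ u' D')
    (hv' : ContDiffOn ℝ ∞ v' D')
    (hm : ∀ z ∈ D, proj (Φ (graphPoint u v z)) ∈ D' ∧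
      Φ (graphPoint u v z) = graphPoint u' v' (proj (Φ (graphPoint u v z))))
    {z : Base} (hz : z ∈ D) (hzΩ : graphPoint u v z ∈ Ω) :
    SolvesAt u v z ↔ SolvesAt u' v' (proj (Φ (graphPoint u v z))) := by
  obtain ⟨ε, T, X₀, Y, V₀, hε, hT, hX₀, hY, hV₀, hform⟩ := hΦ
  have hI := isOpen_image_tT hΩ
  have hJ := isOpen_image_yT hΩ
  set I := (fun p : Total => p.1) '' Ω
  set J := (fun p : Total => p.2.2.1) '' Ω
  have hε0 : ε ≠ 0 := by rcases hε with rfl | rfl <;> norm_num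
  have hε2 : ε ^ 2 = 1 := by rcases hε with rfl | rfl <;> norm_num
  have hD1 := isOpen_graph_preimage hD hΩ hu hv
  set D₁ := D ∩ graphPoint u v ⁻¹' Ω with hD₁
  have hfm : ∀ z ∈ D₁, z.1 ∈ I ∧ z.2.2 ∈ J ∧ 0 < deriv T z.1 ∧ deriv Y z.2.2 ≠ 0 := fun z hz =>
    ⟨⟨_, hz.2, rfl⟩, ⟨_, hz.2, rfl⟩, (hform _ _ _ _ _ hz.2).1, (hform _ _ _ _ _ hz.2).2.1⟩
  have hT' : ContDiffOn ℝ ∞ (deriv T) I := hT.deriv_of_isOpen hI (by simp)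
  have hX₀' : ContDiffOn ℝ ∞ (deriv X₀) I := hX₀.deriv_of_isOpen hI (by simp)
  have hY' : ContDiffOn ℝ ∞ (deriv Y) J := hY.deriv_of_isOpen hJ (by simp)
  have hT'pos : ∀ t ∈ I, 0 < deriv T t := by
    rintro _ ⟨⟨t, x, y, a, b⟩, hp, rfl⟩
    exact (hform _ _ _ _ _ hp).1
  -- The role of σ in the base change: S² = T_t because ε² = 1.
  set S : ℝ → ℝ := fun t => ε * deriv T t ^ (1 / 2 : ℝ) with hS
  have hSsm : ContDiffOn ℝ ∞ S I :=
    contDiffOn_const.mul (hT'.rpow_const_of_ne fun t ht => (hT'pos t ht).ne')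
  have hlift_t : ∀ {g : ℝ → ℝ}, ContDiffOn ℝ ∞ g I → ContDiffOn ℝ ∞ (fun z : Base => g (tB z)) D₁ :=
    fun hg => hg.comp tB.contDiff.contDiffOn fun z hz => (hfm z hz).1
  have hlift_y : ∀ {g : ℝ → ℝ}, ContDiffOn ℝ ∞ g J → ContDiffOn ℝ ∞ (fun z : Base => g (yB z)) D₁ :=
    fun hg => hg.comp yB.contDiff.contDiffOn fun z hz => (hfm z hz).2.1
  have hpt : ∀ {g : ℝ → ℝ}, ContDiffOn ℝ ∞ g I → ∀ w, ∀ z ∈ D₁,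
      pd w (fun z : Base => g (tB z)) z = w.1 * deriv g z.1 := fun hg w z hz =>
    pd_comp_clm tB (differentiableAt_of_mem hI hg (hfm z hz).1) w
  have hpy : ∀ {g : ℝ → ℝ}, ContDiffOn ℝ ∞ g J → ∀ w, ∀ z ∈ D₁,
      pd w (fun z : Base => g (yB z)) z = w.2.2 * deriv g z.2.2 := fun hg w z hz =>
    pd_comp_clm yB (differentiableAt_of_mem hJ hg (hfm z hz).2.1) w
  set χ : Base → ℝ := fun z => S (tB z) * xB z + X₀ (tB z) with hχ
  have hxsm : ContDiffOn ℝ ∞ (fun z => xB z) D₁ := xB.contDiff.contDiffOn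
  have hχsm : ContDiffOn ℝ ∞ χ D₁ := ((hlift_t hSsm).mul hxsm).add (hlift_t hX₀)
  have hpχ : ∀ w, ∀ z ∈ D₁, pd w χ z =
      S z.1 * w.2.1 + z.2.1 * (w.1 * deriv S z.1) + w.1 * deriv X₀ z.1 := by
    intro w z hz
    simp only [hχ]
    rw [pd_add hD1 ((hlift_t hSsm).mul hxsm) (hlift_t hX₀) hz, pd_mul hD1 (hlift_t hSsm) hxsm hz,
      hpt hSsm w z hz, hpt hX₀ w z hz, pd_clm]
    rfl
  have hS2 : ∀ t ∈ I, S t ^ 2 = deriv T t := fun t ht => by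
    simp only [hS, mul_pow, hε2, one_mul, sq_rpow_half (hT'pos t ht)]
  have hS0 : ∀ t ∈ I, S t ≠ 0 := fun t ht h => by
    have := hS2 t ht
    rw [h] at this
    have h2 := hT'pos t ht
    norm_num at this
    linarith
  have hdS : ∀ t ∈ I, deriv S t = ε * (deriv (deriv T) t / (2 * deriv T t ^ (1 / 2 : ℝ))) :=
    fun t ht => ((hasDerivAt_rpow_half (differentiableAt_of_mem hI hT' ht).hasDerivAt
      (hT'pos t ht)).const_mul ε).deriv
  have hbc : IsBaseChange D₁ (fun z => T (tB z)) χ (fun z => Y (yB z)) (fun z => S (tB z)) :=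
    { isOpen := hD1
      smooth_τ := hlift_t hT
      smooth_χ := hχsm
      smooth_ψ := hlift_y hY
      smooth_σ := hlift_t hSsm
      σ_ne_zero := fun z hz => hS0 _ (hfm z hz).1
      pd_ex_τ := fun z hz => by rw [hpt hT ex z hz]; simp
      pd_ex_ψ := fun z hz => by rw [hpy hY ex z hz]; simp
      pd_et_ψ := fun z hz => by rw [hpy hY et z hz]; simp
      pd_ex_χ := fun z hz => by rw [hpχ ex z hz]; simp
      pd_ex_σ := fun z hz => by rw [hpt hSsm ex z hz]; simp
      pd_et_τ := fun z hz => by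
        rw [hpt hT et z hz]
        simp only [one_mul]
        exact (hS2 _ (hfm z hz).1).symm }
  have hΦz : ∀ z ∈ D₁, proj (Φ (graphPoint u v z)) = (T (tB z), χ z, Y (yB z)) := fun z hz => by
    have := (hform _ _ _ _ _ hz.2).2.2
    rw [graphPoint, this]; rfl
  have hmap : ∀ z ∈ D₁, (T (tB z), χ z, Y (yB z)) ∈ D' := fun z hz => by
    rw [← hΦz z hz]; exact (hm z hz.1).1
  -- The form (*) solved for the old u and v. With χ_t = S' x + X⁰_t and S' = ε T_tt/(2 T_t^{1/2}),
  -- the shift χ_t/(2S) accounts for both lower-order terms of ũ.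
  have hval : ∀ z ∈ D₁, u z = S (tB z) * u' (T (tB z), χ z, Y (yB z)) + pd et χ z / (2 * S (tB z)) ∧
      v z = deriv Y (yB z) * v' (T (tB z), χ z, Y (yB z)) + -(deriv Y (yB z) * V₀ (yB z)) := by
    intro z hz
    obtain ⟨h1, h2, h3⟩ := hform _ _ _ _ _ hz.2
    have h4 := (hm z hz.1).2
    rw [hΦz z hz] at h4
    have h5 : Φ (graphPoint u v z) = _ := h3
    rw [h5] at h4
    simp only [graphPoint, Prod.mk.injEq] at h4
    obtain ⟨-, -, -, hu4, hv4⟩ := h4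
    constructor
    · rw [← hu4, hpχ et z hz, hdS _ (hfm z hz).1, rpow_three_halves h1]
      have hT2 := sq_rpow_half h1
      simp only [hS]
      change u z = ε * deriv T z.1 ^ (1 / 2 : ℝ) * _ + _ / (2 * (ε * deriv T z.1 ^ (1 / 2 : ℝ)))
      have hspos : 0 < deriv T z.1 ^ (1 / 2 : ℝ) := Real.rpow_pos_of_pos h1 _
      set s := deriv T z.1 ^ (1 / 2 : ℝ)
      rw [← hT2]
      field_simp
      rw [hε2]
      ring
    · rw [← hv4]
      change v z = deriv Y z.2.2 * _ + -(deriv Y z.2.2 * V₀ z.2.2)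
      field_simp
      ring
  have hzD : z ∈ D₁ := ⟨hz, hzΩ⟩
  have ha := hlift_y hY'
  have hb : ContDiffOn ℝ ∞ (fun z => -(deriv Y (yB z) * V₀ (yB z))) D₁ := (ha.mul (hlift_y hV₀)).neg
  have hpb : ∀ w : Base, w.2.2 = 0 → ∀ z ∈ D₁, pd w (fun z => -(deriv Y (yB z) * V₀ (yB z))) z = 0 := by
    intro w hw z hz
    have : ∀ z, -(deriv Y (yB z) * V₀ (yB z)) = (-1) * (deriv Y (yB z) * V₀ (yB z)) := fun z => by ring
    simp only [this]
    rw [pd_const_mul hD1 _ (ha.mul (hlift_y hV₀)) hz, pd_mul hD1 ha (hlift_y hV₀) hz,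
      hpy hY' w z hz, hpy hV₀ w z hz, hw]
    ring
  have k1 := hbc.first_eq hD' hmap (fun z hz => by rw [hpt hT ey z hz]; simp)
    (fun z hz => by rw [hpχ ey z hz]; simp) hu' (fun z hz => (hval z hz).1) z hzD
  obtain ⟨k2, k3⟩ := hbc.second_eq (a := fun z => deriv Y (yB z))
    (b := fun z => -(deriv Y (yB z) * V₀ (yB z))) hD' hmap hv' (fun z hz => (hval z hz).1)
    ha hb (fun z hz => by rw [hpy hY' et z hz]; simp) (fun z hz => by rw [hpy hY' ex z hz]; simp)
    (hpb et rfl) (hpb ex rfl) (fun z hz => (hval z hz).2) z hzD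
  rw [hpy hY ey z hzD] at k1
  rw [hΦz z hzD]
  have hσ0 : S (tB z) ≠ 0 := hS0 _ (hfm z hzD).1
  have hY0 : deriv Y z.2.2 ≠ 0 := (hfm z hzD).2.2.2
  have hY0' : deriv Y (yB z) ≠ 0 := hY0
  refine and_congr ?_ ?_
  · rw [k1, k2]
    change S (tB z) ^ 3 * (1 * deriv Y (yB z)) * _ = 2 * (deriv Y (yB z) * _ * _) ↔ _
    have hne : S (tB z) ^ 3 * deriv Y (yB z) ≠ 0 := mul_ne_zero (pow_ne_zero _ hσ0) hY0'
    constructor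
    · intro h
      apply mul_left_cancel₀ hne
      linear_combination h
    · intro h
      linear_combination (S (tB z) ^ 3 * deriv Y (yB z)) * h
  · have hne : deriv Y (yB z) * S (tB z) ^ 2 ≠ 0 := mul_ne_zero hY0' (pow_ne_zero _ hσ0)
    constructor
    · intro h
      rw [h, sub_self] at k3
      have := (mul_eq_zero.1 k3.symm).resolve_left hne
      linarith
    · intro h
      rw [h, sub_self, mul_zero] at k3
      linarith

/-- The coordinate `x` on the total space. -/
abbrev xT : Total →L[ℝ] ℝ :=
  (ContinuousLinearMap.fst ℝ ℝ (ℝ × ℝ × ℝ)).comp (ContinuousLinearMap.snd ℝ ℝ (ℝ × ℝ × ℝ × ℝ))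

/-- The coordinate `u` on the total space. -/
abbrev uT : Total →L[ℝ] ℝ :=
  (ContinuousLinearMap.fst ℝ ℝ ℝ).comp ((ContinuousLinearMap.snd ℝ ℝ (ℝ × ℝ)).comp
    ((ContinuousLinearMap.snd ℝ ℝ (ℝ × ℝ × ℝ)).comp (ContinuousLinearMap.snd ℝ ℝ (ℝ × ℝ × ℝ × ℝ))))

/-- The coordinate `v` on the total space. -/
abbrev vT : Total →L[ℝ] ℝ :=
  (ContinuousLinearMap.snd ℝ ℝ ℝ).comp ((ContinuousLinearMap.snd ℝ ℝ (ℝ × ℝ)).comp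
    ((ContinuousLinearMap.snd ℝ ℝ (ℝ × ℝ × ℝ)).comp (ContinuousLinearMap.snd ℝ ℝ (ℝ × ℝ × ℝ × ℝ))))

/-- The Jacobian is nonsingular by triangularity: for a vector in its kernel, the components t̃ and
ỹ force the t- and y-entries to vanish, after which x̃, ũ and ṽ kill the x-, u- and v-entries. -/
theorem isPointTransformation_of_hasForm {Ω : Set Total} {Φ : Total → Total} (hΩ : IsOpen Ω)
    (hΦ : HasForm Ω Φ) : IsPointTransformation Ω Φ := by
  obtain ⟨ε, T, X₀, Y, V₀, hε, hT, hX₀, hY, hV₀, hform⟩ := hΦ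
  have hI := isOpen_image_tT hΩ
  have hJ := isOpen_image_yT hΩ
  set I := (fun p : Total => p.1) '' Ω
  set J := (fun p : Total => p.2.2.1) '' Ω
  have hε0 : ε ≠ 0 := by rcases hε with rfl | rfl <;> norm_num
  have hT' : ContDiffOn ℝ ∞ (deriv T) I := hT.deriv_of_isOpen hI (by simp)
  have hT'' : ContDiffOn ℝ ∞ (deriv (deriv T)) I := hT'.deriv_of_isOpen hI (by simp)
  have hX₀' : ContDiffOn ℝ ∞ (deriv X₀) I := hX₀.deriv_of_isOpen hI (by simp)
  have hY' : ContDiffOn ℝ ∞ (deriv Y) J := hY.deriv_of_isOpen hJ (by simp)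
  have hT'pos : ∀ t ∈ I, 0 < deriv T t := by
    rintro _ ⟨⟨t, x, y, a, b⟩, hp, rfl⟩
    exact (hform _ _ _ _ _ hp).1
  have hY'ne : ∀ y ∈ J, deriv Y y ≠ 0 := by
    rintro _ ⟨⟨t, x, y, a, b⟩, hp, rfl⟩
    exact (hform _ _ _ _ _ hp).2.1
  have hmt : ∀ p ∈ Ω, tT p ∈ I := fun p hp => ⟨p, hp, rfl⟩
  have hmy : ∀ p ∈ Ω, yT p ∈ J := fun p hp => ⟨p, hp, rfl⟩
  set S : ℝ → ℝ := fun t => ε * deriv T t ^ (1 / 2 : ℝ) with hS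
  set A : ℝ → ℝ := fun t => ε / deriv T t ^ (1 / 2 : ℝ) with hA
  set B : ℝ → ℝ := fun t => ε * deriv (deriv T) t / (4 * deriv T t ^ (3 / 2 : ℝ)) with hB
  set C : ℝ → ℝ := fun t => deriv X₀ t / (2 * deriv T t) with hC
  set K : ℝ → ℝ := fun y => (deriv Y y)⁻¹ with hK
  have hS0 : ∀ t ∈ I, S t ≠ 0 := fun t ht =>
    mul_ne_zero hε0 (Real.rpow_pos_of_pos (hT'pos t ht) _).ne'
  have hA0 : ∀ t ∈ I, A t ≠ 0 := fun t ht =>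
    div_ne_zero hε0 (Real.rpow_pos_of_pos (hT'pos t ht) _).ne'
  have hSsm : ContDiffOn ℝ ∞ S I :=
    contDiffOn_const.mul (hT'.rpow_const_of_ne fun t ht => (hT'pos t ht).ne')
  have hAsm : ContDiffOn ℝ ∞ A I :=
    contDiffOn_const.div (hT'.rpow_const_of_ne fun t ht => (hT'pos t ht).ne')
      fun t ht => (Real.rpow_pos_of_pos (hT'pos t ht) _).ne'
  have hBsm : ContDiffOn ℝ ∞ B I :=
    (contDiffOn_const.mul hT'').div
      (contDiffOn_const.mul (hT'.rpow_const_of_ne fun t ht => (hT'pos t ht).ne'))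
      fun t ht => mul_ne_zero four_ne_zero (Real.rpow_pos_of_pos (hT'pos t ht) _).ne'
  have hCsm : ContDiffOn ℝ ∞ C I :=
    hX₀'.div (contDiffOn_const.mul hT') fun t ht => mul_ne_zero two_ne_zero (hT'pos t ht).ne'
  have hKsm : ContDiffOn ℝ ∞ K J := hY'.inv hY'ne
  have lt : ∀ {g : ℝ → ℝ}, ContDiffOn ℝ ∞ g I → ContDiffOn ℝ ∞ (fun p : Total => g (tT p)) Ω :=
    fun hg => hg.comp tT.contDiff.contDiffOn hmt
  have ly : ∀ {g : ℝ → ℝ}, ContDiffOn ℝ ∞ g J → ContDiffOn ℝ ∞ (fun p : Total => g (yT p)) Ω :=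
    fun hg => hg.comp yT.contDiff.contDiffOn hmy
  have hL : ∀ L : Total →L[ℝ] ℝ, ContDiffOn ℝ ∞ (fun p => L p) Ω := fun L => L.contDiff.contDiffOn
  have e1 : ∀ p ∈ Ω, (Φ p).1 = T (tT p) := fun p hp => by
    rw [show Φ p = _ from (hform _ _ _ _ _ hp).2.2]; rfl
  have e2 : ∀ p ∈ Ω, (Φ p).2.1 = S (tT p) * xT p + X₀ (tT p) := fun p hp => by
    rw [show Φ p = _ from (hform _ _ _ _ _ hp).2.2]; rfl
  have e3 : ∀ p ∈ Ω, (Φ p).2.2.1 = Y (yT p) := fun p hp => by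
    rw [show Φ p = _ from (hform _ _ _ _ _ hp).2.2]; rfl
  have e4 : ∀ p ∈ Ω, (Φ p).2.2.2.1 = A (tT p) * uT p - B (tT p) * xT p - C (tT p) :=
    fun p hp => by
      rw [show Φ p = _ from (hform _ _ _ _ _ hp).2.2]; rfl
  have e5 : ∀ p ∈ Ω, (Φ p).2.2.2.2 = K (yT p) * vT p + V₀ (yT p) := fun p hp => by
    rw [show Φ p = _ from (hform _ _ _ _ _ hp).2.2, hK, inv_mul_eq_div]; rfl
  have s1 := lt hT
  have s2 : ContDiffOn ℝ ∞ (fun p => S (tT p) * xT p + X₀ (tT p)) Ω :=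
    ((lt hSsm).mul (hL xT)).add (lt hX₀)
  have s3 := ly hY
  have s4 : ContDiffOn ℝ ∞ (fun p => A (tT p) * uT p - B (tT p) * xT p - C (tT p)) Ω :=
    (((lt hAsm).mul (hL uT)).sub ((lt hBsm).mul (hL xT))).sub (lt hCsm)
  have s5 : ContDiffOn ℝ ∞ (fun p => K (yT p) * vT p + V₀ (yT p)) Ω :=
    ((ly hKsm).mul (hL vT)).add (ly hV₀)
  have hsm : ContDiffOn ℝ ∞ Φ Ω :=
    (s1.prodMk (s2.prodMk (s3.prodMk (s4.prodMk s5)))).congr fun p hp => by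
      rw [← e1 p hp, ← e2 p hp, ← e3 p hp, ← e4 p hp, ← e5 p hp]
  refine ⟨hΩ, hsm, fun p hp h0 => ?_⟩
  obtain ⟨w, hw, hw0⟩ := (Submodule.ne_bot_iff _).1 (LinearMap.bot_lt_ker_of_det_eq_zero h0).ne'
  apply hw0
  have hw' : fderiv ℝ Φ p w = 0 := hw
  rw [fderiv_total_eq (differentiableAt_of_mem hΩ hsm hp)] at hw'
  simp only [Prod.mk_eq_zero] at hw'
  obtain ⟨q1, q2, q3, q4, q5⟩ := hw'
  rw [pd_congr hΩ w e1 p hp, pd_comp_clm tT (differentiableAt_of_mem hI hT (hmt p hp))] at q1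
  rw [pd_congr hΩ w e3 p hp, pd_comp_clm yT (differentiableAt_of_mem hJ hY (hmy p hp))] at q3
  have w1 : tT w = 0 := (mul_eq_zero.1 q1).resolve_right (hT'pos _ (hmt p hp)).ne'
  have w3 : yT w = 0 := (mul_eq_zero.1 q3).resolve_right (hY'ne _ (hmy p hp))
  have zt : ∀ {g : ℝ → ℝ}, ContDiffOn ℝ ∞ g I → pd w (fun p : Total => g (tT p)) p = 0 :=
    fun hg => by rw [pd_comp_clm tT (differentiableAt_of_mem hI hg (hmt p hp)), w1, zero_mul]
  have zy : ∀ {g : ℝ → ℝ}, ContDiffOn ℝ ∞ g J → pd w (fun p : Total => g (yT p)) p = 0 :=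
    fun hg => by rw [pd_comp_clm yT (differentiableAt_of_mem hJ hg (hmy p hp)), w3, zero_mul]
  rw [pd_congr hΩ w e2 p hp, pd_add hΩ ((lt hSsm).mul (hL xT)) (lt hX₀) hp,
    pd_mul hΩ (lt hSsm) (hL xT) hp, zt hSsm, zt hX₀, pd_clm, mul_zero, add_zero, add_zero] at q2
  have w2 : xT w = 0 := (mul_eq_zero.1 q2).resolve_left (hS0 _ (hmt p hp))
  rw [pd_congr hΩ w e4 p hp,
    pd_sub hΩ (((lt hAsm).mul (hL uT)).sub ((lt hBsm).mul (hL xT))) (lt hCsm) hp,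
    pd_sub hΩ ((lt hAsm).mul (hL uT)) ((lt hBsm).mul (hL xT)) hp,
    pd_mul hΩ (lt hAsm) (hL uT) hp, pd_mul hΩ (lt hBsm) (hL xT) hp, zt hAsm, zt hBsm, zt hCsm,
    pd_clm, pd_clm, w2] at q4
  simp only [mul_zero, add_zero, sub_zero] at q4
  have w4 : uT w = 0 := (mul_eq_zero.1 q4).resolve_left (hA0 _ (hmt p hp))
  rw [pd_congr hΩ w e5 p hp, pd_add hΩ ((ly hKsm).mul (hL vT)) (ly hV₀) hp,
    pd_mul hΩ (ly hKsm) (hL vT) hp, zy hKsm, zy hV₀, pd_clm, mul_zero, add_zero, add_zero] at q5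
  have w5 : vT w = 0 := (mul_eq_zero.1 q5).resolve_left (inv_ne_zero (hY'ne _ (hmy p hp)))
  exact Prod.ext w1 (Prod.ext w2 (Prod.ext w3 (Prod.ext w4 w5)))

/-- A map that is of the stated form near every point is a point symmetry. -/
theorem isPointSymmetry_of_locally_hasForm {Ω : Set Total} {Φ : Total → Total} (hΩ : IsOpen Ω)
    (h : ∀ p ∈ Ω, ∃ Ω' : Set Total, IsOpen Ω' ∧ p ∈ Ω' ∧ Ω' ⊆ Ω ∧ HasForm Ω' Φ) :
    IsPointSymmetry Ω Φ where
  isOpen := hΩ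
  smooth p hp := by
    obtain ⟨Ω', ho, hpΩ', -, hf⟩ := h p hp
    exact (contDiffAt_of_mem ho (isPointTransformation_of_hasForm ho hf).smooth
      hpΩ').contDiffWithinAt
  jacobian_ne_zero p hp := by
    obtain ⟨Ω', ho, hpΩ', -, hf⟩ := h p hp
    exact (isPointTransformation_of_hasForm ho hf).jacobian_ne_zero p hpΩ'
  solves_iff D D' u v u' v' hD hD' hu hv hu' hv' hg him := by
    have hm : ∀ z ∈ D, proj (Φ (graphPoint u v z)) ∈ D' ∧
        Φ (graphPoint u v z) = graphPoint u' v' (proj (Φ (graphPoint u v z))) := by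
      intro z hz
      obtain ⟨z', hz', he⟩ : Φ (graphPoint u v z) ∈ graphPoint u' v' '' D' :=
        him ▸ ⟨z, hz, rfl⟩
      rw [← he]
      exact ⟨hz', rfl⟩
    have key : ∀ z ∈ D, SolvesAt u v z ↔ SolvesAt u' v' (proj (Φ (graphPoint u v z))) := by
      intro z hz
      obtain ⟨Ω', ho, hpΩ', -, hf⟩ := h _ (hg z hz)
      exact solvesAt_iff_of_hasForm ho hf hD hD' hu hv hu' hv' hm hz hpΩ'
    rw [solvesOn_iff hD hu, solvesOn_iff hD' hu']
    constructor
    · intro hs z' hz'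
      obtain ⟨z, hz, he⟩ : graphPoint u' v' z' ∈ (fun z => Φ (graphPoint u v z)) '' D :=
        him ▸ ⟨z', hz', rfl⟩
      have : proj (Φ (graphPoint u v z)) = z' := by simp only at he; rw [he]; rfl
      exact this ▸ (key z hz).1 (hs z hz)
    · intro hs z hz
      exact (key z hz).2 (hs _ (hm z hz).1)

/-! ### Local inversion, and transfer of solutions through a symmetry. -/

/-- A smooth map between spaces of the same dimension is a local diffeomorphism near a point where
its derivative is injective. -/
theorem exists_local_inverse {D : Set Base} {φ : Base → Base} {z₀ : Base} (hD : IsOpen D)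
    (hφ : ContDiffOn ℝ ∞ φ D) (hz₀ : z₀ ∈ D) (hinj : ∀ w, fderiv ℝ φ z₀ w = 0 → w = 0) :
    ∃ D₁ ⊆ D, IsOpen D₁ ∧ z₀ ∈ D₁ ∧ IsOpen (φ '' D₁) ∧
      ∃ ψ : Base → Base, ContDiffOn ℝ ∞ ψ (φ '' D₁) ∧ ∀ z ∈ D₁, ψ (φ z) = z := by
  have hdet : ∀ {A : Base →L[ℝ] Base}, (∀ w, A w = 0 → w = 0) → A.det ≠ 0 := by
    intro A hA h0
    obtain ⟨w, hw, hw0⟩ := (Submodule.ne_bot_iff _).1 (LinearMap.bot_lt_ker_of_det_eq_zero h0).ne'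
    exact hw0 (hA w hw)
  set f₀ := ContinuousLinearMap.toContinuousLinearEquivOfDetNeZero _ (hdet hinj) with hf₀
  have hfd : HasFDerivAt φ (f₀ : Base →L[ℝ] Base) z₀ := by
    rw [hf₀, ContinuousLinearMap.coe_toContinuousLinearEquivOfDetNeZero]
    exact (differentiableAt_of_mem hD hφ hz₀).hasFDerivAt
  set e := (contDiffAt_of_mem hD hφ hz₀).toOpenPartialHomeomorph φ hfd (by simp) with he
  have hsrc : z₀ ∈ e.source :=
    (contDiffAt_of_mem hD hφ hz₀).mem_toOpenPartialHomeomorph_source hfd (by simp)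
  -- Smoothness of the inverse at every image point requires an invertible derivative at its
  -- preimage, so the source is cut down to the open set where the determinant does not vanish.
  have hcont : ContinuousOn (fun z => (fderiv ℝ φ z).det) D :=
    ContinuousLinearMap.continuous_det.comp_continuousOn
      (hφ.continuousOn_fderiv_of_isOpen hD (by simp))
  have hU : IsOpen (D ∩ (fun z => (fderiv ℝ φ z).det) ⁻¹' {0}ᶜ) :=
    hcont.isOpen_inter_preimage hD isOpen_compl_singleton
  set D₁ := e.source ∩ (D ∩ (fun z => (fderiv ℝ φ z).det) ⁻¹' {0}ᶜ)
  have hD₁ : IsOpen D₁ := e.open_source.inter hU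
  refine ⟨D₁, fun z hz => hz.2.1, hD₁, ⟨hsrc, hz₀, hdet hinj⟩,
    e.isOpen_image_of_subset_source hD₁ Set.inter_subset_left, e.symm, ?_, fun z hz =>
      e.left_inv hz.1⟩
  rintro _ ⟨z, hz, rfl⟩
  have h1 : e.symm (φ z) = z := e.left_inv hz.1
  have hzd : (fderiv ℝ φ z).det ≠ 0 := hz.2.2
  have h2 : HasFDerivAt e ((ContinuousLinearMap.toContinuousLinearEquivOfDetNeZero _ hzd :
      Base ≃L[ℝ] Base) : Base →L[ℝ] Base) (e.symm (φ z)) := by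
    rw [ContinuousLinearMap.coe_toContinuousLinearEquivOfDetNeZero, h1]
    exact (differentiableAt_of_mem hD hφ hz.2.1).hasFDerivAt
  have h3 : ContDiffAt ℝ ∞ e (e.symm (φ z)) := by
    rw [h1]; exact contDiffAt_of_mem hD hφ hz.2.1
  exact (e.contDiffAt_symm (e.map_source hz.1) h2 h3).contDiffWithinAt

theorem contDiff_proj : ContDiff ℝ ∞ proj := by
  unfold proj
  fun_prop

section Transfer

variable {Ω : Set Total} {Φ : Total → Total} {D : Set Base} {u v : Base → ℝ} {z₀ : Base}

/-- The image of a solution under a point symmetry, where the image of the graph is a graph. -/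
theorem IsPointSymmetry.exists_image (hΦ : IsPointSymmetry Ω Φ) (hD : IsOpen D)
    (hu : ContDiffOn ℝ ∞ u D) (hv : ContDiffOn ℝ ∞ v D) (hs : ∀ z ∈ D, SolvesAt u v z)
    (hz₀ : z₀ ∈ D) (hp : graphPoint u v z₀ ∈ Ω)
    (hinj : ∀ w, fderiv ℝ (fun z => proj (Φ (graphPoint u v z))) z₀ w = 0 → w = 0) :
    ∃ D₁ ⊆ D, IsOpen D₁ ∧ z₀ ∈ D₁ ∧ (∀ z ∈ D₁, graphPoint u v z ∈ Ω) ∧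
      ∃ (D' : Set Base) (u' v' : Base → ℝ), IsOpen D' ∧ ContDiffOn ℝ ∞ u' D' ∧
        ContDiffOn ℝ ∞ v' D' ∧ (∀ z ∈ D', SolvesAt u' v' z) ∧
        ∀ z ∈ D₁, proj (Φ (graphPoint u v z)) ∈ D' ∧
          Φ (graphPoint u v z) = graphPoint u' v' (proj (Φ (graphPoint u v z))) := by
  have hD2 := isOpen_graph_preimage hD hΦ.isOpen hu hv
  set D₂ := D ∩ graphPoint u v ⁻¹' Ω
  have hG : ContDiffOn ℝ ∞ (fun z => Φ (graphPoint u v z)) D₂ :=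
    hΦ.smooth.comp ((graphPoint_contDiffOn hu hv).mono Set.inter_subset_left) fun z hz => hz.2
  obtain ⟨D₁, hsub, hD₁, hz₁, hD', ψ, hψ, hinv⟩ := exists_local_inverse hD2
    (contDiff_proj.comp_contDiffOn hG) ⟨hz₀, hp⟩ hinj
  have hψm : ∀ z' ∈ (proj ∘ fun z => Φ (graphPoint u v z)) '' D₁, ψ z' ∈ D₂ := by
    rintro _ ⟨z, hz, rfl⟩
    rw [hinv z hz]
    exact hsub hz
  have hGψ := hG.comp hψ hψm
  have hu' : ContDiffOn ℝ ∞ (fun z' => (Φ (graphPoint u v (ψ z'))).2.2.2.1)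
      ((proj ∘ fun z => Φ (graphPoint u v z)) '' D₁) := hGψ.snd.snd.snd.fst
  have hv' : ContDiffOn ℝ ∞ (fun z' => (Φ (graphPoint u v (ψ z'))).2.2.2.2)
      ((proj ∘ fun z => Φ (graphPoint u v z)) '' D₁) := hGψ.snd.snd.snd.snd
  have hgr : ∀ z ∈ D₁, Φ (graphPoint u v z) =
      graphPoint (fun z' => (Φ (graphPoint u v (ψ z'))).2.2.2.1)
        (fun z' => (Φ (graphPoint u v (ψ z'))).2.2.2.2) (proj (Φ (graphPoint u v z))) := by
    intro z hz
    have h1 : ψ (proj (Φ (graphPoint u v z))) = z := hinv z hz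
    simp only [graphPoint] at h1 ⊢
    simp only [h1]
    rfl
  refine ⟨D₁, fun z hz => (hsub hz).1, hD₁, hz₁, fun z hz => (hsub hz).2, _, _, _, hD', hu', hv',
    ?_, fun z hz => ⟨⟨z, hz, rfl⟩, hgr z hz⟩⟩
  have huD := hu.mono (fun z hz => (hsub hz).1 : D₁ ⊆ D)
  have hvD := hv.mono (fun z hz => (hsub hz).1 : D₁ ⊆ D)
  refine (solvesOn_iff hD' hu').1 ((hΦ.solves_iff D₁ _ u v _ _ hD₁ hD' huD hvD hu' hv'
    (fun z hz => (hsub hz).2) ?_).1 ((solvesOn_iff hD₁ huD).2 fun z hz => hs z (hsub hz).1))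
  rw [Set.image_image]
  exact Set.image_congr hgr

/-- The preimage of a solution under a point symmetry is a solution. -/
theorem IsPointSymmetry.solvesAt_of_image (hΦ : IsPointSymmetry Ω Φ) (hD : IsOpen D)
    (hu : ContDiffOn ℝ ∞ u D) (hv : ContDiffOn ℝ ∞ v D) (hg : ∀ z ∈ D, graphPoint u v z ∈ Ω)
    (hz₀ : z₀ ∈ D)
    (hinj : ∀ w, fderiv ℝ (fun z => proj (Φ (graphPoint u v z))) z₀ w = 0 → w = 0)
    {u' v' : Base → ℝ} (hu' : ContDiff ℝ ∞ u') (hv' : ContDiff ℝ ∞ v')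
    (hs : ∀ z, SolvesAt u' v' z)
    (hgr : ∀ z ∈ D, Φ (graphPoint u v z) = graphPoint u' v' (proj (Φ (graphPoint u v z)))) :
    SolvesAt u v z₀ := by
  have hG : ContDiffOn ℝ ∞ (fun z => Φ (graphPoint u v z)) D :=
    hΦ.smooth.comp (graphPoint_contDiffOn hu hv) hg
  obtain ⟨D₁, hsub, hD₁, hz₁, hD', -⟩ := exists_local_inverse hD
    (contDiff_proj.comp_contDiffOn hG) hz₀ hinj
  refine (solvesOn_iff hD₁ (hu.mono hsub)).1 ((hΦ.solves_iff D₁ _ u v u' v' hD₁ hD' (hu.mono hsub)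
    (hv.mono hsub) hu'.contDiffOn hv'.contDiffOn (fun z hz => hg z (hsub hz)) ?_).2
    ((solvesOn_iff hD' hu'.contDiffOn).2 fun z _ => hs z)) z₀ hz₁
  rw [Set.image_image]
  exact Set.image_congr fun z hz => hgr z (hsub hz)

end Transfer

/-! ### Frames along graphs, and the second equation at a single point. -/

/-- The direction of the `t`-axis in the total space. -/
abbrev Et : Total := (1, 0, 0, 0, 0)

/-- The direction of the `x`-axis in the total space. -/
abbrev Ex : Total := (0, 1, 0, 0, 0)

/-- The direction of the `y`-axis in the total space. -/
abbrev Ey : Total := (0, 0, 1, 0, 0)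

/-- The direction of the `u`-axis. -/
abbrev Eu : Total := (0, 0, 0, 1, 0)

/-- The direction of the `v`-axis. -/
abbrev Ev : Total := (0, 0, 0, 0, 1)

theorem pd_total (w : Total) (f : Total → ℝ) (p : Total) :
    pd w f p = w.1 * pd Et f p + w.2.1 * pd Ex f p + w.2.2.1 * pd Ey f p + w.2.2.2.1 * pd Eu f p
      + w.2.2.2.2 * pd Ev f p := by
  have : w = w.1 • Et + w.2.1 • Ex + w.2.2.1 • Ey + w.2.2.2.1 • Eu + w.2.2.2.2 • Ev := by
    ext <;> simp
  conv_lhs => rw [this]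
  simp only [pd_add_dir, pd_smul_dir]

theorem pd_base (w : Base) (f : Base → ℝ) (z : Base) :
    pd w f z = w.1 * pd et f z + w.2.1 * pd ex f z + w.2.2 * pd ey f z := by
  have : w = w.1 • et + w.2.1 • ex + w.2.2 • ey := by
    ext <;> simp
  conv_lhs => rw [this]
  simp only [pd_add_dir, pd_smul_dir]

section Components

variable (Φ : Total → Total)

/-- The component `t̃` of a transformation. -/
def cT : Total → ℝ := fun q => (Φ q).1

/-- The component `x̃` of a transformation. -/
def cX : Total → ℝ := fun q => (Φ q).2.1

/-- The component `ỹ` of a transformation. -/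
def cY : Total → ℝ := fun q => (Φ q).2.2.1

/-- The component `ũ` of a transformation. -/
def cU : Total → ℝ := fun q => (Φ q).2.2.2.1

/-- The component `ṽ` of a transformation. -/
def cV : Total → ℝ := fun q => (Φ q).2.2.2.2

end Components

section Smooth

variable {Ω : Set Total} {Φ : Total → Total}

theorem contDiffOn_cT (h : ContDiffOn ℝ ∞ Φ Ω) : ContDiffOn ℝ ∞ (cT Φ) Ω := h.fst

theorem contDiffOn_cX (h : ContDiffOn ℝ ∞ Φ Ω) : ContDiffOn ℝ ∞ (cX Φ) Ω := h.snd.fst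

theorem contDiffOn_cY (h : ContDiffOn ℝ ∞ Φ Ω) : ContDiffOn ℝ ∞ (cY Φ) Ω := h.snd.snd.fst

theorem contDiffOn_cV (h : ContDiffOn ℝ ∞ Φ Ω) : ContDiffOn ℝ ∞ (cV Φ) Ω := h.snd.snd.snd.snd

end Smooth

/-- The lift of a tangent vector of the base to a graph with the differentials `α`, `β` of its two
components. -/
def lift (α β : Base → ℝ) (w : Base) : Total := (w.1, w.2.1, w.2.2, α w, β w)

theorem pd_comp {E F : Type*} [NormedAddCommGroup E] [NormedSpace ℝ E] [NormedAddCommGroup F]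
    [NormedSpace ℝ F] {h : F → ℝ} {G : E → F} {z : E} (hh : DifferentiableAt ℝ h (G z))
    (hG : DifferentiableAt ℝ G z) (w : E) :
    pd w (fun z => h (G z)) z = pd (fderiv ℝ G z w) h (G z) := by
  change fderiv ℝ (h ∘ G) z w = _
  rw [fderiv_comp z hh hG]
  rfl

theorem fderiv_graphPoint {D : Set Base} {u v : Base → ℝ} (hD : IsOpen D)
    (hu : ContDiffOn ℝ ∞ u D) (hv : ContDiffOn ℝ ∞ v D) (w : Base) {z : Base} (hz : z ∈ D) :
    fderiv ℝ (graphPoint u v) z w = lift (fun w => pd w u z) (fun w => pd w v z) w := by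
  rw [fderiv_total_eq (differentiableAt_of_mem hD (graphPoint_contDiffOn hu hv) hz)]
  exact Prod.ext (pd_clm tB w z) (Prod.ext (pd_clm xB w z) (Prod.ext (pd_clm yB w z) rfl))

/-- The first three components of a graph are linear in the base point, so only u and v contribute
second derivatives. -/
theorem fderiv_fderiv_graphPoint {D : Set Base} {u v : Base → ℝ} (hD : IsOpen D)
    (hu : ContDiffOn ℝ ∞ u D) (hv : ContDiffOn ℝ ∞ v D) (w : Base) {z : Base} (hz : z ∈ D) :
    fderiv ℝ (fun z => fderiv ℝ (graphPoint u v) z w) z w =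
      pd w (pd w u) z • Eu + pd w (pd w v) z • Ev := by
  have hd : DifferentiableAt ℝ (fun z => fderiv ℝ (graphPoint u v) z w) z :=
    differentiableAt_of_mem hD
      (((graphPoint_contDiffOn hu hv).fderiv_of_isOpen hD (m := ∞) (by simp)).clm_apply
        contDiffOn_const) hz
  have hl : ∀ z ∈ D, fderiv ℝ (graphPoint u v) z w =
    lift (fun w => pd w u z) (fun w => pd w v z) w := fun z hz => fderiv_graphPoint hD hu hv w hz
  rw [fderiv_total_eq hd]
  have h1 := pd_congr hD w (f := fun q => (fderiv ℝ (graphPoint u v) q w).1) (g := fun _ => w.1)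
    (fun q hq => by rw [hl q hq]; rfl) z hz
  have h2 := pd_congr hD w (f := fun q => (fderiv ℝ (graphPoint u v) q w).2.1) (g := fun _ => w.2.1)
    (fun q hq => by rw [hl q hq]; rfl) z hz
  have h3 := pd_congr hD w (f := fun q => (fderiv ℝ (graphPoint u v) q w).2.2.1)
    (g := fun _ => w.2.2) (fun q hq => by rw [hl q hq]; rfl) z hz
  have h4 := pd_congr hD w (f := fun q => (fderiv ℝ (graphPoint u v) q w).2.2.2.1)
    (g := pd w u) (fun q hq => by rw [hl q hq]; rfl) z hz
  have h5 := pd_congr hD w (f := fun q => (fderiv ℝ (graphPoint u v) q w).2.2.2.2)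
    (g := pd w v) (fun q hq => by rw [hl q hq]; rfl) z hz
  rw [h1, h2, h3, h4, h5, pd_const, pd_const, pd_const]
  simp

/-- The function `ṽ - a t̃ - b x̃ - c ỹ`. -/
def defect (Φ : Total → Total) (a b c : ℝ) : Total → ℝ :=
  fun q => cV Φ q - (a * cT Φ q + b * cX Φ q + c * cY Φ q)

theorem contDiffOn_defect {Ω : Set Total} {Φ : Total → Total} (h : ContDiffOn ℝ ∞ Φ Ω) (a b c : ℝ) :
    ContDiffOn ℝ ∞ (defect Φ a b c) Ω :=
  (contDiffOn_cV h).sub (((contDiffOn_const.mul (contDiffOn_cT h)).add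
    (contDiffOn_const.mul (contDiffOn_cX h))).add (contDiffOn_const.mul (contDiffOn_cY h)))

theorem pd_defect {Ω : Set Total} {Φ : Total → Total} (hΩ : IsOpen Ω) (h : ContDiffOn ℝ ∞ Φ Ω)
    (a b c : ℝ) (w : Total) : ∀ p ∈ Ω, pd w (defect Φ a b c) p =
      pd w (cV Φ) p - (a * pd w (cT Φ) p + b * pd w (cX Φ) p + c * pd w (cY Φ) p) := by
  intro p hp
  have h1 : ContDiffOn ℝ ∞ (fun q => a * cT Φ q) Ω := contDiffOn_const.mul (contDiffOn_cT h)
  have h2 : ContDiffOn ℝ ∞ (fun q => b * cX Φ q) Ω := contDiffOn_const.mul (contDiffOn_cX h)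
  have h3 : ContDiffOn ℝ ∞ (fun q => c * cY Φ q) Ω := contDiffOn_const.mul (contDiffOn_cY h)
  unfold defect
  rw [pd_sub hΩ (contDiffOn_cV h) ((h1.add h2).add h3) hp, pd_add hΩ (h1.add h2) h3 hp,
    pd_add hΩ h1 h2 hp, pd_const_mul hΩ a (contDiffOn_cT h) hp,
    pd_const_mul hΩ b (contDiffOn_cX h) hp, pd_const_mul hΩ c (contDiffOn_cY h) hp]

/-- The relations satisfied at `p` by the vector `ξ = ∂/∂x̃` and the first derivatives
`a`, `b`, `c` of `ṽ` along the image of a graph whose components have the differentials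
`α`, `β`. -/
structure IsFrame (Φ : Total → Total) (p : Total) (α β : Base → ℝ) (ξ : Base) (a b c : ℝ) :
    Prop where
  inj : ∀ w, pd (lift α β w) (cT Φ) p = 0 → pd (lift α β w) (cX Φ) p = 0 →
    pd (lift α β w) (cY Φ) p = 0 → w = 0
  pd_T : pd (lift α β ξ) (cT Φ) p = 0
  pd_X : pd (lift α β ξ) (cX Φ) p = 1
  pd_Y : pd (lift α β ξ) (cY Φ) p = 0
  pd_V : ∀ w, pd (lift α β w) (cV Φ) p =
    a * pd (lift α β w) (cT Φ) p + b * pd (lift α β w) (cX Φ) p + c * pd (lift α β w) (cY Φ) p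

/-- The second equation of the system in the new variables, written in the old ones. -/
theorem IsPointSymmetry.second_order_identity {Ω : Set Total} {Φ : Total → Total}
    (hΦ : IsPointSymmetry Ω Φ) {D : Set Base} {u v : Base → ℝ} (hD : IsOpen D)
    (hu : ContDiffOn ℝ ∞ u D) (hv : ContDiffOn ℝ ∞ v D) (hs : ∀ z ∈ D, SolvesAt u v z)
    {z₀ : Base} (hz₀ : z₀ ∈ D) {p : Total} (hp : p ∈ Ω) (hgp : graphPoint u v z₀ = p)
    {ξ : Base} {a b c : ℝ}
    (hF : IsFrame Φ p (fun w => pd w u z₀) (fun w => pd w v z₀) ξ a b c) :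
    a = pd (lift (fun w => pd w u z₀) (fun w => pd w v z₀) ξ)
          (pd (lift (fun w => pd w u z₀) (fun w => pd w v z₀) ξ) (defect Φ a b c)) p
        + pd Eu (defect Φ a b c) p * pd ξ (pd ξ u) z₀
        + pd Ev (defect Φ a b c) p * pd ξ (pd ξ v) z₀ + 2 * cU Φ p * b := by
  subst hgp
  have hΩ := hΦ.isOpen
  have hsm := hΦ.smooth
  have hdf := contDiffOn_defect hsm a b c
  set j := lift (fun w => pd w u z₀) (fun w => pd w v z₀) with hj
  set p := graphPoint u v z₀ with hpdef
  have hGd := differentiableAt_of_mem hD (graphPoint_contDiffOn hu hv) hz₀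
  have hjG : ∀ w, fderiv ℝ (graphPoint u v) z₀ w = j w := fun w => fderiv_graphPoint hD hu hv w hz₀
  have hφc : ∀ {c : Total → ℝ}, ContDiffOn ℝ ∞ c Ω → ∀ w,
      pd w (fun z => c (graphPoint u v z)) z₀ = pd (j w) c p := fun hc w => by
    rw [← hjG]
    exact pd_comp (G := graphPoint u v) (differentiableAt_of_mem hΩ hc hp) hGd w
  have hφd : DifferentiableAt ℝ (fun z => proj (Φ (graphPoint u v z))) z₀ :=
    ((contDiff_proj.differentiable (by simp)).differentiableAt).comp z₀
      ((differentiableAt_of_mem hΩ hsm hp).comp z₀ hGd)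
  have hφ' : ∀ w, fderiv ℝ (fun z => proj (Φ (graphPoint u v z))) z₀ w =
      (pd (j w) (cT Φ) p, pd (j w) (cX Φ) p, pd (j w) (cY Φ) p) := by
    intro w
    rw [fderiv_base_eq hφd, ← hφc (contDiffOn_cT hsm), ← hφc (contDiffOn_cX hsm),
      ← hφc (contDiffOn_cY hsm)]
    rfl
  have hinj : ∀ w, fderiv ℝ (fun z => proj (Φ (graphPoint u v z))) z₀ w = 0 → w = 0 := by
    intro w hw
    rw [hφ', Prod.mk_eq_zero, Prod.mk_eq_zero] at hw
    exact hF.inj w hw.1 hw.2.1 hw.2.2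
  obtain ⟨D₁, hsub, hD₁, hz₁, hgΩ, D', u', v', hD', hu', hv', hs', hgr⟩ :=
    hΦ.exists_image hD hu hv hs hz₀ hp hinj
  set φ : Base → Base := fun z => proj (Φ (graphPoint u v z)) with hφ
  have hφsm : ContDiffOn ℝ ∞ φ D₁ := contDiff_proj.comp_contDiffOn
    (hsm.comp (graphPoint_contDiffOn (hu.mono hsub) (hv.mono hsub)) hgΩ)
  -- Removing from v' the linear form with coefficients a, b, c makes its differential vanish at the
  -- image point, so the second-order chain rule loses the term containing second derivatives of φ.
  set L : Base →L[ℝ] ℝ := a • tB + b • xB + c • yB with hL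
  have hLsm : ContDiffOn ℝ ∞ (fun z => L z) D' := L.contDiff.contDiffOn
  set g : Base → ℝ := fun z => v' z - L z with hg
  have hgsm : ContDiffOn ℝ ∞ g D' := hv'.sub hLsm
  have hfg : ∀ z ∈ D₁, defect Φ a b c (graphPoint u v z) = g (φ z) := by
    intro z hz
    have h1 : (Φ (graphPoint u v z)).2.2.2.2 = v' (φ z) := by
      conv_lhs => rw [(hgr z hz).2]
      rfl
    simp only [defect, cV, h1, hg]
    rfl
  have hpg : ∀ w, ∀ z ∈ D', pd w g z = pd w v' z - L w := by
    intro w z hz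
    rw [hg, pd_sub hD' hv' hLsm hz, pd_clm]
  have hφz : φ z₀ ∈ D' := (hgr z₀ hz₁).1
  -- Every direction at the image point comes from the source, where the frame relation `pd_V` says
  -- that the defect is stationary along the graph.
  have hg0 : ∀ w', pd w' g (φ z₀) = 0 := by
    have hsurj : Function.Surjective (fderiv ℝ φ z₀ : Base →ₗ[ℝ] Base) :=
      LinearMap.injective_iff_surjective.1 ((injective_iff_map_eq_zero _).2 hinj)
    intro w'
    obtain ⟨w, rfl⟩ := hsurj w'
    have h1 : pd w (fun z => g (φ z)) z₀ = pd (fderiv ℝ φ z₀ w) g (φ z₀) :=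
      pd_comp (differentiableAt_of_mem hD' hgsm hφz) hφd w
    have h2 := pd_congr hD₁ w hfg z₀ hz₁
    rw [hφc hdf, pd_defect hΩ hsm a b c (j w) p hp, hF.pd_V w, sub_self] at h2
    exact h1.symm.trans h2.symm
  have hφξ : fderiv ℝ φ z₀ ξ = ex := by
    rw [hφ', hF.pd_T, hF.pd_X, hF.pd_Y]
  have hl : pd ξ (pd ξ (fun z => defect Φ a b c (graphPoint u v z))) z₀ =
      pd (j ξ) (pd (j ξ) (defect Φ a b c)) p + (pd Eu (defect Φ a b c) p * pd ξ (pd ξ u) z₀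
        + pd Ev (defect Φ a b c) p * pd ξ (pd ξ v) z₀) := by
    rw [pd_pd_comp hD₁ hΩ (graphPoint_contDiffOn (hu.mono hsub) (hv.mono hsub)) hdf hgΩ hz₁, hjG,
      fderiv_fderiv_graphPoint hD₁ (hu.mono hsub) (hv.mono hsub) ξ hz₁]
    simp only [map_add, map_smul, smul_eq_mul]
    simp only [pd]
    ring
  have hr : pd ξ (pd ξ (fun z => g (φ z))) z₀ = pd ex (pd ex v') (φ z₀) := by
    rw [pd_pd_comp hD₁ hD' hφsm hgsm (fun z hz => (hgr z hz).1) hz₁, hφξ]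
    have h1 : fderiv ℝ g (φ z₀) = 0 := ContinuousLinearMap.ext hg0
    rw [h1, pd_congr hD' ex (hpg ex) _ hφz,
      pd_sub hD' (contDiffOn_pd hD' ex hv') contDiffOn_const hφz, pd_const]
    simp
  -- The same second derivative along ξ, computed once in the old variables and once as v'_{x̃x̃}.
  have hlr := pd_congr hD₁ ξ (pd_congr hD₁ ξ hfg) z₀ hz₁
  rw [hl, hr] at hlr
  have ht := hpg et _ hφz
  have hx := hpg ex _ hφz
  rw [hg0] at ht hx
  have hLt : L et = a := by simp [hL]
  have hLx : L ex = b := by simp [hL]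
  rw [hLt] at ht
  rw [hLx] at hx
  have hU : u' (φ z₀) = cU Φ p := by
    have : cU Φ p = (graphPoint u' v' (φ z₀)).2.2.2.1 := by
      rw [← (hgr z₀ hz₁).2]; rfl
    rw [this]; rfl
  have heq := (hs' _ hφz).2
  rw [hU] at heq
  have hb : pd ex v' (φ z₀) = b := by linarith
  rw [hb] at heq
  linarith

/-! ### Second-order jets and the explicit solutions. -/

section Jets

variable {E : Type*} [NormedAddCommGroup E] [NormedSpace ℝ E]

/-- The smooth function `f` on `D` has at `z` the value `a` and the first two derivatives `b`, `c`
in the direction `w`. -/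
structure HasJet (D : Set E) (w z : E) (f : E → ℝ) (a b c : ℝ) : Prop where
  smooth : ContDiffOn ℝ ∞ f D
  val : f z = a
  fst : pd w f z = b
  snd : pd w (pd w f) z = c

variable {D : Set E} {w z : E} {f g : E → ℝ} {a b c a' b' c' : ℝ}

theorem HasJet.add (hD : IsOpen D) (hz : z ∈ D) (hf : HasJet D w z f a b c)
    (hg : HasJet D w z g a' b' c') :
    HasJet D w z (fun z => f z + g z) (a + a') (b + b') (c + c') where
  smooth := hf.smooth.add hg.smooth
  val := by rw [hf.val, hg.val]
  fst := by rw [pd_add hD hf.smooth hg.smooth hz, hf.fst, hg.fst]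
  snd := by
    rw [pd_congr hD w (fun z hz => pd_add hD hf.smooth hg.smooth hz) z hz,
      pd_add hD (contDiffOn_pd hD w hf.smooth) (contDiffOn_pd hD w hg.smooth) hz, hf.snd, hg.snd]

theorem HasJet.mul (hD : IsOpen D) (hz : z ∈ D) (hf : HasJet D w z f a b c)
    (hg : HasJet D w z g a' b' c') :
    HasJet D w z (fun z => f z * g z) (a * a') (a * b' + a' * b) (a * c' + 2 * b * b' + a' * c) where
  smooth := hf.smooth.mul hg.smooth
  val := by rw [hf.val, hg.val]
  fst := by rw [pd_mul hD hf.smooth hg.smooth hz, hf.fst, hg.fst, hf.val, hg.val]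
  snd := by
    have h1 := contDiffOn_pd hD w hf.smooth
    have h2 := contDiffOn_pd hD w hg.smooth
    rw [pd_congr hD w (fun z hz => pd_mul hD hf.smooth hg.smooth hz) z hz,
      pd_add hD (hf.smooth.mul h2) (hg.smooth.mul h1) hz, pd_mul hD hf.smooth h2 hz,
      pd_mul hD hg.smooth h1 hz, hf.snd, hg.snd, hf.fst, hg.fst, hf.val, hg.val]
    ring

theorem HasJet.inv (hD : IsOpen D) (hz : z ∈ D) (hf : HasJet D w z f a b c)
    (h0 : ∀ z ∈ D, f z ≠ 0) :
    HasJet D w z (fun z => (f z)⁻¹) a⁻¹ (-b / a ^ 2) (2 * b ^ 2 / a ^ 3 - c / a ^ 2) where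
  smooth := hf.smooth.inv h0
  val := by rw [hf.val]
  fst := by rw [pd_inv hD hf.smooth hz (h0 z hz), hf.fst, hf.val]
  snd := by
    have h1 := contDiffOn_pd hD w hf.smooth
    have hi : ContDiffOn ℝ ∞ (fun z => (f z)⁻¹) D := hf.smooth.inv h0
    have h2 : ∀ z ∈ D, pd w (fun z => (f z)⁻¹) z = (-1) * (pd w f z * ((f z)⁻¹ * (f z)⁻¹)) :=
      fun z hz => by
        rw [pd_inv hD hf.smooth hz (h0 z hz)]
        field_simp
    have ha : a ≠ 0 := hf.val ▸ h0 z hz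
    rw [pd_congr hD w h2 z hz, pd_const_mul hD _ (h1.mul (hi.mul hi)) hz,
      pd_mul hD h1 (hi.mul hi) hz, pd_mul hD hi hi hz, pd_inv hD hf.smooth hz (h0 z hz),
      hf.snd, hf.fst, hf.val]
    field_simp
    ring

theorem HasJet.const (c : ℝ) : HasJet D w z (fun _ => c) c 0 0 where
  smooth := contDiffOn_const
  val := rfl
  fst := pd_const _ _ _
  snd := by
    have : pd w (fun _ : E => c) = fun _ => 0 := funext fun z => pd_const w c z
    rw [this, pd_const]

theorem HasJet.comp_clm (L : E →L[ℝ] ℝ) {h : ℝ → ℝ} (hh : ContDiff ℝ ∞ h) :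
    HasJet D w z (fun z => h (L z)) (h (L z)) (L w * deriv h (L z))
      (L w * (L w * deriv (deriv h) (L z))) := by
  have h' : ContDiff ℝ ∞ (deriv h) := (contDiff_infty_iff_deriv.1 hh).2
  have hd : ∀ x, DifferentiableAt ℝ h x := (contDiff_infty_iff_deriv.1 hh).1
  have hd' : ∀ x, DifferentiableAt ℝ (deriv h) x := (contDiff_infty_iff_deriv.1 h').1
  refine ⟨(hh.comp L.contDiff).contDiffOn, rfl, pd_comp_clm L (hd _) w, ?_⟩
  have h1 : pd w (fun z => h (L z)) = fun z => L w * deriv h (L z) :=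
    funext fun z => pd_comp_clm L (hd _) w
  have h2 : ContDiffOn ℝ ∞ (fun z => deriv h (L z)) Set.univ := (h'.comp L.contDiff).contDiffOn
  rw [h1, pd_const_mul isOpen_univ _ h2 (Set.mem_univ z),
    pd_comp_clm L (hd' _) w]

theorem HasJet.congr {f' : E → ℝ} (hD : IsOpen D) (hz : z ∈ D) (hf : HasJet D w z f a b c)
    (h : ∀ z ∈ D, f' z = f z) : HasJet D w z f' a b c where
  smooth := hf.smooth.congr h
  val := by rw [h z hz, hf.val]
  fst := by rw [pd_congr hD w h z hz, hf.fst]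
  snd := by rw [pd_congr hD w (pd_congr hD w h) z hz, hf.snd]

end Jets

/-- Solutions with functional parameters `R₁(x)`, `R₂(t)`, `Q(y)`, `V₀(y)`, obtained from the
potential `log (1 + Q (R₁ + R₂))`, and their jets at a point where `R₁ + R₂` and `Q` vanish. -/
theorem exists_separable_solution {R₁ R₂ Q V₀ : ℝ → ℝ} (hR₁ : ContDiff ℝ ∞ R₁)
    (hR₂ : ContDiff ℝ ∞ R₂) (hQ : ContDiff ℝ ∞ Q) (hV₀ : ContDiff ℝ ∞ V₀) {t₀ x₀ y₀ : ℝ}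
    (h1 : deriv R₁ x₀ ≠ 0) (hR : R₁ x₀ + R₂ t₀ = 0) (hQ₀ : Q y₀ = 0) :
    ∃ (D : Set Base) (u v : Base → ℝ), IsOpen D ∧ (t₀, x₀, y₀) ∈ D ∧ ContDiffOn ℝ ∞ u D ∧
      ContDiffOn ℝ ∞ v D ∧ (∀ z ∈ D, SolvesAt u v z) ∧
      pd ex (pd ex (pd ex v)) (t₀, x₀, y₀) = deriv Q y₀ * deriv (deriv (deriv R₁)) x₀ ∧
      ∀ w : Base,
        HasJet D w (t₀, x₀, y₀) u ((deriv R₂ t₀ - deriv (deriv R₁) x₀) / (2 * deriv R₁ x₀))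
          ((w.1 * deriv (deriv R₂) t₀ - w.2.1 * deriv (deriv (deriv R₁)) x₀) / (2 * deriv R₁ x₀)
            - (deriv R₂ t₀ - deriv (deriv R₁) x₀) * (w.2.1 * deriv (deriv R₁) x₀)
              / (2 * deriv R₁ x₀ ^ 2)
            + w.2.2 * deriv Q y₀ * deriv R₁ x₀)
          ((w.1 ^ 2 * deriv (deriv (deriv R₂)) t₀
              - w.2.1 ^ 2 * deriv (deriv (deriv (deriv R₁))) x₀) / (2 * deriv R₁ x₀)
            - (w.1 * deriv (deriv R₂) t₀ - w.2.1 * deriv (deriv (deriv R₁)) x₀)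
              * (w.2.1 * deriv (deriv R₁) x₀) / deriv R₁ x₀ ^ 2
            + (deriv R₂ t₀ - deriv (deriv R₁) x₀) *
              (2 * (w.2.1 * deriv (deriv R₁) x₀) ^ 2 / deriv R₁ x₀ ^ 3
                - w.2.1 ^ 2 * deriv (deriv (deriv R₁)) x₀ / deriv R₁ x₀ ^ 2) / 2
            + 2 * (w.2.2 * deriv Q y₀) * (w.2.1 * deriv (deriv R₁) x₀)
            + w.2.2 ^ 2 * deriv (deriv Q) y₀ * deriv R₁ x₀) ∧
        HasJet D w (t₀, x₀, y₀) v (V₀ y₀)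
          (deriv Q y₀ * (w.2.1 * deriv R₁ x₀ + w.1 * deriv R₂ t₀) + w.2.2 * deriv V₀ y₀)
          (deriv Q y₀ * (w.2.1 ^ 2 * deriv (deriv R₁) x₀ + w.1 ^ 2 * deriv (deriv R₂) t₀)
            + 2 * (w.2.2 * deriv (deriv Q) y₀) * (w.2.1 * deriv R₁ x₀ + w.1 * deriv R₂ t₀)
            + w.2.2 ^ 2 * deriv (deriv V₀) y₀) := by
  have dsm : ∀ {h : ℝ → ℝ}, ContDiff ℝ ∞ h → ContDiff ℝ ∞ (deriv h) := fun hh =>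
    (contDiff_infty_iff_deriv.1 hh).2
  have dd : ∀ {h : ℝ → ℝ}, ContDiff ℝ ∞ h → ∀ x, DifferentiableAt ℝ h x := fun hh =>
    (contDiff_infty_iff_deriv.1 hh).1
  set R : Base → ℝ := fun z => R₁ (xB z) + R₂ (tB z) with hRdef
  set F : Base → ℝ := fun z => 1 + Q (yB z) * R z with hF
  have lx : ∀ {h : ℝ → ℝ}, ContDiff ℝ ∞ h → ContDiff ℝ ∞ (fun z => h (xB z)) := fun hh =>
    hh.comp xB.contDiff
  have lt : ∀ {h : ℝ → ℝ}, ContDiff ℝ ∞ h → ContDiff ℝ ∞ (fun z => h (tB z)) := fun hh =>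
    hh.comp tB.contDiff
  have ly : ∀ {h : ℝ → ℝ}, ContDiff ℝ ∞ h → ContDiff ℝ ∞ (fun z => h (yB z)) := fun hh =>
    hh.comp yB.contDiff
  have hRsm : ContDiff ℝ ∞ R := (lx hR₁).add (lt hR₂)
  have hFsm : ContDiff ℝ ∞ F := contDiff_const.add ((ly hQ).mul hRsm)
  set D : Set Base := {z | 0 < F z} ∩ {z | deriv R₁ (xB z) ≠ 0} with hDdef
  have hD : IsOpen D := (isOpen_lt continuous_const hFsm.continuous).inter
    (isOpen_ne_fun (lx (dsm hR₁)).continuous continuous_const)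
  have hz₀ : (t₀, x₀, y₀) ∈ D := by
    refine ⟨?_, h1⟩
    change 0 < 1 + Q y₀ * _
    rw [hQ₀]; norm_num
  have hF0 : ∀ z ∈ D, F z ≠ 0 := fun z hz => (ne_of_gt hz.1)
  have hR0 : ∀ z ∈ D, 2 * deriv R₁ (xB z) ≠ 0 := fun z hz => mul_ne_zero two_ne_zero hz.2
  -- This u₀ is chosen so that F_t = F_xx + 2 u₀ F_x: after dividing by Q it reads R₂' = R₁'' + 2 u₀
  -- R₁'. For W = log F this linear equation is the potential equation.
  set u₀ : Base → ℝ := fun z =>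
    (deriv R₂ (tB z) + (-1) * deriv (deriv R₁) (xB z)) * (2 * deriv R₁ (xB z))⁻¹ with hu₀
  set u : Base → ℝ := fun z => Q (yB z) * deriv R₁ (xB z) * (F z)⁻¹ with hu
  set v : Base → ℝ := fun z => deriv Q (yB z) * R z * (F z)⁻¹ with hv
  have hN : ContDiff ℝ ∞ (fun z : Base => deriv R₂ (tB z) + (-1) * deriv (deriv R₁) (xB z)) :=
    (lt (dsm hR₂)).add (contDiff_const.mul (lx (dsm (dsm hR₁))))
  have hM : ContDiff ℝ ∞ (fun z : Base => 2 * deriv R₁ (xB z)) :=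
    contDiff_const.mul (lx (dsm hR₁))
  have hFi : ContDiffOn ℝ ∞ (fun z => (F z)⁻¹) D := hFsm.contDiffOn.inv hF0
  have hMi : ContDiffOn ℝ ∞ (fun z : Base => (2 * deriv R₁ (xB z))⁻¹) D := hM.contDiffOn.inv hR0
  have hu₀sm : ContDiffOn ℝ ∞ u₀ D := hN.contDiffOn.mul hMi
  have husm : ContDiffOn ℝ ∞ u D := ((ly hQ).mul (lx (dsm hR₁))).contDiffOn.mul hFi
  have hvsm : ContDiffOn ℝ ∞ v D := ((ly (dsm hQ)).mul hRsm).contDiffOn.mul hFi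
  have hV₀sm : ContDiffOn ℝ ∞ (fun z => V₀ (yB z)) D := (ly hV₀).contDiffOn
  have px : ∀ {h : ℝ → ℝ}, ContDiff ℝ ∞ h → ∀ w z : Base,
      pd w (fun z => h (xB z)) z = w.2.1 * deriv h (xB z) := fun hh w z =>
    pd_comp_clm xB (dd hh _) w
  have pt : ∀ {h : ℝ → ℝ}, ContDiff ℝ ∞ h → ∀ w z : Base,
      pd w (fun z => h (tB z)) z = w.1 * deriv h (tB z) := fun hh w z =>
    pd_comp_clm tB (dd hh _) w
  have py : ∀ {h : ℝ → ℝ}, ContDiff ℝ ∞ h → ∀ w z : Base,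
      pd w (fun z => h (yB z)) z = w.2.2 * deriv h (yB z) := fun hh w z =>
    pd_comp_clm yB (dd hh _) w
  have pR : ∀ w z : Base, pd w R z = w.2.1 * deriv R₁ (xB z) + w.1 * deriv R₂ (tB z) :=
    fun w z => by
      rw [hRdef, pd_add isOpen_univ (lx hR₁).contDiffOn (lt hR₂).contDiffOn (Set.mem_univ z),
        px hR₁, pt hR₂]
  have pF : ∀ w z : Base, pd w F z =
      Q (yB z) * (w.2.1 * deriv R₁ (xB z) + w.1 * deriv R₂ (tB z))
        + R z * (w.2.2 * deriv Q (yB z)) := fun w z => by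
    rw [hF, pd_add isOpen_univ contDiff_const.contDiffOn ((ly hQ).mul hRsm).contDiffOn
      (Set.mem_univ z), pd_const, pd_mul isOpen_univ (ly hQ).contDiffOn hRsm.contDiffOn
      (Set.mem_univ z), pR, py hQ, zero_add]
  set W : Base → ℝ := fun z => Real.log (F z) with hW
  have hWsm : ContDiffOn ℝ ∞ W D := hFsm.contDiffOn.log hF0
  have pW : ∀ w, ∀ z ∈ D, pd w W z = pd w F z * (F z)⁻¹ := by
    intro w z hz
    have h := ((hFsm.differentiable (by simp)).differentiableAt (x := z)).hasFDerivAt.log (hF0 z hz)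
    simp only [hW, pd, h.fderiv]
    simp
    ring
  have pWx : ∀ z ∈ D, pd ex W z = u z := fun z hz => by
    rw [pW ex z hz, pF]; simp [hu]
  have pWy : ∀ z ∈ D, pd ey W z = v z := fun z hz => by
    rw [pW ey z hz, pF]; simp only [hv]; ring
  have pWxx : ∀ z ∈ D, pd ex (pd ex W) z = Q (yB z) * deriv (deriv R₁) (xB z) * (F z)⁻¹
      - u z * u z := by
    intro z hz
    rw [pd_congr hD ex pWx z hz, hu,
      pd_mul hD ((ly hQ).mul (lx (dsm hR₁))).contDiffOn hFi hz,
      pd_mul hD (ly hQ).contDiffOn (lx (dsm hR₁)).contDiffOn hz, px (dsm hR₁), py hQ,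
      pd_inv hD hFsm.contDiffOn hz (hF0 z hz), pF]
    have := hF0 z hz
    simp only
    field_simp
    ring
  have hsolve := solvesAt_of_potential hD hWsm hu₀sm hV₀sm (fun z hz => by
      rw [pWxx z hz, pWx z hz, pW et z hz, pF]
      have h2 := hF0 z hz
      have h3 : deriv R₁ (xB z) ≠ 0 := hz.2
      simp only [hu, hu₀]
      field_simp
      ring) (fun z hz => by
      rw [hu₀, pd_mul hD hN.contDiffOn hMi hz,
        pd_inv hD hM.contDiffOn hz (hR0 z hz),
        pd_add hD (lt (dsm hR₂)).contDiffOn (contDiff_const.mul (lx (dsm (dsm hR₁)))).contDiffOn hz,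
        pd_const_mul hD _ (lx (dsm (dsm hR₁))).contDiffOn hz,
        pd_const_mul hD _ (lx (dsm hR₁)).contDiffOn hz, pt (dsm hR₂), px (dsm hR₁),
        px (dsm (dsm hR₁))]
      simp) (fun z hz => by rw [py hV₀]; simp) (fun z hz => by rw [py hV₀]; simp)
  refine ⟨D, _, _, hD, hz₀, (contDiffOn_pd hD ex hWsm).add hu₀sm,
    (contDiffOn_pd hD ey hWsm).add hV₀sm, hsolve, ?_, fun w => ⟨?_, ?_⟩⟩
  -- From 1/F = 1 − Q R/F, the component v is Q' R + V₀ plus Q times a smooth function H. Since Q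
  -- does not depend on x and vanishes at y₀, the H part drops out of v_xxx there.
  · set H : Base → ℝ := fun z => (-1) * (deriv Q (yB z) * (R z * R z) * (F z)⁻¹) with hH
    have hHsm : ContDiffOn ℝ ∞ H D :=
      contDiffOn_const.mul (((ly (dsm hQ)).mul (hRsm.mul hRsm)).contDiffOn.mul hFi)
    have hdec : ∀ z ∈ D, pd ey W z + V₀ (yB z) =
        deriv Q (yB z) * R z + V₀ (yB z) + Q (yB z) * H z := fun z hz => by
      rw [pWy z hz, hv, hH]
      have := hF0 z hz
      field_simp
      simp only [hF]
      ring
    have step : ∀ {h : ℝ → ℝ} {G : Base → ℝ}, ContDiff ℝ ∞ h → ContDiffOn ℝ ∞ G D → ∀ z ∈ D,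
        pd ex (fun z => h (yB z) * G z) z = h (yB z) * pd ex G z := by
      intro h G hh hG z hz
      rw [pd_mul hD (ly hh).contDiffOn hG hz, py hh]; simp
    have hHx := contDiffOn_pd hD ex hHsm
    have hHxx := contDiffOn_pd hD ex hHx
    have q1 : ContDiffOn ℝ ∞ (fun z => Q (yB z) * H z) D := (ly hQ).contDiffOn.mul hHsm
    have q2 : ContDiffOn ℝ ∞ (fun z => Q (yB z) * pd ex H z) D := (ly hQ).contDiffOn.mul hHx
    have q3 : ContDiffOn ℝ ∞ (fun z => Q (yB z) * pd ex (pd ex H) z) D :=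
      (ly hQ).contDiffOn.mul hHxx
    have r1 : ContDiffOn ℝ ∞ (fun z => deriv Q (yB z) * R z) D :=
      ((ly (dsm hQ)).mul hRsm).contDiffOn
    have r2 : ContDiffOn ℝ ∞ (fun z => deriv Q (yB z) * deriv R₁ (xB z)) D :=
      ((ly (dsm hQ)).mul (lx (dsm hR₁))).contDiffOn
    have r3 : ContDiffOn ℝ ∞ (fun z => deriv Q (yB z) * deriv (deriv R₁) (xB z)) D :=
      ((ly (dsm hQ)).mul (lx (dsm (dsm hR₁)))).contDiffOn
    have d1 : ∀ z ∈ D, pd ex (fun z => pd ey W z + V₀ (yB z)) z =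
        deriv Q (yB z) * deriv R₁ (xB z) + Q (yB z) * pd ex H z := fun z hz => by
      rw [pd_congr hD ex hdec z hz, pd_add hD (r1.add hV₀sm) q1 hz, pd_add hD r1 hV₀sm hz,
        step (dsm hQ) hRsm.contDiffOn z hz, step hQ hHsm z hz, pR, py hV₀]
      simp
    have d2 : ∀ z ∈ D, pd ex (pd ex (fun z => pd ey W z + V₀ (yB z))) z =
        deriv Q (yB z) * deriv (deriv R₁) (xB z) + Q (yB z) * pd ex (pd ex H) z := fun z hz => by
      rw [pd_congr hD ex d1 z hz, pd_add hD r2 q2 hz,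
        step (dsm hQ) (lx (dsm hR₁)).contDiffOn z hz, step hQ hHx z hz, px (dsm hR₁)]
      simp
    rw [pd_congr hD ex d2 _ hz₀, pd_add hD r3 q3 hz₀,
      step (dsm hQ) (lx (dsm (dsm hR₁))).contDiffOn _ hz₀, step hQ hHxx _ hz₀, px (dsm (dsm hR₁))]
    have : Q (yB (t₀, x₀, y₀)) = 0 := hQ₀
    rw [this]
    simp
  all_goals
    have jQ := HasJet.comp_clm (D := D) (w := w) (z := (t₀, x₀, y₀)) yB hQ
    have jQ' := HasJet.comp_clm (D := D) (w := w) (z := (t₀, x₀, y₀)) yB (dsm hQ)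
    have jV := HasJet.comp_clm (D := D) (w := w) (z := (t₀, x₀, y₀)) yB hV₀
    have jR₁ := HasJet.comp_clm (D := D) (w := w) (z := (t₀, x₀, y₀)) xB hR₁
    have jR₂ := HasJet.comp_clm (D := D) (w := w) (z := (t₀, x₀, y₀)) tB hR₂
    have jR₁' := HasJet.comp_clm (D := D) (w := w) (z := (t₀, x₀, y₀)) xB (dsm hR₁)
    have jR₂' := HasJet.comp_clm (D := D) (w := w) (z := (t₀, x₀, y₀)) tB (dsm hR₂)
    have jR₁'' := HasJet.comp_clm (D := D) (w := w) (z := (t₀, x₀, y₀)) xB (dsm (dsm hR₁))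
    have eQ : Q (yB (t₀, x₀, y₀)) = 0 := hQ₀
    have eR : R₁ (xB (t₀, x₀, y₀)) + R₂ (tB (t₀, x₀, y₀)) = 0 := hR
    rw [eQ] at jQ
    have jR := jR₁.add hD hz₀ jR₂
    rw [eR] at jR
    have jF := ((HasJet.const (D := D) (w := w) (z := (t₀, x₀, y₀)) 1).add hD hz₀
      (jQ.mul hD hz₀ jR)).inv hD hz₀ hF0
  · have ju₀ := (jR₂'.add hD hz₀ ((HasJet.const (-1)).mul hD hz₀ jR₁'')).mul hD hz₀
      (((HasJet.const 2).mul hD hz₀ jR₁').inv hD hz₀ hR0)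
    have ju := ((jQ.mul hD hz₀ jR₁').mul hD hz₀ jF).add hD hz₀ ju₀
    have h1' : deriv R₁ (xB (t₀, x₀, y₀)) ≠ 0 := h1
    convert ju.congr (f' := fun z => pd ex W z + u₀ z) hD hz₀ (fun z hz => by rw [pWx z hz]) using 1
    · change _ = 0 * _ * _ + (deriv R₂ t₀ + -1 * deriv (deriv R₁) x₀) * (2 * deriv R₁ x₀)⁻¹
      ring
    · simp
      field_simp
      ring
    · simp
      field_simp
      ring
  · have jv := ((jQ'.mul hD hz₀ jR).mul hD hz₀ jF).add hD hz₀ jV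
    convert jv.congr (f' := fun z => pd ey W z + V₀ (yB z)) hD hz₀
      (fun z hz => by rw [pWy z hz]) using 1
    · simp
    · simp
    · simp
      ring

/-- The quartic polynomial with the Taylor coefficients `c₀, …, c₄` at `x₀`. -/
def quartic (c₀ c₁ c₂ c₃ c₄ x₀ x : ℝ) : ℝ :=
  c₀ + c₁ * (x - x₀) + c₂ * (x - x₀) ^ 2 + c₃ * (x - x₀) ^ 3 + c₄ * (x - x₀) ^ 4

theorem contDiff_quartic (c₀ c₁ c₂ c₃ c₄ x₀ : ℝ) : ContDiff ℝ ∞ (quartic c₀ c₁ c₂ c₃ c₄ x₀) := by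
  unfold quartic
  fun_prop

theorem quartic_self (c₀ c₁ c₂ c₃ c₄ x₀ : ℝ) : quartic c₀ c₁ c₂ c₃ c₄ x₀ x₀ = c₀ := by
  simp [quartic]

/-- Quartics centred at x₀ are closed under differentiation, so all the derivatives needed at x₀ are
read off from the leading coefficient c₀ of the result. -/
theorem deriv_quartic (c₀ c₁ c₂ c₃ c₄ x₀ : ℝ) :
    deriv (quartic c₀ c₁ c₂ c₃ c₄ x₀) = quartic c₁ (2 * c₂) (3 * c₃) (4 * c₄) 0 x₀ := by
  funext x
  have h : HasDerivAt (fun x : ℝ => x - x₀) 1 x := (hasDerivAt_id x).sub_const x₀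
  have h' := ((((h.const_mul c₁).const_add c₀).add ((h.pow 2).const_mul c₂)).add
    ((h.pow 3).const_mul c₃)).add ((h.pow 4).const_mul c₄)
  have h'' : deriv (quartic c₀ c₁ c₂ c₃ c₄ x₀) x = _ := h'.deriv
  rw [h'', quartic]
  simp
  ring

/-- The linear form with the given coefficients on the base. -/
def form (a b c : ℝ) (w : Base) : ℝ := w.1 * a + w.2.1 * b + w.2.2 * c

/-- Solutions through a given point with prescribed first derivatives, subject only to
`u_y = v_x ≠ 0`, and with sufficiently arbitrary second derivatives. -/
theorem exists_solution (p : Total) {ρ : ℝ} (hρ : ρ ≠ 0) (θ n ut ux : ℝ) :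
    ∃ C : Base → ℝ, ∀ d k m l : ℝ, ∃ (D : Set Base) (u v : Base → ℝ),
      IsOpen D ∧ proj p ∈ D ∧ ContDiffOn ℝ ∞ u D ∧ ContDiffOn ℝ ∞ v D ∧
      (∀ z ∈ D, SolvesAt u v z) ∧ graphPoint u v (proj p) = p ∧
      ((fun w => pd w u (proj p)) = form ut ux ρ) ∧ ((fun w => pd w v (proj p)) = form θ ρ n) ∧
      (∀ w : Base, pd w (pd w u) (proj p) =
        C w + d * w.1 ^ 2 + k * w.2.1 ^ 2 + m * w.2.2 ^ 2) ∧
      (∀ w : Base, pd w (pd w v) (proj p) =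
        (θ - 2 * ρ * uT p) * w.2.1 ^ 2 + 2 * ρ * ut * w.1 ^ 2
          + 2 * m / ρ * w.2.2 * (ρ * w.2.1 + θ * w.1) + l * w.2.2 ^ 2) ∧
      pd ex (pd ex (pd ex v)) (proj p) = -2 * (ρ * ux + uT p * (θ - 2 * ρ * uT p)) := by
  obtain ⟨t₀, x₀, y₀, u₀, v₀⟩ := p
  -- The part of the second derivative of u fixed by the first jet; d, k, m, l do not enter it.
  refine ⟨fun w => -(w.1 * (2 * (ρ * ut)) + w.2.1 * (2 * (ρ * ux + u₀ * (θ - 2 * ρ * u₀))))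
    * (w.2.1 * (θ - 2 * ρ * u₀)) / ρ ^ 2
    + 2 * ρ * u₀ * (2 * (w.2.1 * (θ - 2 * ρ * u₀)) ^ 2 / ρ ^ 3
      + w.2.1 ^ 2 * (2 * (ρ * ux + u₀ * (θ - 2 * ρ * u₀))) / ρ ^ 2) / 2
    + 2 * w.2.2 * (w.2.1 * (θ - 2 * ρ * u₀)), fun d k m l => ?_⟩
  -- At the base point: Q' = 1, R₁' = ρ and R₂' = θ give u_y = v_x = ρ and v_t = θ; R₁'' = θ − 2ρu₀
  -- gives the value u₀ of u; R₁''' and R₂'' are solved from u_x and u_t. The next orders R₂''' =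
  -- 2ρd, R₁'''' = −2ρk, Q'' = m/ρ and V₀'' = l carry the free second derivatives.
  obtain ⟨D, u, v, hD, hz, hu, hv, hs, hxxx, hj⟩ := exists_separable_solution
    (contDiff_quartic 0 ρ ((θ - 2 * ρ * u₀) / 2) (-(ρ * ux + u₀ * (θ - 2 * ρ * u₀)) / 3)
      (-(ρ * k) / 12) x₀)
    (contDiff_quartic 0 θ (ρ * ut) (ρ * d / 3) 0 t₀) (contDiff_quartic 0 1 (m / (2 * ρ)) 0 0 y₀)
    (contDiff_quartic v₀ n (l / 2) 0 0 y₀) (t₀ := t₀) (x₀ := x₀) (y₀ := y₀)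
    (by rwa [deriv_quartic, quartic_self]) (by simp [quartic_self]) (quartic_self _ _ _ _ _ _)
  simp only [deriv_quartic, quartic_self] at hj hxxx
  refine ⟨D, u, v, hD, hz, hu, hv, hs, ?_, ?_, ?_, ?_, ?_, ?_⟩
  · have h1 := (hj 0).1.val
    have h2 := (hj 0).2.val
    have h3 : (θ - 2 * ((θ - 2 * ρ * u₀) / 2)) / (2 * ρ) = u₀ := by field_simp; ring
    rw [h3] at h1
    simp only [graphPoint, proj, h1, h2]
  · funext w
    simp only [proj, (hj w).1.fst, form]
    field_simp
    ring
  · funext w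
    simp only [proj, (hj w).2.fst, form]
    ring
  · intro w
    simp only [proj, (hj w).1.snd]
    field_simp
    ring
  · intro w
    simp only [proj, (hj w).2.snd]
    change _ = (θ - 2 * ρ * u₀) * _ + _ + _ + _
    field_simp
  · simp only [proj, hxxx]
    change _ = -2 * (ρ * ux + u₀ * (θ - 2 * ρ * u₀))
    ring

/-! ### Generic frames, and independence of `u`. -/

/-- A nonzero cubic polynomial vanishes only at finitely many points. -/
theorem eventually_cubic_ne_zero {a b c d : ℝ} (h : ¬(a = 0 ∧ b = 0 ∧ c = 0 ∧ d = 0)) :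
    ∀ᶠ s in Filter.cofinite, a + b * s + c * s ^ 2 + d * s ^ 3 ≠ 0 := by
  set P : Polynomial ℝ := Polynomial.C a + Polynomial.C b * Polynomial.X
    + Polynomial.C c * Polynomial.X ^ 2 + Polynomial.C d * Polynomial.X ^ 3 with hP
  have hP0 : P ≠ 0 := by
    intro h0
    apply h
    have h1 : ∀ n, P.coeff n = 0 := fun n => by rw [h0]; simp
    have c0 := h1 0
    have c1 := h1 1
    have c2 := h1 2
    have c3 := h1 3
    simp [hP, Polynomial.coeff_X, Polynomial.coeff_C] at c0 c1 c2 c3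
    exact ⟨c0, c1, c2, c3⟩
  have hfin := Polynomial.finite_setOfPred_isRoot hP0
  refine hfin.eventually_cofinite_notMem.mono fun s hs hs0 => hs ?_
  simp only [Set.mem_ofPred_eq, Polynomial.IsRoot, hP]
  simpa using hs0

theorem lift_form_add (a b c a' b' c' : ℝ) (w w' : Base) :
    lift (form a b c) (form a' b' c') (w + w') =
      lift (form a b c) (form a' b' c') w + lift (form a b c) (form a' b' c') w' := by
  ext <;> simp [lift, form] <;> ring

theorem lift_form_smul (a b c a' b' c' r : ℝ) (w : Base) :
    lift (form a b c) (form a' b' c') (r • w) = r • lift (form a b c) (form a' b' c') w := by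
  ext <;> simp [lift, form] <;> ring

/-- Injectivity on the three-dimensional tangent space of the graph makes (dt̃, dx̃, dỹ) invertible
there. The preimages of the basis vectors are ∂/∂t̃, ∂/∂x̃ and ∂/∂ỹ; the derivatives of ṽ along them
are A, B, C. -/
theorem exists_isFrame {Φ : Total → Total} {p : Total} {a b c a' b' c' : ℝ}
    (h : ∀ w, pd (lift (form a b c) (form a' b' c') w) (cT Φ) p = 0 →
      pd (lift (form a b c) (form a' b' c') w) (cX Φ) p = 0 →
      pd (lift (form a b c) (form a' b' c') w) (cY Φ) p = 0 → w = 0) :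
    ∃ ξ A B C, IsFrame Φ p (form a b c) (form a' b' c') ξ A B C := by
  set j := lift (form a b c) (form a' b' c') with hj
  let M : Base →ₗ[ℝ] Base :=
    { toFun := fun w => (pd (j w) (cT Φ) p, pd (j w) (cX Φ) p, pd (j w) (cY Φ) p)
      map_add' := fun w w' => by simp [hj, lift_form_add, pd_add_dir]
      map_smul' := fun r w => by simp [hj, lift_form_smul, pd_smul_dir] }
  have hM : ∀ w, M w = (pd (j w) (cT Φ) p, pd (j w) (cX Φ) p, pd (j w) (cY Φ) p) := fun _ => rfl
  have hinj : Function.Injective M := by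
    refine (injective_iff_map_eq_zero M).2 fun w hw => ?_
    rw [hM, Prod.mk_eq_zero, Prod.mk_eq_zero] at hw
    exact h w hw.1 hw.2.1 hw.2.2
  have hsurj : Function.Surjective M := LinearMap.injective_iff_surjective.1 hinj
  obtain ⟨τ, hτ⟩ := hsurj et
  obtain ⟨ξ, hξ⟩ := hsurj ex
  obtain ⟨η, hη⟩ := hsurj ey
  have hξ' := hξ
  rw [hM, Prod.mk.injEq, Prod.mk.injEq] at hξ'
  refine ⟨ξ, pd (j τ) (cV Φ) p, pd (j ξ) (cV Φ) p, pd (j η) (cV Φ) p, h, hξ'.1, hξ'.2.1, hξ'.2.2,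
    fun w => ?_⟩
  have hw : w = (M w).1 • τ + (M w).2.1 • ξ + (M w).2.2 • η := by
    apply hinj
    rw [map_add, map_add, map_smul, map_smul, map_smul, hτ, hξ, hη]
    ext <;> simp
  conv_lhs => rw [hw, lift_form_add, lift_form_add, lift_form_smul, lift_form_smul,
    lift_form_smul, pd_add_dir, pd_add_dir, pd_smul_dir, pd_smul_dir, pd_smul_dir]
  simp only [hM]
  ring

section

variable {Ω : Set Total} {Φ : Total → Total}

/-- The differential of the defect function in a frame is a combination of the two contact forms. -/
theorem IsFrame.pd_defect_eq (hΩ : IsOpen Ω) (hsm : ContDiffOn ℝ ∞ Φ Ω) {p : Total} (hp : p ∈ Ω)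
    {a b c a' b' c' : ℝ} {ξ : Base} {A B C : ℝ}
    (hF : IsFrame Φ p (form a b c) (form a' b' c') ξ A B C) (k : Total) :
    pd k (defect Φ A B C) p =
      pd Eu (defect Φ A B C) p * (k.2.2.2.1 - form a b c (proj k))
        + pd Ev (defect Φ A B C) p * (k.2.2.2.2 - form a' b' c' (proj k)) := by
  -- The differential annihilates the tangent space of the graph, which is the common kernel of the
  -- two contact forms; its coefficients are its values on ∂/∂u and ∂/∂v.
  have h0 : ∀ w, pd (lift (form a b c) (form a' b' c') w) (defect Φ A B C) p = 0 := fun w => by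
    rw [pd_defect hΩ hsm A B C _ p hp, hF.pd_V w, sub_self]
  have h1 := h0 et
  have h2 := h0 ex
  have h3 := h0 ey
  rw [pd_total] at h1 h2 h3 ⊢
  simp only [lift, form, proj] at h1 h2 h3 ⊢
  linear_combination k.1 * h1 + k.2.1 * h2 + k.2.2.1 * h3

theorem IsFrame.ne_zero {p : Total} {a b c a' b' c' : ℝ} {ξ : Base} {A B C : ℝ}
    (hF : IsFrame Φ p (form a b c) (form a' b' c') ξ A B C) : ξ ≠ 0 := by
  rintro rfl
  have h := hF.pd_X
  have : lift (form a b c) (form a' b' c') 0 = 0 := by ext <;> simp [lift, form]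
  rw [this] at h
  simp [pd] at h

theorem IsPointTransformation.exists_pd_eq (hΦ : IsPointTransformation Ω Φ) {p : Total}
    (hp : p ∈ Ω) (a b c d e : ℝ) : ∃ k, pd k (cT Φ) p = a ∧ pd k (cX Φ) p = b ∧
      pd k (cY Φ) p = c ∧ pd k (cU Φ) p = d ∧ pd k (cV Φ) p = e := by
  have hd := differentiableAt_of_mem hΦ.isOpen hΦ.smooth hp
  have hsurj : Function.Surjective (fderiv ℝ Φ p) := by
    have := (ContinuousLinearMap.toContinuousLinearEquivOfDetNeZero _
      (hΦ.jacobian_ne_zero p hp)).surjective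
    exact this
  obtain ⟨k, hk⟩ := hsurj (a, b, c, d, e)
  rw [fderiv_total_eq hd] at hk
  simp only [Prod.mk.injEq] at hk
  exact ⟨k, hk⟩

theorem IsPointTransformation.eq_zero_of_pd (hΦ : IsPointTransformation Ω Φ) {p : Total}
    (hp : p ∈ Ω) {k : Total} (h1 : pd k (cT Φ) p = 0) (h2 : pd k (cX Φ) p = 0)
    (h3 : pd k (cY Φ) p = 0) (h4 : pd k (cU Φ) p = 0) (h5 : pd k (cV Φ) p = 0) : k = 0 := by
  have hd := differentiableAt_of_mem hΦ.isOpen hΦ.smooth hp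
  have hinj : Function.Injective (fderiv ℝ Φ p) := by
    have := (ContinuousLinearMap.toContinuousLinearEquivOfDetNeZero _
      (hΦ.jacobian_ne_zero p hp)).injective
    exact this
  apply hinj
  rw [fderiv_total_eq hd, map_zero]
  exact Prod.ext h1 (Prod.ext h2 (Prod.ext h3 (Prod.ext h4 h5)))

/-- The vectors annihilated by `dt̃`, `dx̃`, `dỹ` are the combinations of `∂/∂ũ` and `∂/∂ṽ`. -/
theorem IsPointTransformation.eq_of_pd (hΦ : IsPointTransformation Ω Φ) {p : Total}
    (hp : p ∈ Ω) {w w' k : Total}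
    (hw : pd w (cT Φ) p = 0 ∧ pd w (cX Φ) p = 0 ∧ pd w (cY Φ) p = 0 ∧ pd w (cU Φ) p = 1 ∧
      pd w (cV Φ) p = 0)
    (hw' : pd w' (cT Φ) p = 0 ∧ pd w' (cX Φ) p = 0 ∧ pd w' (cY Φ) p = 0 ∧ pd w' (cU Φ) p = 0 ∧
      pd w' (cV Φ) p = 1)
    (h1 : pd k (cT Φ) p = 0) (h2 : pd k (cX Φ) p = 0) (h3 : pd k (cY Φ) p = 0) :
    k = pd k (cU Φ) p • w + pd k (cV Φ) p • w' := by
  obtain ⟨a1, a2, a3, a4, a5⟩ := hw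
  obtain ⟨b1, b2, b3, b4, b5⟩ := hw'
  have key : k + (-pd k (cU Φ) p) • w + (-pd k (cV Φ) p) • w' = 0 := by
    apply hΦ.eq_zero_of_pd hp <;> simp only [pd_add_dir, pd_smul_dir, a1, a2, a3, a4, a5, b1, b2,
      b3, b4, b5, h1, h2, h3] <;> ring
  have : k = (k + (-pd k (cU Φ) p) • w + (-pd k (cV Φ) p) • w') + pd k (cU Φ) p • w
      + pd k (cV Φ) p • w' := by module
  rw [key, zero_add] at this
  exact this

/-- The components `t̃`, `x̃`, `ỹ`, `ṽ` of a point symmetry do not depend on `u`. -/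
theorem IsPointSymmetry.pd_Eu_eq_zero (hΦ : IsPointSymmetry Ω Φ) {p : Total} (hp : p ∈ Ω) :
    pd Eu (cT Φ) p = 0 ∧ pd Eu (cX Φ) p = 0 ∧ pd Eu (cY Φ) p = 0 ∧ pd Eu (cV Φ) p = 0 := by
  have hΩ := hΦ.isOpen
  have hsm := hΦ.smooth
  have hPT := hΦ.toIsPointTransformation
  obtain ⟨w, hw⟩ := hPT.exists_pd_eq hp 0 0 0 1 0
  obtain ⟨w', hw'⟩ := hPT.exists_pd_eq hp 0 0 0 0 1
  have span := fun k => hPT.eq_of_pd hp (k := k) hw hw'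
  -- Here w = ∂/∂ũ and w' = ∂/∂ṽ. The claim amounts to w being a multiple of ∂/∂u. The four entries
  -- are the coefficients of 1, s, s², s³ in w_v − β(w) for the form β chosen below.
  by_cases hw0 : w.2.2.2.2 = 0 ∧ -w.2.1 = 0 ∧ -w.1 = 0 ∧ -w.2.2.1 = 0
  · obtain ⟨z5, z2, z1, z3⟩ := hw0
    obtain ⟨a1, a2, a3, a4, a5⟩ := hw
    rw [pd_total, z5, neg_eq_zero.1 z1, neg_eq_zero.1 z2, neg_eq_zero.1 z3] at a1 a2 a3 a4 a5
    simp only [zero_mul, zero_add, add_zero] at a1 a2 a3 a4 a5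
    have h4 : w.2.2.2.1 ≠ 0 := fun h => by rw [h] at a4; simp at a4
    exact ⟨(mul_eq_zero.1 a1).resolve_left h4, (mul_eq_zero.1 a2).resolve_left h4,
      (mul_eq_zero.1 a3).resolve_left h4, (mul_eq_zero.1 a5).resolve_left h4⟩
  exfalso
  -- The common kernel of dt̃, dx̃, dỹ is spanned by w and w', so it cannot contain the three
  -- independent directions of y, u and v. The zero slot is the missing s² coefficient of f along
  -- (0, 0, 1, s, s³).
  have hK : ∃ f ∈ ({cT Φ, cX Φ, cY Φ} : Set (Total → ℝ)),
      ¬(pd Ey f p = 0 ∧ pd Eu f p = 0 ∧ (0 : ℝ) = 0 ∧ pd Ev f p = 0) := by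
    by_contra hcon
    push Not at hcon
    obtain ⟨t1, t2, -, t3⟩ := hcon (cT Φ) (by simp)
    obtain ⟨x1, x2, -, x3⟩ := hcon (cX Φ) (by simp)
    obtain ⟨y1, y2, -, y3⟩ := hcon (cY Φ) (by simp)
    have sy := span Ey t1 x1 y1
    have su := span Eu t2 x2 y2
    have sv := span Ev t3 x3 y3
    simp only [Prod.ext_iff, Prod.fst_add, Prod.snd_add, Prod.smul_fst, Prod.smul_snd,
      smul_eq_mul] at sy su sv
    obtain ⟨-, -, y3, y4, y5⟩ := sy
    obtain ⟨-, -, u3, u4, u5⟩ := su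
    obtain ⟨-, -, v3, v4, v5⟩ := sv
    generalize pd Ey (cU Φ) p = a₁ at *
    generalize pd Ey (cV Φ) p = b₁ at *
    generalize pd Eu (cU Φ) p = a₂ at *
    generalize pd Eu (cV Φ) p = b₂ at *
    generalize pd Ev (cU Φ) p = a₃ at *
    generalize pd Ev (cV Φ) p = b₃ at *
    -- A 3 × 3 determinant whose rows are combinations of two vectors vanishes, whereas on the y-,
    -- u-, v-axes it would be 1.
    have key : (a₁ * w.2.2.1 + b₁ * w'.2.2.1) *
          ((a₂ * w.2.2.2.1 + b₂ * w'.2.2.2.1) * (a₃ * w.2.2.2.2 + b₃ * w'.2.2.2.2)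
            - (a₂ * w.2.2.2.2 + b₂ * w'.2.2.2.2) * (a₃ * w.2.2.2.1 + b₃ * w'.2.2.2.1))
        - (a₁ * w.2.2.2.1 + b₁ * w'.2.2.2.1) *
          ((a₂ * w.2.2.1 + b₂ * w'.2.2.1) * (a₃ * w.2.2.2.2 + b₃ * w'.2.2.2.2)
            - (a₂ * w.2.2.2.2 + b₂ * w'.2.2.2.2) * (a₃ * w.2.2.1 + b₃ * w'.2.2.1))
        + (a₁ * w.2.2.2.2 + b₁ * w'.2.2.2.2) *
          ((a₂ * w.2.2.1 + b₂ * w'.2.2.1) * (a₃ * w.2.2.2.1 + b₃ * w'.2.2.2.1)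
            - (a₂ * w.2.2.2.1 + b₂ * w'.2.2.2.1) * (a₃ * w.2.2.1 + b₃ * w'.2.2.1)) = 0 := by
      ring
    rw [← y3, ← y4, ← y5, ← u3, ← u4, ← u5, ← v3, ← v4, ← v5] at key
    norm_num at key
  obtain ⟨f, hf, hf0⟩ := hK
  obtain ⟨s, hs0, hs1, hs2⟩ := ((Filter.eventually_cofinite_ne (0 : ℝ)).and
    ((eventually_cubic_ne_zero hw0).and (eventually_cubic_ne_zero hf0))).exists
  -- Putting v_t, v_x, v_y = s², s, s³ along one curve turns the genericity conditions into nonzero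
  -- cubics in s.
  set β : Base → ℝ := form (s ^ 2) s (s ^ 3) with hβ
  set bw := w.2.2.2.2 - β (proj w) with hbw
  set bw' := w'.2.2.2.2 - β (proj w') with hbw'
  have hbw0 : bw ≠ 0 := by
    convert hs1 using 1
    simp only [hbw, hβ, form, proj]
    ring
  -- The combination of w and w' on which dv − β vanishes. The graph is transverse to the span of w
  -- and w' as soon as du − α does not vanish on m.
  set m : Total := bw • w' + (-bw') • w with hm
  have hmβ : m.2.2.2.2 - β (proj m) = 0 := by
    simp only [hm, hβ, form, proj, hbw, hbw', Prod.fst_add, Prod.snd_add, Prod.smul_fst,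
      Prod.smul_snd, smul_eq_mul]
    ring
  have hmV : pd m (cV Φ) p = bw := by
    rw [hm, pd_add_dir, pd_smul_dir, pd_smul_dir, hw'.2.2.2.2, hw.2.2.2.2]; ring
  have hmf : pd m f p = 0 := by
    rw [hm, pd_add_dir, pd_smul_dir, pd_smul_dir]
    rcases hf with rfl | rfl | rfl
    · rw [hw.1, hw'.1]; ring
    · rw [hw.2.1, hw'.2.1]; ring
    · rw [hw.2.2.1, hw'.2.2.1]; ring
  -- If m has a t- or x-entry, u_t or u_x can be adjusted. Otherwise failure would make m a multiple
  -- of (0, 0, 1, s, s³), along which f has nonzero derivative; then m = 0, contradicting dṽ(m) = bw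
  -- ≠ 0.
  obtain ⟨ut, ux, hA⟩ : ∃ ut ux : ℝ, m.2.2.2.1 - form ut ux s (proj m) ≠ 0 := by
    by_cases m1 : m.1 = 0
    · by_cases m2 : m.2.1 = 0
      · refine ⟨0, 0, fun h => hbw0 ?_⟩
        simp only [form, proj, hβ, m1, m2] at h hmβ
        have hm4 : m.2.2.2.1 = s * m.2.2.1 := by linarith
        have hm5 : m.2.2.2.2 = s ^ 3 * m.2.2.1 := by linarith
        rw [pd_total, m1, m2, hm4, hm5] at hmf
        have : m.2.2.1 * (pd Ey f p + pd Eu f p * s + 0 * s ^ 2 + pd Ev f p * s ^ 3) = 0 := by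
          linear_combination hmf
        have hm3 := (mul_eq_zero.1 this).resolve_right hs2
        rw [hm3, mul_zero] at hm4 hm5
        rw [← hmV, pd_total, m1, m2, hm3, hm4, hm5]
        ring
      · refine ⟨0, (m.2.2.2.1 - s * m.2.2.1 - 1) / m.2.1, ?_⟩
        simp only [form, proj]
        have : m.2.2.2.1 - (m.1 * 0 + m.2.1 * ((m.2.2.2.1 - s * m.2.2.1 - 1) / m.2.1)
          + m.2.2.1 * s) = 1 := by field_simp; ring
        rw [this]; norm_num
    · refine ⟨(m.2.2.2.1 - s * m.2.2.1 - 1) / m.1, 0, ?_⟩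
      simp only [form, proj]
      have : m.2.2.2.1 - (m.1 * ((m.2.2.2.1 - s * m.2.2.1 - 1) / m.1) + m.2.1 * 0
        + m.2.2.1 * s) = 1 := by field_simp; ring
      rw [this]; norm_num
  have hinj : ∀ z, pd (lift (form ut ux s) β z) (cT Φ) p = 0 →
      pd (lift (form ut ux s) β z) (cX Φ) p = 0 →
      pd (lift (form ut ux s) β z) (cY Φ) p = 0 → z = 0 := by
    intro z z1 z2 z3
    have hk := span _ z1 z2 z3
    set k := lift (form ut ux s) β z with hkdef
    have kα : k.2.2.2.1 - form ut ux s (proj k) = 0 := by simp [hkdef, lift, proj, form]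
    have kβ : k.2.2.2.2 - β (proj k) = 0 := by simp [hkdef, lift, proj, hβ, form]
    generalize pd k (cU Φ) p = g at hk
    generalize pd k (cV Φ) p = g' at hk
    have e1 : g * bw + g' * bw' = 0 := by
      rw [hk] at kβ
      simp only [hβ, form, proj, hbw, hbw', Prod.fst_add, Prod.snd_add, Prod.smul_fst,
        Prod.smul_snd, smul_eq_mul] at kβ ⊢
      linear_combination kβ
    have e2 : g' * (m.2.2.2.1 - form ut ux s (proj m)) = 0 := by
      rw [hk] at kα
      simp only [hm, form, proj, Prod.fst_add, Prod.snd_add, Prod.smul_fst,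
        Prod.smul_snd, smul_eq_mul] at kα ⊢
      linear_combination bw * kα - e1 * (w.2.2.2.1 - (w.1 * ut + w.2.1 * ux + w.2.2.1 * s))
    have g0' : g' = 0 := (mul_eq_zero.1 e2).resolve_right hA
    have g0 : g = 0 := by
      rw [g0', zero_mul, add_zero] at e1
      exact (mul_eq_zero.1 e1).resolve_right hbw0
    rw [g0, g0', zero_smul, zero_smul, add_zero] at hk
    simp only [hkdef, lift, Prod.mk_eq_zero] at hk
    exact Prod.ext hk.1 (Prod.ext hk.2.1 hk.2.2.1)
  obtain ⟨ξ, A, B, C, hF⟩ := exists_isFrame hinj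
  obtain ⟨C', hsol⟩ := exists_solution p hs0 (s ^ 2) (s ^ 3) ut ux
  have ident : ∀ d k m : ℝ, A = pd (lift (form ut ux s) β ξ)
      (pd (lift (form ut ux s) β ξ) (defect Φ A B C)) p
      + pd Eu (defect Φ A B C) p * (C' ξ + d * ξ.1 ^ 2 + k * ξ.2.1 ^ 2 + m * ξ.2.2 ^ 2)
      + pd Ev (defect Φ A B C) p * ((s ^ 2 - 2 * s * uT p) * ξ.2.1 ^ 2 + 2 * s * ut * ξ.1 ^ 2
          + 2 * m / s * ξ.2.2 * (s * ξ.2.1 + s ^ 2 * ξ.1) + 0 * ξ.2.2 ^ 2) + 2 * cU Φ p * B := by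
    intro d k m
    obtain ⟨D, u, v, hD, hz, hu, hv, hs, hg, hα, hβ', hu2, hv2, -⟩ := hsol d k m 0
    have := hΦ.second_order_identity hD hu hv hs hz hp hg (by rw [hα, hβ']; exact hF)
    rw [hα, hβ', hu2, hv2] at this
    exact this
  have i0 := ident 0 0 0
  have i1 := ident 1 0 0
  have i2 := ident 0 1 0
  have i3 := ident 0 0 1
  set fu := pd Eu (defect Φ A B C) p with hfu
  set fv := pd Ev (defect Φ A B C) p with hfv
  -- The parameters d, k, m do not affect the frame, so their coefficients vanish. Since ξ ≠ 0, this
  -- forces fu = 0.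
  have j1 : fu * ξ.1 ^ 2 = 0 := by linear_combination i0 - i1
  have j2 : fu * ξ.2.1 ^ 2 = 0 := by linear_combination i0 - i2
  have j3 : fu * ξ.2.2 ^ 2 + fv * (2 * 1 / s * ξ.2.2 * (s * ξ.2.1 + s ^ 2 * ξ.1)) = 0 := by
    linear_combination i0 - i3
  have hfu0 : fu = 0 := by
    by_contra hne
    have k1 : ξ.1 = 0 := by simpa [hne] using j1
    have k2 : ξ.2.1 = 0 := by simpa [hne] using j2
    rw [k1, k2] at j3
    have k3 : ξ.2.2 = 0 := by simpa [hne] using j3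
    exact hF.ne_zero (Prod.ext k1 (Prod.ext k2 k3))
  -- With fu = 0 the differential of the defect is fv times dv − β. On w it is 0 while bw ≠ 0, so fv
  -- = 0; but on w' it is dṽ(w') = 1.
  have r1 := hF.pd_defect_eq hΩ hsm hp w
  have r2 := hF.pd_defect_eq hΩ hsm hp w'
  rw [pd_defect hΩ hsm A B C _ p hp, hw.1, hw.2.1, hw.2.2.1, hw.2.2.2.2, ← hfu, ← hfv, hfu0] at r1
  rw [pd_defect hΩ hsm A B C _ p hp, hw'.1, hw'.2.1, hw'.2.2.1, hw'.2.2.2.2, ← hfu, ← hfv,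
    hfu0] at r2
  have r3 : fv * bw = 0 := by rw [hbw, hβ]; linarith
  have hfv0 : fv = 0 := (mul_eq_zero.1 r3).resolve_right hbw0
  rw [hfv0] at r2
  norm_num at r2

end

/-! ### The direction of `∂/∂x̃`: `t̃` and `ỹ` depend on `t` and `y` only. -/

section

variable {Ω : Set Total} {Φ : Total → Total}

/-- Changing the first derivatives of u moves lifted vectors only along ∂/∂u, to which the
components other than ũ are insensitive. -/
theorem lift_form_eq_add (a b c : ℝ) (β : Base → ℝ) (w : Base) :
    lift (form a b c) β w = lift (form 0 0 0) β w + form a b c w • Eu := by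
  ext <;> simp [lift, form]

theorem pd_pd_add_smul {f : Total → ℝ} (hΩ : IsOpen Ω) (hf : ContDiffOn ℝ ∞ f Ω)
    (h : ∀ q ∈ Ω, pd Eu f q = 0) (k : Total) (r : ℝ) {p : Total} (hp : p ∈ Ω) :
    pd (k + r • Eu) (pd (k + r • Eu) f) p = pd k (pd k f) p := by
  have h1 : ∀ q ∈ Ω, pd (k + r • Eu) f q = pd k f q := fun q hq => by
    rw [pd_add_dir, pd_smul_dir, h q hq]; ring
  rw [pd_congr hΩ _ h1 p hp, pd_add_dir, pd_smul_dir, pd_pd_eq_zero hΩ hf h k p hp]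
  ring

/-- The consequences of the second equation after the dependence on `u` has been settled. -/
theorem IsPointSymmetry.frame_identity (hΦ : IsPointSymmetry Ω Φ) {p : Total} (hp : p ∈ Ω)
    {ρ θ n : ℝ} (hρ : ρ ≠ 0) {ξ : Base} {A B C : ℝ}
    (hF : IsFrame Φ p (form 0 0 0) (form θ ρ n) ξ A B C) :
    ξ.1 = 0 ∧ ξ.2.2 = 0 ∧ pd Ev (defect Φ A B C) p ≠ 0 ∧
      A = pd (lift (form 0 0 0) (form θ ρ n) ξ)
          (pd (lift (form 0 0 0) (form θ ρ n) ξ) (defect Φ A B C)) p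
        + pd Ev (defect Φ A B C) p * ((θ - 2 * ρ * uT p) * ξ.2.1 ^ 2) + 2 * cU Φ p * B := by
  have hΩ := hΦ.isOpen
  have hsm := hΦ.smooth
  have hdf := contDiffOn_defect hsm A B C
  have hfu : ∀ q ∈ Ω, pd Eu (defect Φ A B C) q = 0 := fun q hq => by
    obtain ⟨h1, h2, h3, h4⟩ := hΦ.pd_Eu_eq_zero hq
    rw [pd_defect hΩ hsm A B C _ q hq, h1, h2, h3, h4]; ring
  have hfv : pd Ev (defect Φ A B C) p ≠ 0 := by
    intro h0
    obtain ⟨w', hw'⟩ := hΦ.toIsPointTransformation.exists_pd_eq hp 0 0 0 0 1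
    have := hF.pd_defect_eq hΩ hsm hp w'
    rw [h0, hfu p hp, pd_defect hΩ hsm A B C _ p hp, hw'.1, hw'.2.1, hw'.2.2.1, hw'.2.2.2.2] at this
    norm_num at this
  have hlift : ∀ {f : Total → ℝ} (a b c : ℝ) (w : Base), pd Eu f p = 0 →
      pd (lift (form a b c) (form θ ρ n) w) f p = pd (lift (form 0 0 0) (form θ ρ n) w) f p := by
    intro f a b c w h
    rw [lift_form_eq_add, pd_add_dir, pd_smul_dir, h]; ring
  -- One frame serves every choice of u_t, u_x, u_y, since t̃, x̃, ỹ, ṽ do not see u. Hence u_t = e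
  -- becomes a further free parameter, entering through v_tt = 2ρe.
  have hF' : ∀ a b c : ℝ, IsFrame Φ p (form a b c) (form θ ρ n) ξ A B C := by
    intro a b c
    obtain ⟨h1, h2, h3, h4⟩ := hΦ.pd_Eu_eq_zero hp
    exact
      { inj := fun w w1 w2 w3 => hF.inj w (hlift a b c w h1 ▸ w1) (hlift a b c w h2 ▸ w2)
          (hlift a b c w h3 ▸ w3)
        pd_T := by rw [hlift a b c ξ h1, hF.pd_T]
        pd_X := by rw [hlift a b c ξ h2, hF.pd_X]
        pd_Y := by rw [hlift a b c ξ h3, hF.pd_Y]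
        pd_V := fun w => by
          rw [hlift a b c w h1, hlift a b c w h2, hlift a b c w h3, hlift a b c w h4, hF.pd_V] }
  have ident : ∀ e l : ℝ, A = pd (lift (form 0 0 0) (form θ ρ n) ξ)
          (pd (lift (form 0 0 0) (form θ ρ n) ξ) (defect Φ A B C)) p
        + pd Ev (defect Φ A B C) p * ((θ - 2 * ρ * uT p) * ξ.2.1 ^ 2 + 2 * ρ * e * ξ.1 ^ 2
          + l * ξ.2.2 ^ 2) + 2 * cU Φ p * B := by
    intro e l
    obtain ⟨C', hsol⟩ := exists_solution p hρ θ n e 0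
    obtain ⟨D, u, v, hD, hz, hu, hv, hs, hg, hα, hβ, -, hv2, -⟩ := hsol 0 0 0 l
    have := hΦ.second_order_identity hD hu hv hs hz hp hg (by rw [hα, hβ]; exact hF' _ _ _)
    rw [hα, hβ, hv2, hfu p hp, lift_form_eq_add, pd_pd_add_smul hΩ hdf hfu _ _ hp] at this
    linear_combination this
  have i0 := ident 0 0
  have i1 := ident 1 0
  have i2 := ident 0 1
  have j1 : pd Ev (defect Φ A B C) p * (2 * ρ * ξ.1 ^ 2) = 0 := by linear_combination i0 - i1
  have j2 : pd Ev (defect Φ A B C) p * ξ.2.2 ^ 2 = 0 := by linear_combination i0 - i2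
  refine ⟨by simpa [hfv, hρ] using j1, by simpa [hfv] using j2, hfv, ?_⟩
  linear_combination i0

/-- The components `t̃` and `ỹ` of a point symmetry depend only on `t` and `y`. -/
theorem IsPointSymmetry.pd_Ex_Ev_eq_zero (hΦ : IsPointSymmetry Ω Φ) {p : Total} (hp : p ∈ Ω) :
    pd Ex (cT Φ) p = 0 ∧ pd Ev (cT Φ) p = 0 ∧ pd Ex (cY Φ) p = 0 ∧ pd Ev (cY Φ) p = 0 ∧
      ¬(pd Ex (cX Φ) p = 0 ∧ pd Ev (cX Φ) p = 0) := by
  have hPT := hΦ.toIsPointTransformation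
  obtain ⟨hT, hX, hY, hV⟩ := hΦ.pd_Eu_eq_zero hp
  obtain ⟨w, hw⟩ := hPT.exists_pd_eq hp 0 0 0 1 0
  obtain ⟨w', hw'⟩ := hPT.exists_pd_eq hp 0 0 0 0 1
  have span := fun k => hPT.eq_of_pd hp (k := k) hw hw'
  -- Since ∂/∂u is annihilated by dt̃, dx̃, dỹ and dṽ, it is a nonzero multiple of w = ∂/∂ũ.
  have hwz : w.1 = 0 ∧ w.2.1 = 0 ∧ w.2.2.1 = 0 ∧ w.2.2.2.2 = 0 := by
    have h := span Eu hT hX hY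
    rw [hV, zero_smul, add_zero] at h
    simp only [Prod.ext_iff, Prod.smul_fst, Prod.smul_snd, smul_eq_mul] at h
    obtain ⟨h1, h2, h3, h4, h5⟩ := h
    have h0 : pd Eu (cU Φ) p ≠ 0 := fun h0 => by rw [h0] at h4; simp at h4
    exact ⟨(mul_eq_zero.1 h1.symm).resolve_left h0, (mul_eq_zero.1 h2.symm).resolve_left h0,
      (mul_eq_zero.1 h3.symm).resolve_left h0, (mul_eq_zero.1 h5.symm).resolve_left h0⟩
  have hw'0 : ¬(w'.2.2.2.2 = 0 ∧ -w'.2.1 = 0 ∧ -w'.1 = 0 ∧ -w'.2.2.1 = 0) := by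
    rintro ⟨z5, z2, z1, z3⟩
    have h := hw'.2.2.2.2
    rw [pd_total, z5, neg_eq_zero.1 z1, neg_eq_zero.1 z2, neg_eq_zero.1 z3, hV] at h
    norm_num at h
  have key : ∀ᶠ s in Filter.cofinite, pd Ex (cT Φ) p + s * pd Ev (cT Φ) p = 0 ∧
      pd Ex (cY Φ) p + s * pd Ev (cY Φ) p = 0 ∧ pd Ex (cX Φ) p + s * pd Ev (cX Φ) p ≠ 0 := by
    filter_upwards [Filter.eventually_cofinite_ne (0 : ℝ), eventually_cubic_ne_zero hw'0]
      with s hs0 hs1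
    obtain ⟨ξ, A, B, C, hF⟩ := exists_isFrame (Φ := Φ) (p := p) (a := 0) (b := 0) (c := 0)
      (a' := s ^ 2) (b' := s) (c' := s ^ 3) (by
        intro z z1 z2 z3
        have hk := span _ z1 z2 z3
        generalize pd (lift (form 0 0 0) (form (s ^ 2) s (s ^ 3)) z) (cU Φ) p = g at hk
        generalize pd (lift (form 0 0 0) (form (s ^ 2) s (s ^ 3)) z) (cV Φ) p = g' at hk
        simp only [lift, form, Prod.ext_iff, Prod.fst_add, Prod.snd_add, Prod.smul_fst,
          Prod.smul_snd, smul_eq_mul, hwz.1, hwz.2.1, hwz.2.2.1, hwz.2.2.2] at hk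
        obtain ⟨k1, k2, k3, -, k5⟩ := hk
        have hg' : g' * (w'.2.2.2.2 + -w'.2.1 * s + -w'.1 * s ^ 2 + -w'.2.2.1 * s ^ 3) = 0 := by
          linear_combination (-1) * k5 + s ^ 2 * k1 + s * k2 + s ^ 3 * k3
        have g0 := (mul_eq_zero.1 hg').resolve_right hs1
        rw [g0] at k1 k2 k3
        exact Prod.ext (by simpa using k1) (Prod.ext (by simpa using k2) (by simpa using k3)))
    obtain ⟨h1, h3, -, -⟩ := hΦ.frame_identity hp hs0 hF
    have h2 : ξ.2.1 ≠ 0 := fun h2 => hF.ne_zero (Prod.ext h1 (Prod.ext h2 h3))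
    have e1 := hF.pd_T
    have e2 := hF.pd_X
    have e3 := hF.pd_Y
    rw [pd_total] at e1 e2 e3
    simp only [lift, form, h1, h3] at e1 e2 e3
    refine ⟨?_, ?_, fun h0 => ?_⟩
    · apply mul_left_cancel₀ h2; linear_combination e1
    · apply mul_left_cancel₀ h2; linear_combination e3
    · have : ξ.2.1 * (pd Ex (cX Φ) p + s * pd Ev (cX Φ) p) = 1 := by linear_combination e2
      rw [h0] at this
      norm_num at this
  obtain ⟨s, hsT, hsY, hsX⟩ := key.exists
  -- The relation t̃_x + ρ t̃_v = 0 for two different values of ρ separates its two terms; likewise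
  -- for ỹ.
  obtain ⟨r, ⟨hrT, hrY, -⟩, hrs⟩ := (key.and (Filter.eventually_cofinite_ne s)).exists
  have hrs' : r - s ≠ 0 := sub_ne_zero.2 hrs
  have hTv : pd Ev (cT Φ) p = 0 := by
    apply mul_left_cancel₀ hrs'; linear_combination hrT - hsT
  have hYv : pd Ev (cY Φ) p = 0 := by
    apply mul_left_cancel₀ hrs'; linear_combination hrY - hsY
  rw [hTv] at hsT
  rw [hYv] at hsY
  refine ⟨by linear_combination hsT, hTv, by linear_combination hsY, hYv, fun h => hsX ?_⟩
  rw [h.1, h.2]; ring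

end

/-! ### Comparing coefficients in the second equation. -/

/-- The direction `∂/∂x + ρ ∂/∂v`. -/
abbrev Exv (ρ : ℝ) : Total := (0, 1, 0, 0, ρ)

theorem pd_Exv (ρ : ℝ) (f : Total → ℝ) (p : Total) :
    pd (Exv ρ) f p = pd Ex f p + ρ * pd Ev f p := by
  rw [pd_total]; simp

section

variable {Ω : Set Total} {Φ : Total → Total}

/-- The second equation as a relation between the derivatives of the components, for arbitrary
values `ρ`, `θ`, `n` of `v_x`, `v_t`, `v_y`. -/
theorem IsPointSymmetry.jet_identity (hΦ : IsPointSymmetry Ω Φ) {p : Total} (hp : p ∈ Ω) {ρ : ℝ}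
    (hρ : ρ ≠ 0) (hl : pd Ex (cX Φ) p + ρ * pd Ev (cX Φ) p ≠ 0) :
    pd Et (cT Φ) p * pd Ey (cY Φ) p - pd Ey (cT Φ) p * pd Et (cY Φ) p ≠ 0 ∧
    ∃ B, B * (pd Ex (cX Φ) p + ρ * pd Ev (cX Φ) p) = pd Ex (cV Φ) p + ρ * pd Ev (cV Φ) p ∧
      pd Ev (cV Φ) p - B * pd Ev (cX Φ) p ≠ 0 ∧ ∀ θ n : ℝ,
        (pd Ey (cY Φ) p * (pd Et (cV Φ) p - B * pd Et (cX Φ) p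
              + θ * (pd Ev (cV Φ) p - B * pd Ev (cX Φ) p))
            - pd Et (cY Φ) p * (pd Ey (cV Φ) p - B * pd Ey (cX Φ) p
              + n * (pd Ev (cV Φ) p - B * pd Ev (cX Φ) p)))
            * (pd Ex (cX Φ) p + ρ * pd Ev (cX Φ) p) ^ 2
          = (pd Et (cT Φ) p * pd Ey (cY Φ) p - pd Ey (cT Φ) p * pd Et (cY Φ) p)
            * (pd (Exv ρ) (pd (Exv ρ) (cV Φ)) p - B * pd (Exv ρ) (pd (Exv ρ) (cX Φ)) p
              + (pd Ev (cV Φ) p - B * pd Ev (cX Φ) p) * (θ - 2 * ρ * uT p)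
              + 2 * cU Φ p * B * (pd Ex (cX Φ) p + ρ * pd Ev (cX Φ) p) ^ 2) := by
  have hΩ := hΦ.isOpen
  have hsm := hΦ.smooth
  have hPT := hΦ.toIsPointTransformation
  obtain ⟨uT0, uX0, uY0, uV0⟩ := hΦ.pd_Eu_eq_zero hp
  obtain ⟨xT0, vT0, xY0, vY0, -⟩ := hΦ.pd_Ex_Ev_eq_zero hp
  -- As t̃ and ỹ involve only t and y, this block of the Jacobian must be invertible by itself.
  have hdet : pd Et (cT Φ) p * pd Ey (cY Φ) p - pd Ey (cT Φ) p * pd Et (cY Φ) p ≠ 0 := by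
    obtain ⟨k, k1, -, k3, -⟩ := hPT.exists_pd_eq hp 1 0 0 0 0
    obtain ⟨l, l1, -, l3, -⟩ := hPT.exists_pd_eq hp 0 0 1 0 0
    rw [pd_total] at k1 k3 l1 l3
    simp only [uT0, uY0, xT0, vT0, xY0, vY0, mul_zero, add_zero] at k1 k3 l1 l3
    intro h0
    have : (1 : ℝ) = 0 := by
      linear_combination (k.1 * l.2.2.1 - k.2.2.1 * l.1) * h0
        - (l.1 * pd Et (cY Φ) p + l.2.2.1 * pd Ey (cY Φ) p) * k1
        + (l.1 * pd Et (cT Φ) p + l.2.2.1 * pd Ey (cT Φ) p) * k3 - l3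
    norm_num at this
  refine ⟨hdet, ?_⟩
  set ℓ := pd Ex (cX Φ) p + ρ * pd Ev (cX Φ) p with hℓ
  set B := (pd Ex (cV Φ) p + ρ * pd Ev (cV Φ) p) / ℓ with hB
  have hBℓ : B * ℓ = pd Ex (cV Φ) p + ρ * pd Ev (cV Φ) p := div_mul_cancel₀ _ hl
  have main : ∀ θ n : ℝ, pd Ev (cV Φ) p - B * pd Ev (cX Φ) p ≠ 0 ∧
      (pd Ey (cY Φ) p * (pd Et (cV Φ) p - B * pd Et (cX Φ) p
              + θ * (pd Ev (cV Φ) p - B * pd Ev (cX Φ) p))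
            - pd Et (cY Φ) p * (pd Ey (cV Φ) p - B * pd Ey (cX Φ) p
              + n * (pd Ev (cV Φ) p - B * pd Ev (cX Φ) p))) * ℓ ^ 2
          = (pd Et (cT Φ) p * pd Ey (cY Φ) p - pd Ey (cT Φ) p * pd Et (cY Φ) p)
            * (pd (Exv ρ) (pd (Exv ρ) (cV Φ)) p - B * pd (Exv ρ) (pd (Exv ρ) (cX Φ)) p
              + (pd Ev (cV Φ) p - B * pd Ev (cX Φ) p) * (θ - 2 * ρ * uT p)
              + 2 * cU Φ p * B * ℓ ^ 2) := by
    intro θ n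
    obtain ⟨ξ, A, B', C, hF⟩ := exists_isFrame (Φ := Φ) (p := p) (a := 0) (b := 0) (c := 0)
      (a' := θ) (b' := ρ) (c' := n) (by
        intro z z1 z2 z3
        rw [pd_total] at z1 z2 z3
        simp only [lift, form, uT0, uY0, uX0, xT0, vT0, xY0, vY0, mul_zero, add_zero] at z1 z2 z3
        have e1 : z.1 = 0 := by
          apply mul_left_cancel₀ hdet
          linear_combination pd Ey (cY Φ) p * z1 - pd Ey (cT Φ) p * z3
        have e3 : z.2.2 = 0 := by
          apply mul_left_cancel₀ hdet
          linear_combination pd Et (cT Φ) p * z3 - pd Et (cY Φ) p * z1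
        rw [e1, e3] at z2
        have e2 : z.2.1 = 0 := by
          apply mul_left_cancel₀ hl
          linear_combination z2 + z.2.1 * hℓ
        exact Prod.ext e1 (Prod.ext e2 e3))
    obtain ⟨h1, h3, hfv, hid⟩ := hΦ.frame_identity hp hρ hF
    have fX := hF.pd_X
    have fx := hF.pd_V ex
    have ft := hF.pd_V et
    have fy := hF.pd_V ey
    have hk0 : lift (form 0 0 0) (form θ ρ n) ξ = ξ.2.1 • Exv ρ := by
      ext <;> simp [lift, form, h1, h3]
    rw [hk0] at hid fX
    rw [pd_smul_dir, pd_Exv] at fX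
    rw [pd_total, pd_total _ (cT Φ), pd_total _ (cX Φ), pd_total _ (cY Φ)] at fx ft fy
    simp only [lift, form, uT0, uX0, uY0, uV0, xT0, vT0, xY0, vY0] at fx ft fy
    -- The x-derivative along the graph determines ṽ_{x̃} from ρ alone, so B is the same for all θ
    -- and n; this permits comparison of coefficients in θ and n.
    have hBB : B' = B := by
      apply mul_right_cancel₀ hl
      rw [hBℓ]
      linear_combination (-1) * fx
    subst hBB
    have hdv : pd Ev (defect Φ A B C) p = pd Ev (cV Φ) p - B * pd Ev (cX Φ) p := by
      rw [pd_defect hΩ hsm A B C _ p hp, vT0, vY0]; ring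
    have hd1 : ∀ q ∈ Ω, pd (ξ.2.1 • Exv ρ) (defect Φ A B C) q =
        ξ.2.1 * (pd (Exv ρ) (cV Φ) q - B * pd (Exv ρ) (cX Φ) q) := fun q hq => by
      obtain ⟨a1, a2, a3, a4, -⟩ := hΦ.pd_Ex_Ev_eq_zero hq
      rw [pd_smul_dir, pd_defect hΩ hsm A B C _ q hq, pd_Exv ρ (cT Φ), pd_Exv ρ (cY Φ), a1, a2, a3,
        a4]
      ring
    have sV := contDiffOn_pd hΩ (Exv ρ) (contDiffOn_cV hsm)
    have sX := contDiffOn_pd hΩ (Exv ρ) (contDiffOn_cX hsm)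
    have sBX : ContDiffOn ℝ ∞ (fun q => B * pd (Exv ρ) (cX Φ) q) Ω := contDiffOn_const.mul sX
    have hd2 : pd (ξ.2.1 • Exv ρ) (pd (ξ.2.1 • Exv ρ) (defect Φ A B C)) p =
        ξ.2.1 * (ξ.2.1 * (pd (Exv ρ) (pd (Exv ρ) (cV Φ)) p
          - B * pd (Exv ρ) (pd (Exv ρ) (cX Φ)) p)) := by
      rw [pd_congr hΩ _ hd1 p hp, pd_smul_dir, pd_const_mul hΩ _ (sV.sub sBX) hp,
        pd_sub hΩ sV sBX hp, pd_const_mul hΩ _ sX hp]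
    rw [hdv] at hfv hid
    rw [hd2] at hid
    refine ⟨hfv, ?_⟩
    generalize pd (Exv ρ) (pd (Exv ρ) (cV Φ)) p = V2 at *
    generalize pd (Exv ρ) (pd (Exv ρ) (cX Φ)) p = X2 at *
    have hξ : ξ.2.1 * ℓ = 1 := fX
    have hA : A * ℓ ^ 2 = V2 - B * X2 + (pd Ev (cV Φ) p - B * pd Ev (cX Φ) p) * (θ - 2 * ρ * uT p)
        + 2 * cU Φ p * B * ℓ ^ 2 := by
      linear_combination ℓ ^ 2 * hid + (V2 - B * X2 + (pd Ev (cV Φ) p - B * pd Ev (cX Φ) p)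
        * (θ - 2 * ρ * uT p)) * (ξ.2.1 * ℓ + 1) * hξ
    rw [← hA]
    -- Cramer's rule: this combination of the t- and y-relations eliminates C = ṽ_ỹ and leaves A
    -- times the determinant.
    linear_combination ℓ ^ 2 * (pd Ey (cY Φ) p * ft - pd Et (cY Φ) p * fy)
  exact ⟨B, hBℓ, (main 0 0).1, fun θ n => (main θ n).2⟩

/-- x̃_x and x̃_v do not both vanish, so the admissible slopes ρ for the jet identity are all but
finitely many. -/
theorem IsPointSymmetry.eventually_ne (hΦ : IsPointSymmetry Ω Φ) {p : Total} (hp : p ∈ Ω) :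
    ∀ᶠ ρ : ℝ in Filter.cofinite, ρ ≠ 0 ∧ pd Ex (cX Φ) p + ρ * pd Ev (cX Φ) p ≠ 0 := by
  obtain ⟨-, -, -, -, hX⟩ := hΦ.pd_Ex_Ev_eq_zero hp
  have h : ¬(pd Ex (cX Φ) p = 0 ∧ pd Ev (cX Φ) p = 0 ∧ (0 : ℝ) = 0 ∧ (0 : ℝ) = 0) := fun h =>
    hX ⟨h.1, h.2.1⟩
  filter_upwards [Filter.eventually_cofinite_ne (0 : ℝ), eventually_cubic_ne_zero h] with ρ h1 h2
  refine ⟨h1, fun h0 => h2 ?_⟩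
  linear_combination h0

/-- The component `ỹ` depends only on `y`, the component `x̃` does not depend on `v`, and
`x̃_x² = t̃_t`. -/
theorem IsPointSymmetry.x_component (hΦ : IsPointSymmetry Ω Φ) {p : Total} (hp : p ∈ Ω) :
    pd Et (cY Φ) p = 0 ∧ pd Ey (cY Φ) p ≠ 0 ∧ pd Ev (cX Φ) p = 0 ∧ pd Ex (cX Φ) p ≠ 0 ∧
      pd Ex (cX Φ) p * pd Ex (cX Φ) p = pd Et (cT Φ) p := by
  have key : pd Et (cY Φ) p = 0 ∧ pd Ey (cY Φ) p ≠ 0 ∧ ∀ᶠ ρ : ℝ in Filter.cofinite,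
      (pd Ex (cX Φ) p + ρ * pd Ev (cX Φ) p) ^ 2 = pd Et (cT Φ) p := by
    have hall : ∀ᶠ ρ : ℝ in Filter.cofinite, pd Et (cY Φ) p = 0 ∧ pd Ey (cY Φ) p ≠ 0 ∧
        (pd Ex (cX Φ) p + ρ * pd Ev (cX Φ) p) ^ 2 = pd Et (cT Φ) p := by
      filter_upwards [hΦ.eventually_ne hp] with ρ hρ
      obtain ⟨hd, B, -, hfv, hid⟩ := hΦ.jet_identity hp hρ.1 hρ.2
      have i0 := hid 0 0
      have i1 := hid 1 0
      have i2 := hid 0 1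
      set fv := pd Ev (cV Φ) p - B * pd Ev (cX Φ) p
      set ℓ := pd Ex (cX Φ) p + ρ * pd Ev (cX Φ) p
      have hYt : pd Et (cY Φ) p = 0 := by
        have : pd Et (cY Φ) p * (fv * ℓ ^ 2) = 0 := by linear_combination i0 - i2
        exact (mul_eq_zero.1 this).resolve_right (mul_ne_zero hfv (pow_ne_zero _ hρ.2))
      rw [hYt, mul_zero, sub_zero] at hd
      have hYy := right_ne_zero_of_mul hd
      refine ⟨hYt, hYy, ?_⟩
      apply mul_left_cancel₀ (mul_ne_zero hYy hfv)
      rw [hYt] at i0 i1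
      linear_combination i1 - i0
    exact ⟨hall.exists.choose_spec.1, hall.exists.choose_spec.2.1, hall.mono fun ρ h => h.2.2⟩
  obtain ⟨hYt, hYy, hsq⟩ := key
  -- (x̃_x + ρ x̃_v)² = t̃_t holds for almost all ρ, hence coefficientwise; the ρ² coefficient gives
  -- x̃_v = 0.
  have hc : pd Ex (cX Φ) p ^ 2 - pd Et (cT Φ) p = 0 ∧ 2 * pd Ex (cX Φ) p * pd Ev (cX Φ) p = 0 ∧
      pd Ev (cX Φ) p ^ 2 = 0 ∧ (0 : ℝ) = 0 := by
    by_contra hne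
    obtain ⟨ρ, h1, h2⟩ := (hsq.and (eventually_cubic_ne_zero hne)).exists
    apply h2
    linear_combination h1
  obtain ⟨c0, -, c2, -⟩ := hc
  have hXv : pd Ev (cX Φ) p = 0 := by simpa using c2
  obtain ⟨-, -, -, -, hX⟩ := hΦ.pd_Ex_Ev_eq_zero hp
  exact ⟨hYt, hYy, hXv, fun h => hX ⟨h, hXv⟩, by linear_combination c0⟩

/-- Differentiate x̃_x² = t̃_t in x: t̃ does not depend on x and x̃_x ≠ 0. -/
theorem IsPointSymmetry.pd_Ex_pd_Ex_cX (hΦ : IsPointSymmetry Ω Φ) {q : Total} (hq : q ∈ Ω) :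
    pd Ex (pd Ex (cX Φ)) q = 0 := by
  have hΩ := hΦ.isOpen
  have hsm := hΦ.smooth
  have sXx := contDiffOn_pd hΩ Ex (contDiffOn_cX hsm)
  have h1 := pd_congr hΩ Ex (f := fun q => pd Ex (cX Φ) q * pd Ex (cX Φ) q)
    (fun q hq => (hΦ.x_component hq).2.2.2.2) q hq
  rw [pd_mul hΩ sXx sXx hq, pd_pd_eq_zero hΩ (contDiffOn_cT hsm)
    (fun q hq => (hΦ.pd_Ex_Ev_eq_zero hq).1) Et q hq] at h1
  have h2 := (hΦ.x_component hq).2.2.2.1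
  apply mul_left_cancel₀ h2
  linarith

/-- The component `ṽ` depends only on `y` and `v`, affinely in `v`, and the component `ũ` is
determined by `t̃` and `x̃`. -/
theorem IsPointSymmetry.u_v_components (hΦ : IsPointSymmetry Ω Φ) :
    ∀ p ∈ Ω, pd Ev (cV Φ) p ≠ 0 ∧ pd Ev (pd Ev (cV Φ)) p = 0 ∧ pd Ex (cV Φ) p = 0 ∧
      pd Et (cV Φ) p = 0 ∧
      uT p = pd Ex (cX Φ) p * cU Φ p + pd Et (cX Φ) p / (2 * pd Ex (cX Φ) p) := by
  have hΩ := hΦ.isOpen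
  have hsm := hΦ.smooth
  have sX := contDiffOn_cX hsm
  have sV := contDiffOn_cV hsm
  have hXx0 : ∀ q ∈ Ω, pd Ex (pd Ex (cX Φ)) q = 0 := fun q hq => hΦ.pd_Ex_pd_Ex_cX hq
  have hXxv : ∀ q ∈ Ω, pd Ev (pd Ex (cX Φ)) q = 0 :=
    pd_pd_eq_zero hΩ sX (fun q hq => (hΦ.x_component hq).2.2.1) Ex
  have coeffs : ∀ p ∈ Ω, pd Ev (cV Φ) p ≠ 0 ∧ pd Ev (pd Ev (cV Φ)) p = 0 ∧
      -(pd Et (cX Φ) p * pd Ev (cV Φ) p) = 2 * pd Ex (cX Φ) p * pd Ex (pd Ev (cV Φ)) p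
        - 2 * uT p * pd Ev (cV Φ) p * pd Ex (cX Φ) p
        + 2 * cU Φ p * pd Ex (cX Φ) p ^ 2 * pd Ev (cV Φ) p ∧
      pd Ex (cX Φ) p * pd Et (cV Φ) p - pd Et (cX Φ) p * pd Ex (cV Φ) p =
        pd Ex (cX Φ) p * pd Ex (pd Ex (cV Φ)) p
          + 2 * cU Φ p * pd Ex (cX Φ) p ^ 2 * pd Ex (cV Φ) p := by
    intro p hp
    obtain ⟨hYt, hYy, hXv, hXx, hsq⟩ := hΦ.x_component hp
    have hρ : ∀ ρ : ℝ, ρ ≠ 0 → pd Ev (cV Φ) p ≠ 0 ∧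
        pd Ex (cX Φ) p * pd Et (cV Φ) p
          - pd Et (cX Φ) p * (pd Ex (cV Φ) p + ρ * pd Ev (cV Φ) p) =
        pd Ex (cX Φ) p * (pd Ex (pd Ex (cV Φ)) p + 2 * ρ * pd Ex (pd Ev (cV Φ)) p
            + ρ ^ 2 * pd Ev (pd Ev (cV Φ)) p)
          - 2 * ρ * uT p * pd Ev (cV Φ) p * pd Ex (cX Φ) p
          + 2 * cU Φ p * pd Ex (cX Φ) p ^ 2 * (pd Ex (cV Φ) p + ρ * pd Ev (cV Φ) p) := by
      intro ρ h0
      obtain ⟨hd, B, hB, hfv, hid⟩ := hΦ.jet_identity hp h0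
        (by rw [hXv, mul_zero, add_zero]; exact hXx)
      have hV2 : pd (Exv ρ) (pd (Exv ρ) (cV Φ)) p = pd Ex (pd Ex (cV Φ)) p
          + 2 * ρ * pd Ex (pd Ev (cV Φ)) p + ρ ^ 2 * pd Ev (pd Ev (cV Φ)) p := by
        have s1 := contDiffOn_pd hΩ Ex sV
        have s2 := contDiffOn_pd hΩ Ev sV
        rw [pd_congr hΩ (Exv ρ) (fun q _ => pd_Exv ρ (cV Φ) q) p hp, pd_Exv,
          pd_add hΩ s1 (contDiffOn_const.mul s2) hp, pd_add hΩ s1 (contDiffOn_const.mul s2) hp,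
          pd_const_mul hΩ _ s2 hp, pd_const_mul hΩ _ s2 hp, pd_comm hΩ sV Ev Ex hp]
        ring
      have hX2 : pd (Exv ρ) (pd (Exv ρ) (cX Φ)) p = 0 := by
        have h1 : ∀ q ∈ Ω, pd (Exv ρ) (cX Φ) q = pd Ex (cX Φ) q := fun q hq => by
          rw [pd_Exv, (hΦ.x_component hq).2.2.1, mul_zero, add_zero]
        rw [pd_congr hΩ (Exv ρ) h1 p hp, pd_Exv, hXx0 p hp, hXxv p hp]; ring
      have i0 := hid 0 0
      rw [hV2, hX2, hYt, hXv, ← hsq] at i0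
      rw [hXv, mul_zero, add_zero] at hB
      rw [hXv, mul_zero, sub_zero] at hfv
      refine ⟨hfv, ?_⟩
      rw [← hB]
      apply mul_left_cancel₀ (mul_ne_zero hYy (mul_ne_zero hXx hXx))
      linear_combination pd Ex (cX Φ) p * i0
    -- The identity, with B x̃_x = ṽ_x + ρ ṽ_v inserted, is quadratic in ρ and holds for all ρ ≠ 0,
    -- so its coefficients vanish separately.
    have hc : (pd Ex (cX Φ) p * pd Et (cV Φ) p - pd Et (cX Φ) p * pd Ex (cV Φ) p)
          - (pd Ex (cX Φ) p * pd Ex (pd Ex (cV Φ)) p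
            + 2 * cU Φ p * pd Ex (cX Φ) p ^ 2 * pd Ex (cV Φ) p) = 0 ∧
        -(pd Et (cX Φ) p * pd Ev (cV Φ) p) - (2 * pd Ex (cX Φ) p * pd Ex (pd Ev (cV Φ)) p
          - 2 * uT p * pd Ev (cV Φ) p * pd Ex (cX Φ) p
          + 2 * cU Φ p * pd Ex (cX Φ) p ^ 2 * pd Ev (cV Φ) p) = 0 ∧
        -(pd Ex (cX Φ) p * pd Ev (pd Ev (cV Φ)) p) = 0 ∧ (0 : ℝ) = 0 := by
      by_contra hne
      obtain ⟨ρ, h1, h2⟩ := ((Filter.eventually_cofinite_ne (0 : ℝ)).and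
        (eventually_cubic_ne_zero hne)).exists
      apply h2
      linear_combination (hρ ρ h1).2
    obtain ⟨c0, c1, c2, -⟩ := hc
    refine ⟨(hρ 1 one_ne_zero).1, ?_, by linear_combination c1, by linear_combination c0⟩
    simpa [hXx] using c2
  have hVu : ∀ q ∈ Ω, pd Eu (cV Φ) q = 0 := fun q hq => (hΦ.pd_Eu_eq_zero hq).2.2.2
  have sVx := contDiffOn_pd hΩ Ex sV
  have sVt := contDiffOn_pd hΩ Et sV
  have sVv := contDiffOn_pd hΩ Ev sV
  have sVxx := contDiffOn_pd hΩ Ex sVx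
  have sVvx := contDiffOn_pd hΩ Ex sVv
  have hVxu := pd_pd_eq_zero hΩ sV hVu Ex
  have hVtu := pd_pd_eq_zero hΩ sV hVu Et
  have hVvu := pd_pd_eq_zero hΩ sV hVu Ev
  have hVxxu := pd_pd_eq_zero hΩ sVx hVxu Ex
  have hVvxu := pd_pd_eq_zero hΩ sVv hVvu Ex
  -- Eliminating ũ between the coefficients of ρ⁰ and ρ¹ also eliminates x̃_t. The right-hand side
  -- does not involve u, so differentiation in u yields ṽ_v ṽ_x = 0.
  have hrel : ∀ p ∈ Ω, uT p * (pd Ev (cV Φ) p * pd Ex (cV Φ) p) =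
      (1 / 2) * (pd Et (cV Φ) p * pd Ev (cV Φ) p) + pd Ex (pd Ev (cV Φ)) p * pd Ex (cV Φ) p
        - (1 / 2) * (pd Ex (pd Ex (cV Φ)) p * pd Ev (cV Φ) p) := by
    intro p hp
    obtain ⟨-, -, c1, c0⟩ := coeffs p hp
    apply mul_left_cancel₀ (hΦ.x_component hp).2.2.2.1
    linear_combination pd Ex (cV Φ) p / 2 * c1 - pd Ev (cV Φ) p / 2 * c0
  have sU : ContDiffOn ℝ ∞ (fun p => uT p) Ω := uT.contDiff.contDiffOn
  have hVx : ∀ p ∈ Ω, pd Ex (cV Φ) p = 0 := by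
    intro p hp
    have h1 := pd_congr hΩ Eu hrel p hp
    rw [pd_mul hΩ sU (sVv.mul sVx) hp, pd_clm,
      pd_sub hΩ ((contDiffOn_const.mul (sVt.mul sVv)).add (sVvx.mul sVx))
        (contDiffOn_const.mul (sVxx.mul sVv)) hp,
      pd_add hΩ (contDiffOn_const.mul (sVt.mul sVv)) (sVvx.mul sVx) hp,
      pd_const_mul hΩ _ (sVt.mul sVv) hp, pd_const_mul hΩ _ (sVxx.mul sVv) hp,
      pd_mul hΩ sVt sVv hp, pd_mul hΩ sVvx sVx hp, pd_mul hΩ sVxx sVv hp, pd_mul hΩ sVv sVx hp,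
      hVxu p hp, hVtu p hp, hVvu p hp, hVxxu p hp, hVvxu p hp] at h1
    have h2 : uT Eu = 1 := rfl
    rw [h2] at h1
    have h3 : pd Ev (cV Φ) p * pd Ex (cV Φ) p = 0 := by linear_combination h1
    exact (mul_eq_zero.1 h3).resolve_left (coeffs p hp).1
  intro p hp
  obtain ⟨h1, h2, c1, c0⟩ := coeffs p hp
  have hXx := (hΦ.x_component hp).2.2.2.1
  have hVxx : pd Ex (pd Ex (cV Φ)) p = 0 := pd_eq_zero_of_const hΩ Ex hVx p hp
  have hVvx : pd Ex (pd Ev (cV Φ)) p = 0 := by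
    rw [pd_comm hΩ sV Ex Ev hp]; exact pd_eq_zero_of_const hΩ Ev hVx p hp
  rw [hVx p hp, hVxx] at c0
  rw [hVvx] at c1
  refine ⟨h1, h2, hVx p hp, ?_, ?_⟩
  · apply mul_left_cancel₀ hXx
    linear_combination c0
  · field_simp
    apply mul_left_cancel₀ h1
    linear_combination c1

end

/-! ### Slices, and what the first equation adds. -/

/-- A function on a convex open set is constant along segments in whose direction its derivative
vanishes. -/
theorem eq_of_pd_eq_zero {E : Type*} [NormedAddCommGroup E] [NormedSpace ℝ E] {S : Set E}
    (hS : IsOpen S) (hc : Convex ℝ S) {f : E → ℝ} (hf : ContDiffOn ℝ ∞ f S) {q q' : E}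
    (hq : q ∈ S) (hq' : q' ∈ S) (h : ∀ z ∈ S, pd (q' - q) f z = 0) : f q' = f q := by
  obtain ⟨z, hz, he⟩ := domain_mvt (f := f) (f' := fun z => fderiv ℝ f z)
    (fun z hz => (differentiableAt_of_mem hS hf hz).hasFDerivAt.hasFDerivWithinAt) hc hq hq'
  have := h z (hc.segment_subset hq hq' hz)
  rw [pd] at this
  linarith

/-- The point of the total space over `z` with the dependent coordinates of `p`. -/
def slice (p : Total) (z : Base) : Total := (z.1, z.2.1, z.2.2, uT p, vT p)

theorem contDiff_slice (p : Total) : ContDiff ℝ ∞ (slice p) := by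
  unfold slice
  fun_prop

theorem fderiv_slice (p : Total) (z w : Base) :
    fderiv ℝ (slice p) z w = (w.1, w.2.1, w.2.2, 0, 0) := by
  rw [fderiv_total_eq ((contDiff_slice p).differentiable (by simp)).differentiableAt]
  exact Prod.ext (pd_clm tB w z) (Prod.ext (pd_clm xB w z) (Prod.ext (pd_clm yB w z)
    (Prod.ext (pd_const _ _ _) (pd_const _ _ _))))

theorem slice_proj (p : Total) : slice p (proj p) = p := rfl

/-- Balls of the product metric are boxes, so replacing the last two coordinates by those of the
centre stays inside. -/
theorem slice_mem_ball {p q : Total} {r : ℝ} (hq : q ∈ Metric.ball p r) :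
    slice p (proj q) ∈ Metric.ball p r := by
  obtain ⟨a, b, c, d, e⟩ := q
  obtain ⟨a', b', c', d', e'⟩ := p
  simp only [Metric.mem_ball, slice, proj, Prod.dist_eq, max_lt_iff] at hq ⊢
  refine ⟨hq.1, hq.2.1, hq.2.2.1, ?_, ?_⟩
  · change dist d' d' < r
    rw [dist_self]; exact lt_of_le_of_lt dist_nonneg hq.1
  · change dist e' e' < r
    rw [dist_self]; exact lt_of_le_of_lt dist_nonneg hq.1

theorem burgers_comp_t {h : ℝ → ℝ} (hh : ContDiff ℝ ∞ h) :
    burgers (fun z => h (tB z)) = fun z => deriv h (tB z) := by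
  have hd : ∀ x, DifferentiableAt ℝ h x := (contDiff_infty_iff_deriv.1 hh).1
  have h1 : ∀ w, pd w (fun z => h (tB z)) = fun z => tB w * deriv h (tB z) := fun w =>
    funext fun z => pd_comp_clm tB (hd _) w
  funext z
  simp only [burgers, h1]
  have h2 : tB ex = 0 := rfl
  have h3 : tB et = 1 := rfl
  simp [h2, h3, pd_const]

theorem burgers_comp_x {h : ℝ → ℝ} (hh : ContDiff ℝ ∞ h) :
    burgers (fun z => h (xB z)) =
      fun z => -2 * (h (xB z) * deriv h (xB z)) + deriv (deriv h) (xB z) := by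
  have hd : ∀ x, DifferentiableAt ℝ h x := (contDiff_infty_iff_deriv.1 hh).1
  have hd' : ∀ x, DifferentiableAt ℝ (deriv h) x :=
    (contDiff_infty_iff_deriv.1 (contDiff_infty_iff_deriv.1 hh).2).1
  have h2 : xB ex = 1 := rfl
  have h3 : xB et = 0 := rfl
  have h1 : ∀ w, pd w (fun z => h (xB z)) = fun z => xB w * deriv h (xB z) := fun w =>
    funext fun z => pd_comp_clm xB (hd _) w
  funext z
  simp only [burgers, h1, h2, h3, one_mul]
  rw [pd_comp_clm xB (hd' _), h2]
  ring

theorem pd_ey_comp_t {h : ℝ → ℝ} (hh : ContDiff ℝ ∞ h) (z : Base) :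
    pd ey (fun z => h (tB z)) z = 0 := by
  rw [pd_comp_clm tB ((contDiff_infty_iff_deriv.1 hh).1 _)]
  have : tB ey = 0 := rfl
  rw [this, zero_mul]

theorem pd_ey_comp_x {h : ℝ → ℝ} (hh : ContDiff ℝ ∞ h) (z : Base) :
    pd ey (fun z => h (xB z)) z = 0 := by
  rw [pd_comp_clm xB ((contDiff_infty_iff_deriv.1 hh).1 _)]
  have : xB ey = 0 := rfl
  rw [this, zero_mul]

section

variable {Ω : Set Total} {Φ : Total → Total}

/-- The change of the independent variables on the slice of a ball through its centre. -/
theorem IsPointSymmetry.isBaseChange_slice (hΦ : IsPointSymmetry Ω Φ) {p : Total} {D : Set Base}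
    (hD : IsOpen D) (hDΩ : ∀ z ∈ D, slice p z ∈ Ω) :
    IsBaseChange D (fun z => cT Φ (slice p z)) (fun z => cX Φ (slice p z))
      (fun z => cY Φ (slice p z)) (fun z => pd Ex (cX Φ) (slice p z)) ∧
    ∀ {f : Total → ℝ}, ContDiffOn ℝ ∞ f Ω → ContDiffOn ℝ ∞ (fun z => f (slice p z)) D ∧
      ∀ z ∈ D, ∀ w : Base,
        pd w (fun z => f (slice p z)) z = pd (w.1, w.2.1, w.2.2, 0, 0) f (slice p z) := by
  have hΩ := hΦ.isOpen
  have hsm := hΦ.smooth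
  have hcomp : ∀ {f : Total → ℝ}, ContDiffOn ℝ ∞ f Ω → ContDiffOn ℝ ∞ (fun z => f (slice p z)) D ∧
      ∀ z ∈ D, ∀ w : Base,
        pd w (fun z => f (slice p z)) z = pd (w.1, w.2.1, w.2.2, 0, 0) f (slice p z) :=
    fun hf => ⟨hf.comp (contDiff_slice p).contDiffOn hDΩ, fun z hz w => by
      rw [← fderiv_slice p z w]
      exact pd_comp (G := slice p) (differentiableAt_of_mem hΩ hf (hDΩ z hz))
        ((contDiff_slice p).differentiable (by simp)).differentiableAt w⟩
  have sT := contDiffOn_cT hsm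
  have sX := contDiffOn_cX hsm
  have sY := contDiffOn_cY hsm
  have sXx := contDiffOn_pd hΩ Ex sX
  refine ⟨?_, hcomp⟩
  exact
    { isOpen := hD
      smooth_τ := (hcomp sT).1
      smooth_χ := (hcomp sX).1
      smooth_ψ := (hcomp sY).1
      smooth_σ := (hcomp sXx).1
      σ_ne_zero := fun z hz => (hΦ.x_component (hDΩ z hz)).2.2.2.1
      pd_ex_τ := fun z hz => by
        rw [(hcomp sT).2 z hz]; exact (hΦ.pd_Ex_Ev_eq_zero (hDΩ z hz)).1
      pd_ex_ψ := fun z hz => by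
        rw [(hcomp sY).2 z hz]; exact (hΦ.pd_Ex_Ev_eq_zero (hDΩ z hz)).2.2.1
      pd_et_ψ := fun z hz => by
        rw [(hcomp sY).2 z hz]; exact (hΦ.x_component (hDΩ z hz)).1
      pd_ex_χ := fun z hz => by rw [(hcomp sX).2 z hz]
      pd_ex_σ := fun z hz => by
        rw [(hcomp sXx).2 z hz]; exact hΦ.pd_Ex_pd_Ex_cX (hDΩ z hz)
      pd_et_τ := fun z hz => by
        rw [(hcomp sT).2 z hz, pow_two]; exact (hΦ.x_component (hDΩ z hz)).2.2.2.2.symm }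

/-- Near `p`, all components of a point symmetry but `ũ` are determined by their values on the
slice through `p`. -/
theorem IsPointSymmetry.components_eq_slice (hΦ : IsPointSymmetry Ω Φ) {p q : Total} {r : ℝ}
    (hball : Metric.ball p r ⊆ Ω) (hq : q ∈ Metric.ball p r) :
    cT Φ q = cT Φ (slice p (proj q)) ∧ cX Φ q = cX Φ (slice p (proj q)) ∧
    cY Φ q = cY Φ (slice p (proj q)) ∧ pd Ex (cX Φ) q = pd Ex (cX Φ) (slice p (proj q)) ∧
    pd Et (cX Φ) q = pd Et (cX Φ) (slice p (proj q)) ∧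
    cV Φ q = cV Φ (slice p (proj q)) + pd Ev (cV Φ) (slice p (proj q)) * (vT q - vT p) := by
  have hΩ := hΦ.isOpen
  have hsm := hΦ.smooth
  have hconst : ∀ {f : Total → ℝ}, ContDiffOn ℝ ∞ f Ω → (∀ q ∈ Ω, pd Eu f q = 0) →
      (∀ q ∈ Ω, pd Ev f q = 0) → f q = f (slice p (proj q)) := by
    intro f hf hu hv
    refine eq_of_pd_eq_zero Metric.isOpen_ball (convex_ball p r) (hf.mono hball)
      (slice_mem_ball hq) hq fun z hz => ?_
    rw [pd_total, hu z (hball hz), hv z (hball hz)]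
    simp [slice, proj]
  have sX := contDiffOn_cX hsm
  have sV := contDiffOn_cV hsm
  have sVv := contDiffOn_pd hΩ Ev sV
  have hXu : ∀ q ∈ Ω, pd Eu (cX Φ) q = 0 := fun q hq => (hΦ.pd_Eu_eq_zero hq).2.1
  have hXv : ∀ q ∈ Ω, pd Ev (cX Φ) q = 0 := fun q hq => (hΦ.x_component hq).2.2.1
  have hVvv : ∀ q ∈ Ω, pd Ev (pd Ev (cV Φ)) q = 0 := fun q hq => (hΦ.u_v_components q hq).2.1
  have hVu : ∀ q ∈ Ω, pd Eu (cV Φ) q = 0 := fun q hq => (hΦ.pd_Eu_eq_zero hq).2.2.2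
  have hVvu := pd_pd_eq_zero hΩ sV hVu Ev
  have h1 := hconst sVv hVvu hVvv
  have sv : ContDiffOn ℝ ∞ (fun q => vT q - vT p) Ω :=
    vT.contDiff.contDiffOn.sub contDiffOn_const
  have psv : ∀ w, ∀ q ∈ Ω, pd w (fun q => vT q - vT p) q = vT w := fun w q hq => by
    rw [pd_sub hΩ vT.contDiff.contDiffOn contDiffOn_const hq, pd_clm, pd_const, sub_zero]
  -- By ṽ_vv = 0, subtracting ṽ_v (v − v_p) leaves a function independent of v; on the slice the
  -- correction is zero.
  have h2 := hconst (f := fun q => cV Φ q - pd Ev (cV Φ) q * (vT q - vT p)) (sV.sub (sVv.mul sv))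
    (fun q hq => by
      rw [pd_sub hΩ sV (sVv.mul sv) hq, pd_mul hΩ sVv sv hq, hVu q hq, hVvu q hq, psv Eu q hq]
      have : vT Eu = 0 := rfl
      rw [this]; ring)
    (fun q hq => by
      rw [pd_sub hΩ sV (sVv.mul sv) hq, pd_mul hΩ sVv sv hq, hVvv q hq, psv Ev q hq]
      have : vT Ev = 1 := rfl
      rw [this]; ring)
  have h3 : vT (slice p (proj q)) = vT p := rfl
  simp only [h3, sub_self, mul_zero, sub_zero] at h2
  refine ⟨hconst (contDiffOn_cT hsm) (fun q hq => (hΦ.pd_Eu_eq_zero hq).1)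
      (fun q hq => (hΦ.pd_Ex_Ev_eq_zero hq).2.1), hconst sX hXu hXv,
    hconst (contDiffOn_cY hsm) (fun q hq => (hΦ.pd_Eu_eq_zero hq).2.2.1)
      (fun q hq => (hΦ.pd_Ex_Ev_eq_zero hq).2.2.2.1),
    hconst (contDiffOn_pd hΩ Ex sX) (pd_pd_eq_zero hΩ sX hXu Ex) (pd_pd_eq_zero hΩ sX hXv Ex),
    hconst (contDiffOn_pd hΩ Et sX) (pd_pd_eq_zero hΩ sX hXu Et) (pd_pd_eq_zero hΩ sX hXv Et), ?_⟩
  rw [← h1]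
  linear_combination h2

/-- The change of the independent variables induced by a graph through `p` near `p`. -/
theorem IsPointSymmetry.fderiv_proj_injective (hΦ : IsPointSymmetry Ω Φ) {p : Total} {r : ℝ}
    (hr : 0 < r) (hball : Metric.ball p r ⊆ Ω) {D : Set Base} (hD : IsOpen D) (hz₀ : proj p ∈ D)
    {u v : Base → ℝ} (hu : ContDiffOn ℝ ∞ u D) (hv : ContDiffOn ℝ ∞ v D)
    (hgp : graphPoint u v (proj p) = p) {w : Base}
    (hw : fderiv ℝ (fun z => proj (Φ (graphPoint u v z))) (proj p) w = 0) : w = 0 := by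
  have hΩ := hΦ.isOpen
  have hsm := hΦ.smooth
  have hp : p ∈ Ω := hball (Metric.mem_ball_self hr)
  have hDo := isOpen_graph_preimage hD (Metric.isOpen_ball (x := p) (ε := r)) hu hv
  have hzD : proj p ∈ D ∩ graphPoint u v ⁻¹' Metric.ball p r :=
    ⟨hz₀, by rw [Set.mem_preimage, hgp]; exact Metric.mem_ball_self hr⟩
  have hSo : IsOpen (slice p ⁻¹' Ω) := hΩ.preimage (contDiff_slice p).continuous
  obtain ⟨hbc, hcomp⟩ := hΦ.isBaseChange_slice hSo fun z hz => hz
  have hpS : proj p ∈ slice p ⁻¹' Ω := hp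
  have hφd : DifferentiableAt ℝ (fun z => proj (Φ (graphPoint u v z))) (proj p) :=
    ((contDiff_proj.differentiable (by simp)).differentiableAt).comp _
      ((differentiableAt_of_mem hΩ hsm (by rw [hgp]; exact hp)).comp _
        (differentiableAt_of_mem hD (graphPoint_contDiffOn hu hv) hz₀))
  rw [fderiv_base_eq hφd, Prod.mk_eq_zero, Prod.mk_eq_zero] at hw
  obtain ⟨w1, w2, w3⟩ := hw
  have a1 := pd_congr hDo w (fun z hz => (hΦ.components_eq_slice hball hz.2).1) _ hzD
  have a2 := pd_congr hDo w (fun z hz => (hΦ.components_eq_slice hball hz.2).2.1) _ hzD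
  have a3 := pd_congr hDo w (fun z hz => (hΦ.components_eq_slice hball hz.2).2.2.1) _ hzD
  replace w1 := a1.symm.trans w1
  replace w2 := a2.symm.trans w2
  replace w3 := a3.symm.trans w3
  change pd w (fun z => cT Φ (slice p z)) (proj p) = 0 at w1
  change pd w (fun z => cX Φ (slice p z)) (proj p) = 0 at w2
  change pd w (fun z => cY Φ (slice p z)) (proj p) = 0 at w3
  rw [pd_base, hbc.pd_ex_τ _ hpS, hbc.pd_et_τ _ hpS] at w1
  rw [pd_base, hbc.pd_ex_χ _ hpS] at w2
  have hψy : pd ey (fun z => cY Φ (slice p z)) (proj p) = pd Ey (cY Φ) p :=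
    (hcomp (contDiffOn_cY hsm)).2 _ hpS ey
  rw [pd_base, hbc.pd_ex_ψ _ hpS, hbc.pd_et_ψ _ hpS, hψy] at w3
  have hσ0 := hbc.σ_ne_zero _ hpS
  -- The derivative of the base map is solved from below: ỹ has only the entry ỹ_y, then t̃
  -- contributes σ² and x̃ contributes σ.
  have z3 : w.2.2 = 0 := by
    apply mul_right_cancel₀ (hΦ.x_component hp).2.1
    linear_combination w3
  rw [z3] at w1 w2
  have z1 : w.1 = 0 := by
    apply mul_right_cancel₀ (pow_ne_zero 2 hσ0)
    linear_combination w1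
  rw [z1] at w2
  have z2 : w.2.1 = 0 := by
    apply mul_right_cancel₀ hσ0
    linear_combination w2
  exact Prod.ext z1 (Prod.ext z2 z3)

/-- The first equation along the preimages of solutions with constant `ṽ`. -/
theorem IsPointSymmetry.pd_ey_burgers_pullback (hΦ : IsPointSymmetry Ω Φ) {p : Total}
    (hp : p ∈ Ω) : ∃ r : ℝ, ∀ u' : Base → ℝ, ContDiff ℝ ∞ u' →
      (∀ z, pd ey (burgers u') z = 0) → u' (proj (Φ p)) = cU Φ p →
      pd ey (fun z => pd Ex (cX Φ) (slice p z) * (pd Ex (cX Φ) (slice p z) *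
          pd Ex (cX Φ) (slice p z)) *
        burgers u' (cT Φ (slice p z), cX Φ (slice p z), cY Φ (slice p z))) (proj p) + r = 0 := by
  have hΩ := hΦ.isOpen
  have hsm := hΦ.smooth
  obtain ⟨ε, hε, hball⟩ := Metric.isOpen_iff.1 hΩ p hp
  set S := Metric.ball p ε with hS
  have hSo : IsOpen S := Metric.isOpen_ball
  have hpS : p ∈ S := Metric.mem_ball_self hε
  set D₀ : Set Base := slice p ⁻¹' S with hD₀
  have hD₀o : IsOpen D₀ := hSo.preimage (contDiff_slice p).continuous
  have hD₀Ω : ∀ z ∈ D₀, slice p z ∈ Ω := fun z hz => hball hz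
  obtain ⟨hbc, hcomp⟩ := hΦ.isBaseChange_slice hD₀o hD₀Ω
  set τ : Base → ℝ := fun z => cT Φ (slice p z) with hτ
  set χ : Base → ℝ := fun z => cX Φ (slice p z) with hχ
  set ψ : Base → ℝ := fun z => cY Φ (slice p z) with hψ
  set σ : Base → ℝ := fun z => pd Ex (cX Φ) (slice p z) with hσ
  have sT := contDiffOn_cT hsm
  have sX := contDiffOn_cX hsm
  have sY := contDiffOn_cY hsm
  have sV := contDiffOn_cV hsm
  have sXx := contDiffOn_pd hΩ Ex sX
  have sXt := contDiffOn_pd hΩ Et sX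
  have sVv := contDiffOn_pd hΩ Ev sV
  have hχt : ∀ z ∈ D₀, pd et χ z = pd Et (cX Φ) (slice p z) := fun z hz => (hcomp sX).2 z hz et
  -- The number r is the y-derivative of the inhomogeneous part of the Burgers rule, which does not
  -- depend on u'.
  refine ⟨pd ey (fun z => pd et (fun z => pd et χ z / (2 * σ z)) z
    - pd et χ z * pd et σ z / (2 * (σ z * σ z))) (proj p), fun u' hu' hu'b hu'p => ?_⟩
  -- The pair (u, v) is obtained by solving ũ = u' and ṽ = ṽ(p) for the old variables. The condition
  -- on u' makes its graph pass through p.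
  set u : Base → ℝ := fun z => σ z * u' (τ z, χ z, ψ z) + pd et χ z / (2 * σ z) with hu
  set v : Base → ℝ := fun z => vT p + (cV Φ p - cV Φ (slice p z)) / pd Ev (cV Φ) (slice p z)
    with hv
  have hχtsm := contDiffOn_pd hD₀o et hbc.smooth_χ
  have h2σ : ContDiffOn ℝ ∞ (fun z => 2 * σ z) D₀ := contDiffOn_const.mul hbc.smooth_σ
  have h2σ0 : ∀ z ∈ D₀, 2 * σ z ≠ 0 := fun z hz =>
    mul_ne_zero two_ne_zero (hbc.σ_ne_zero z hz)
  have hq := contDiffOn_fun_div hχtsm h2σ h2σ0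
  have hmaps : ∀ z ∈ D₀, (τ z, χ z, ψ z) ∈ (Set.univ : Set Base) := fun z _ => Set.mem_univ _
  have husm : ContDiffOn ℝ ∞ u D₀ :=
    (hbc.smooth_σ.mul (hbc.contDiffOn_comp hmaps hu'.contDiffOn)).add hq
  have hVv0 : ∀ z ∈ D₀, pd Ev (cV Φ) (slice p z) ≠ 0 := fun z hz =>
    (hΦ.u_v_components _ (hD₀Ω z hz)).1
  have hnum : ContDiffOn ℝ ∞ (fun z => cV Φ p - cV Φ (slice p z)) D₀ :=
    contDiffOn_const.sub (hcomp sV).1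
  have hvq := contDiffOn_fun_div hnum (hcomp sVv).1 hVv0
  have hvsm : ContDiffOn ℝ ∞ v D₀ := contDiffOn_const.add hvq
  have hz₀ : proj p ∈ D₀ := hpS
  have hgp : graphPoint u v (proj p) = p := by
    have h1 : u (proj p) = uT p := by
      rw [(hΦ.u_v_components p hp).2.2.2.2, ← hu'p]
      simp only [hu]
      rw [hχt _ hz₀]
      rfl
    have h2 : v (proj p) = vT p := by
      simp only [hv, slice_proj, sub_self, zero_div, add_zero]
    simp only [graphPoint, h1, h2]
    rfl
  have hDo := isOpen_graph_preimage hD₀o hSo husm hvsm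
  set D := D₀ ∩ graphPoint u v ⁻¹' S with hDdef
  have hzD : proj p ∈ D := ⟨hz₀, by rw [Set.mem_preimage, hgp]; exact hpS⟩
  have huD := husm.mono (Set.inter_subset_left : D ⊆ D₀)
  have hvD := hvsm.mono (Set.inter_subset_left : D ⊆ D₀)
  have gT : ∀ z ∈ D, cT Φ (graphPoint u v z) = τ z := fun z hz =>
    (hΦ.components_eq_slice hball hz.2).1
  have gX : ∀ z ∈ D, cX Φ (graphPoint u v z) = χ z := fun z hz =>
    (hΦ.components_eq_slice hball hz.2).2.1
  have gY : ∀ z ∈ D, cY Φ (graphPoint u v z) = ψ z := fun z hz =>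
    (hΦ.components_eq_slice hball hz.2).2.2.1
  have gXx : ∀ z ∈ D, pd Ex (cX Φ) (graphPoint u v z) = σ z := fun z hz =>
    (hΦ.components_eq_slice hball hz.2).2.2.2.1
  have gXt : ∀ z ∈ D, pd Et (cX Φ) (graphPoint u v z) = pd et χ z := fun z hz => by
    rw [hχt z hz.1]
    exact (hΦ.components_eq_slice hball hz.2).2.2.2.2.1
  have gU : ∀ z ∈ D, cU Φ (graphPoint u v z) = u' (τ z, χ z, ψ z) := fun z hz => by
    have h1 := (hΦ.u_v_components _ (hball hz.2)).2.2.2.2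
    rw [gXx z hz, gXt z hz] at h1
    have h2 : uT (graphPoint u v z) = σ z * u' (τ z, χ z, ψ z) + pd et χ z / (2 * σ z) := rfl
    rw [h2] at h1
    apply mul_left_cancel₀ (hbc.σ_ne_zero z hz.1)
    linarith
  have gV : ∀ z ∈ D, cV Φ (graphPoint u v z) = cV Φ p := fun z hz => by
    rw [(hΦ.components_eq_slice hball hz.2).2.2.2.2.2]
    have h1 : slice p (proj (graphPoint u v z)) = slice p z := rfl
    have h2 : vT (graphPoint u v z) = v z := rfl
    have h3 := hVv0 z hz.1
    rw [h1, h2]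
    simp only [hv]
    field_simp
    ring
  have hproj : ∀ z ∈ D, proj (Φ (graphPoint u v z)) = (τ z, χ z, ψ z) := fun z hz => by
    rw [← gT z hz, ← gX z hz, ← gY z hz]; rfl
  have hgr : ∀ z ∈ D, Φ (graphPoint u v z) =
      graphPoint u' (fun _ => cV Φ p) (proj (Φ (graphPoint u v z))) := fun z hz => by
    have h4 : u' (proj (Φ (graphPoint u v z))) = cU Φ (graphPoint u v z) := by
      rw [gU z hz, hproj z hz]
    simp only [graphPoint] at h4 ⊢
    rw [h4]
    rw [show cV Φ p = _ from (gV z hz).symm]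
    rfl
  have hvx : ∀ z ∈ D, pd ex v z = 0 := fun z hz => by
    have e1 : pd ex (fun z => cV Φ (slice p z)) z = 0 := by
      rw [(hcomp sV).2 z hz.1]; exact (hΦ.u_v_components _ (hD₀Ω z hz.1)).2.2.1
    have e2 : pd ex (fun z => pd Ev (cV Φ) (slice p z)) z = 0 := by
      rw [(hcomp sVv).2 z hz.1]
      exact (pd_pd_eq_zero hΩ sV (fun q hq => (hΦ.u_v_components q hq).2.2.1) Ev) _ (hD₀Ω z hz.1)
    rw [hv, pd_add hD₀o contDiffOn_const hvq hz.1, pd_const,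
      pd_div hD₀o hnum (hcomp sVv).1 hz.1 hVv0, pd_sub hD₀o contDiffOn_const (hcomp sV).1 hz.1,
      pd_const, e1, e2]
    ring
  have hinj : ∀ w, fderiv ℝ (fun z => proj (Φ (graphPoint u v z))) (proj p) w = 0 → w = 0 :=
    fun w hw => hΦ.fderiv_proj_injective hε hball hD₀o hz₀ husm hvsm hgp hw
  have hcv : ∀ (w : Base) (c : ℝ), pd w (fun _ : Base => c) = fun _ => 0 := fun w c =>
    funext fun z => pd_const w c z
  have hsolves := hΦ.solvesAt_of_image hDo huD hvD (fun z hz => hball hz.2) hzD hinj hu'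
    (contDiff_const (c := cV Φ p)) (fun z => ⟨by rw [hu'b z]; simp [hcv], by simp [hcv]⟩) hgr
  have hb := hsolves.1
  -- As ṽ does not involve x, neither does v, so the first equation reduces to ∂_y B(u) = 0.
  rw [pd_eq_zero_of_const hDo ex (pd_eq_zero_of_const hDo ex hvx) _ hzD, mul_zero] at hb
  have hbur : ∀ z ∈ D₀, burgers u z = σ z * (σ z * σ z) * burgers u' (τ z, χ z, ψ z)
      + (pd et (fun z => pd et χ z / (2 * σ z)) z
        - pd et χ z * pd et σ z / (2 * (σ z * σ z))) := fun z hz => by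
    rw [hbc.burgers_eq isOpen_univ hmaps hu'.contDiffOn (fun z _ => rfl) z hz]
    ring
  have hσt := contDiffOn_pd hD₀o et hbc.smooth_σ
  have hσσ : ContDiffOn ℝ ∞ (fun z => 2 * (σ z * σ z)) D₀ :=
    contDiffOn_const.mul (hbc.smooth_σ.mul hbc.smooth_σ)
  have hσσ0 : ∀ z ∈ D₀, 2 * (σ z * σ z) ≠ 0 := fun z hz =>
    mul_ne_zero two_ne_zero (mul_ne_zero (hbc.σ_ne_zero z hz) (hbc.σ_ne_zero z hz))
  have hBsm := hbc.contDiffOn_comp hmaps (contDiffOn_burgers isOpen_univ hu'.contDiffOn)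
  rw [pd_congr hD₀o ey hbur _ hz₀,
    pd_add hD₀o ((hbc.smooth_σ.mul (hbc.smooth_σ.mul hbc.smooth_σ)).mul hBsm)
      ((contDiffOn_pd hD₀o et hq).sub (contDiffOn_fun_div (hχtsm.mul hσt) hσσ hσσ0)) hz₀] at hb
  exact hb

/-- The components `t̃` and `x̃` do not depend on `y`. -/
theorem IsPointSymmetry.pd_Ey_eq_zero (hΦ : IsPointSymmetry Ω Φ) {p : Total} (hp : p ∈ Ω) :
    pd Ey (cT Φ) p = 0 ∧ pd Ey (cX Φ) p = 0 := by
  have hΩ := hΦ.isOpen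
  have hsm := hΦ.smooth
  have hDo : IsOpen (slice p ⁻¹' Ω) := hΩ.preimage (contDiff_slice p).continuous
  obtain ⟨hbc, hcomp⟩ := hΦ.isBaseChange_slice hDo fun z hz => hz
  have hz₀ : proj p ∈ slice p ⁻¹' Ω := hp
  set D := slice p ⁻¹' Ω
  set τ : Base → ℝ := fun z => cT Φ (slice p z) with hτ
  set χ : Base → ℝ := fun z => cX Φ (slice p z) with hχ
  set ψ : Base → ℝ := fun z => cY Φ (slice p z) with hψ
  set σ : Base → ℝ := fun z => pd Ex (cX Φ) (slice p z) with hσ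
  obtain ⟨r, hr⟩ := hΦ.pd_ey_burgers_pullback hp
  have hs3 : ContDiffOn ℝ ∞ (fun z => σ z * (σ z * σ z)) D :=
    hbc.smooth_σ.mul (hbc.smooth_σ.mul hbc.smooth_σ)
  have hσ0 : σ (proj p) ≠ 0 := hbc.σ_ne_zero _ hz₀
  have hσ3 : σ (proj p) * (σ (proj p) * σ (proj p)) ≠ 0 := mul_ne_zero hσ0 (mul_ne_zero hσ0 hσ0)
  have hd : ∀ {h : ℝ → ℝ}, ContDiff ℝ ∞ h → ContDiff ℝ ∞ (deriv h) := fun hh =>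
    (contDiff_infty_iff_deriv.1 hh).2
  have htest : ∀ {h : ℝ → ℝ}, ContDiff ℝ ∞ h → h (cT Φ p) = cU Φ p →
      pd ey (fun z => σ z * (σ z * σ z) * deriv h (τ z)) (proj p) + r = 0 := by
    intro h hh h0
    have := hr (fun z => h (tB z)) (hh.comp tB.contDiff)
      (fun z => by rw [burgers_comp_t hh]; exact pd_ey_comp_t (hd hh) z) h0
    rw [burgers_comp_t hh] at this
    exact this
  have hτp : τ (proj p) = cT Φ p := rfl
  have hχp : χ (proj p) = cX Φ p := rfl
  -- For u' = h(t̃) the Burgers expression is h'. The values h' = 0, 1, 2(t̃ − t̃(p)) yield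
  -- successively r = 0, ∂_y σ³ = 0 and t̃_y = 0.
  have k0 := htest (contDiff_quartic (cU Φ p) 0 0 0 0 (cT Φ p)) (quartic_self _ _ _ _ _ _)
  have k1 := htest (contDiff_quartic (cU Φ p) 1 0 0 0 (cT Φ p)) (quartic_self _ _ _ _ _ _)
  have k2 := htest (contDiff_quartic (cU Φ p) 0 1 0 0 (cT Φ p)) (quartic_self _ _ _ _ _ _)
  simp only [deriv_quartic, quartic, mul_zero, zero_mul, add_zero, mul_one, zero_add] at k0 k1 k2
  rw [pd_const, zero_add] at k0
  rw [k0, add_zero] at k1 k2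
  have hlin : ContDiffOn ℝ ∞ (fun z => 2 * (τ z - cT Φ p)) D :=
    contDiffOn_const.mul (hbc.smooth_τ.sub contDiffOn_const)
  rw [pd_mul hDo hs3 hlin hz₀, pd_const_mul hDo _ (hbc.smooth_τ.sub contDiffOn_const) hz₀,
    pd_sub hDo hbc.smooth_τ contDiffOn_const hz₀, pd_const, k1, hτp] at k2
  have hτy : pd ey τ (proj p) = 0 := by
    apply mul_left_cancel₀ hσ3
    linear_combination k2 / 2
  have hq := contDiff_quartic (cU Φ p) 1 0 0 0 (cX Φ p)
  -- For u' = ũ(p) + (x̃ − x̃(p)) the Burgers expression is −2u', whose y-derivative isolates x̃_y.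
  have hbx : burgers (fun z => quartic (cU Φ p) 1 0 0 0 (cX Φ p) (xB z)) =
      fun z => (-2) * (cU Φ p + (xB z - cX Φ p)) := by
    rw [burgers_comp_x hq]
    funext z
    simp only [deriv_quartic, quartic]
    ring
  have hxl : ∀ z, pd ey (fun z => (-2) * (cU Φ p + (xB z - cX Φ p))) z = 0 := fun z => by
    have := pd_ey_comp_x (h := fun s => (-2) * (cU Φ p + (s - cX Φ p))) (by fun_prop) z
    exact this
  have k3 := hr (fun z => quartic (cU Φ p) 1 0 0 0 (cX Φ p) (xB z)) (hq.comp xB.contDiff)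
    (fun z => by rw [hbx]; exact hxl z) (quartic_self _ _ _ _ _ _)
  rw [hbx, k0, add_zero] at k3
  have hXl : ContDiffOn ℝ ∞ (fun z => (-2) * (cU Φ p + (χ z - cX Φ p))) D :=
    contDiffOn_const.mul (contDiffOn_const.add (hbc.smooth_χ.sub contDiffOn_const))
  have k4 : pd ey (fun z => σ z * (σ z * σ z) * ((-2) * (cU Φ p + (χ z - cX Φ p)))) (proj p) = 0 :=
    k3
  rw [pd_mul hDo hs3 hXl hz₀,
    pd_const_mul hDo _ (contDiffOn_const.add (hbc.smooth_χ.sub contDiffOn_const)) hz₀,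
    pd_add hDo contDiffOn_const (hbc.smooth_χ.sub contDiffOn_const) hz₀,
    pd_sub hDo hbc.smooth_χ contDiffOn_const hz₀, pd_const, pd_const, k1] at k4
  have hχy : pd ey χ (proj p) = 0 := by
    apply mul_left_cancel₀ hσ3
    linear_combination (-1 / 2) * k4
  refine ⟨?_, ?_⟩
  · rw [← hτy, hτ, (hcomp (contDiffOn_cT hsm)).2 _ hz₀ ey]; rfl
  · rw [← hχy, hχ, (hcomp (contDiffOn_cX hsm)).2 _ hz₀ ey]; rfl

end

section

variable {Ω : Set Total} {Φ : Total → Total}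

/-- The scaling of `v` is inverse to that of `y`. -/
theorem IsPointSymmetry.pd_Ev_mul_pd_Ey (hΦ : IsPointSymmetry Ω Φ) {p : Total} (hp : p ∈ Ω) :
    pd Ev (cV Φ) p * pd Ey (cY Φ) p = 1 := by
  have hΩ := hΦ.isOpen
  have hsm := hΦ.smooth
  obtain ⟨ε, hε, hball⟩ := Metric.isOpen_iff.1 hΩ p hp
  have hpS : p ∈ Metric.ball p ε := Metric.mem_ball_self hε
  -- With v_x = 1, v_t = 2u and u_x = 1 at p, the formula for v_xxx gives −2, so the first equation
  -- is tested nontrivially.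
  obtain ⟨_, hC⟩ := exists_solution p one_ne_zero (2 * uT p) 0 0 1
  obtain ⟨D, u, v, hD, hz₀, hu, hv, hs, hgp, -, -, -, -, hxxx⟩ := hC 0 0 0 0
  obtain ⟨D₁, hsub, hD₁, hz₁, -, D', u', v', hD', hu', hv', hs', himg⟩ :=
    hΦ.exists_image hD hu hv hs hz₀ (by rwa [hgp]) fun w hw =>
      hΦ.fderiv_proj_injective hε hball hD hz₀ hu hv hgp hw
  have hKo : IsOpen (D₁ ∩ graphPoint u v ⁻¹' Metric.ball p ε) :=
    isOpen_graph_preimage hD₁ Metric.isOpen_ball (hu.mono hsub) (hv.mono hsub)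
  have hzK : proj p ∈ D₁ ∩ graphPoint u v ⁻¹' Metric.ball p ε :=
    ⟨hz₁, by rw [Set.mem_preimage, hgp]; exact hpS⟩
  set K := D₁ ∩ graphPoint u v ⁻¹' Metric.ball p ε
  have hsl : ∀ z ∈ K, slice p z ∈ Ω := fun z hz => hball (slice_mem_ball hz.2)
  obtain ⟨hbc, hcomp⟩ := hΦ.isBaseChange_slice hKo hsl
  set τ : Base → ℝ := fun z => cT Φ (slice p z)
  set χ : Base → ℝ := fun z => cX Φ (slice p z)
  set ψ : Base → ℝ := fun z => cY Φ (slice p z)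
  set σ : Base → ℝ := fun z => pd Ex (cX Φ) (slice p z)
  have sX := contDiffOn_cX hsm
  have sV := contDiffOn_cV hsm
  have sVv := contDiffOn_pd hΩ Ev sV
  have hproj : ∀ z ∈ K, proj (Φ (graphPoint u v z)) = (τ z, χ z, ψ z) := fun z hz => by
    have h := hΦ.components_eq_slice hball hz.2
    exact Prod.ext h.1 (Prod.ext h.2.1 h.2.2.1)
  have hm : ∀ z ∈ K, (τ z, χ z, ψ z) ∈ D' := fun z hz => by
    rw [← hproj z hz]; exact (himg z hz.1).1
  have gU : ∀ z ∈ K, cU Φ (graphPoint u v z) = u' (τ z, χ z, ψ z) := fun z hz => by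
    rw [← hproj z hz]
    exact congrArg (fun q : Total => q.2.2.2.1) (himg z hz.1).2
  have gV : ∀ z ∈ K, cV Φ (graphPoint u v z) = v' (τ z, χ z, ψ z) := fun z hz => by
    rw [← hproj z hz]
    exact congrArg (fun q : Total => q.2.2.2.2) (himg z hz.1).2
  have hχt : ∀ z ∈ K, pd et χ z = pd Et (cX Φ) (slice p z) := fun z hz => (hcomp sX).2 z hz et
  have hu_eq : ∀ z ∈ K, u z = σ z * u' (τ z, χ z, ψ z) + pd et χ z / (2 * σ z) := fun z hz => by
    have h := hΦ.components_eq_slice hball hz.2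
    have h1 := (hΦ.u_v_components _ (hball hz.2)).2.2.2.2
    rw [h.2.2.2.1, h.2.2.2.2.1, gU z hz] at h1
    rw [hχt z hz]
    exact h1
  have hVv0 : ∀ z ∈ K, pd Ev (cV Φ) (slice p z) ≠ 0 := fun z hz =>
    (hΦ.u_v_components _ (hsl z hz)).1
  have hone : ContDiffOn ℝ ∞ (fun _ : Base => (1 : ℝ)) K := contDiffOn_const
  have hnum : ContDiffOn ℝ ∞ (fun z => cV Φ (slice p z)) K := (hcomp sV).1
  have hden := (hcomp sVv).1
  have hv_eq : ∀ z ∈ K, v z = 1 / pd Ev (cV Φ) (slice p z) * v' (τ z, χ z, ψ z)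
      + (vT p - cV Φ (slice p z) / pd Ev (cV Φ) (slice p z)) := fun z hz => by
    have h1 := (hΦ.components_eq_slice hball hz.2).2.2.2.2.2
    rw [gV z hz] at h1
    have h2 : slice p (proj (graphPoint u v z)) = slice p z := rfl
    have h3 : vT (graphPoint u v z) = v z := rfl
    rw [h2, h3] at h1
    have h4 := hVv0 z hz
    rw [h1]
    field_simp
    ring
  have hzero : ∀ w : Base, (∀ q ∈ Ω, pd (w.1, w.2.1, w.2.2, 0, 0) (cV Φ) q = 0) → ∀ z ∈ K,
      pd w (fun z => 1 / pd Ev (cV Φ) (slice p z)) z = 0 ∧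
      pd w (fun z => vT p - cV Φ (slice p z) / pd Ev (cV Φ) (slice p z)) z = 0 := by
    intro w hw z hz
    have e1 : pd w (fun z => cV Φ (slice p z)) z = 0 := by
      rw [(hcomp sV).2 z hz]; exact hw _ (hsl z hz)
    have e2 : pd w (fun z => pd Ev (cV Φ) (slice p z)) z = 0 := by
      rw [(hcomp sVv).2 z hz]; exact pd_pd_eq_zero hΩ sV hw Ev _ (hsl z hz)
    refine ⟨?_, ?_⟩
    · rw [pd_div hKo hone hden hz hVv0, e2, pd_const]; ring
    · rw [pd_sub hKo contDiffOn_const (contDiffOn_fun_div hnum hden hVv0) hz, pd_const,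
        pd_div hKo hnum hden hz hVv0, e1, e2]
      ring
  have ht := hzero et fun q hq => (hΦ.u_v_components q hq).2.2.2.1
  have hx := hzero ex fun q hq => (hΦ.u_v_components q hq).2.2.1
  have k1 := (hbc.second_eq hD' hm hv' hu_eq (contDiffOn_fun_div hone hden hVv0)
    (contDiffOn_const.sub (contDiffOn_fun_div hnum hden hVv0)) (fun z hz => (ht z hz).1)
    (fun z hz => (hx z hz).1) (fun z hz => (ht z hz).2) (fun z hz => (hx z hz).2) hv_eq _ hzK).1
  have k2 := hbc.first_eq hD' hm
    (fun z hz => by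
      rw [(hcomp (contDiffOn_cT hsm)).2 z hz]; exact (hΦ.pd_Ey_eq_zero (hsl z hz)).1)
    (fun z hz => by rw [(hcomp sX).2 z hz]; exact (hΦ.pd_Ey_eq_zero (hsl z hz)).2)
    hu' hu_eq _ hzK
  have hψy : pd ey ψ (proj p) = pd Ey (cY Φ) p := (hcomp (contDiffOn_cY hsm)).2 _ hzK ey
  -- Both transformation rules now compare v_xxx with v'_xxx: the first equation gives the factor σ³
  -- ỹ_y, direct differentiation gives σ³/ṽ_v.
  rw [(hs _ hz₀).1, (hs' _ (hm _ hzK)).1, hψy, hxxx] at k2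
  rw [hxxx, slice_proj] at k1
  have hσ0 := hbc.σ_ne_zero _ hzK
  have hV0 := (hΦ.u_v_components p hp).1
  set A := pd ex (pd ex (pd ex v')) (τ (proj p), χ (proj p), ψ (proj p))
  field_simp at k1
  have hA : σ (proj p) ^ 3 * A ≠ 0 := by
    intro h0
    have : σ (proj p) ^ 3 * pd Ey (cY Φ) p * (2 * A) = 2 * pd Ey (cY Φ) p * (σ (proj p) ^ 3 * A) := by
      ring
    rw [this, h0] at k2
    norm_num at k2
  apply mul_right_cancel₀ hA
  linear_combination k1 - (1 / 2) * pd Ev (cV Φ) p * k2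

end

/-! ### Integration to the global form on convex sets. -/

/-- A smooth function whose derivative vanishes on the kernel of a linear form factors through the
linear form on a convex open set. -/
theorem exists_factor {Ω : Set Total} (hΩ : IsOpen Ω) (hc : Convex ℝ Ω) (L : Total →L[ℝ] ℝ)
    {e : Total} (he : L e = 1) {f : Total → ℝ} (hf : ContDiffOn ℝ ∞ f Ω)
    (h : ∀ w, L w = 0 → ∀ q ∈ Ω, pd w f q = 0) :
    ∃ g : ℝ → ℝ, ContDiffOn ℝ ∞ g (L '' Ω) ∧ ∀ q ∈ Ω, g (L q) = f q := by
  classical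
  have hinv : ∀ q ∈ Ω, ∀ q' ∈ Ω, L q' = L q → f q' = f q := fun q hq q' hq' hL =>
    eq_of_pd_eq_zero hΩ hc hf hq hq' fun z hz => h _ (by rw [map_sub, hL, sub_self]) z hz
  set g : ℝ → ℝ := fun s => if hs : ∃ q ∈ Ω, L q = s then f hs.choose else 0 with hg
  have hgL : ∀ q ∈ Ω, g (L q) = f q := fun q hq => by
    have hs : ∃ q' ∈ Ω, L q' = L q := ⟨q, hq, rfl⟩
    simp only [hg, dif_pos hs]
    exact hinv q hq _ hs.choose_spec.1 hs.choose_spec.2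
  refine ⟨g, ?_, hgL⟩
  rintro _ ⟨q, hq, rfl⟩
  apply ContDiffAt.contDiffWithinAt
  -- A line through q on which L is the parameter; near L q, the function g is f along this line,
  -- hence smooth despite the choice in its definition.
  set γ : ℝ → Total := fun s => q + (s - L q) • e with hγ
  have hγs : ContDiff ℝ ∞ γ := contDiff_const.add ((contDiff_id.sub contDiff_const).smul contDiff_const)
  have hγ0 : γ (L q) = q := by simp [hγ]
  have hγΩ : ∀ᶠ s in nhds (L q), γ s ∈ Ω :=
    hγs.continuous.continuousAt.eventually_mem (by rw [hγ0]; exact hΩ.mem_nhds hq)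
  have hLγ : ∀ s, L (γ s) = s := fun s => by simp [hγ, he]
  have hcd : ContDiffAt ℝ ∞ (fun s => f (γ s)) (L q) :=
    ContDiffAt.comp (L q) (by rw [hγ0]; exact contDiffAt_of_mem hΩ hf hq) hγs.contDiffAt
  refine hcd.congr_of_eventuallyEq ?_
  filter_upwards [hγΩ] with s hs
  rw [← hgL _ hs, hLγ]

theorem deriv_of_factor {Ω : Set Total} (hΩ : IsOpen Ω) {L : Total →L[ℝ] ℝ}
    (hL : IsOpen (L '' Ω)) {e : Total} (he : L e = 1) {f : Total → ℝ} {g : ℝ → ℝ}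
    (hg : ContDiffOn ℝ ∞ g (L '' Ω)) (h : ∀ q ∈ Ω, g (L q) = f q) :
    ∀ q ∈ Ω, deriv g (L q) = pd e f q := fun q hq => by
  rw [← pd_congr hΩ e h q hq,
    pd_comp_clm L (differentiableAt_of_mem hL hg (Set.mem_image_of_mem L hq)) e, he, one_mul]

section

variable {Ω : Set Total} {Φ : Total → Total}

/-- On a convex open set a point symmetry has the stated form globally. -/
theorem IsPointSymmetry.hasForm (hΦ : IsPointSymmetry Ω Φ) (hc : Convex ℝ Ω) : HasForm Ω Φ := by
  have hΩ := hΦ.isOpen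
  have hsm := hΦ.smooth
  have sT := contDiffOn_cT hsm
  have sX := contDiffOn_cX hsm
  have sY := contDiffOn_cY hsm
  have sV := contDiffOn_cV hsm
  have sXx := contDiffOn_pd hΩ Ex sX
  have sVv := contDiffOn_pd hΩ Ev sV
  have sx : ContDiffOn ℝ ∞ (fun q => xT q) Ω := xT.contDiff.contDiffOn
  have sv : ContDiffOn ℝ ∞ (fun q => vT q) Ω := vT.contDiff.contDiffOn
  have hXy : ∀ q ∈ Ω, pd Ey (cX Φ) q = 0 := fun q hq => (hΦ.pd_Ey_eq_zero hq).2
  have hXu : ∀ q ∈ Ω, pd Eu (cX Φ) q = 0 := fun q hq => (hΦ.pd_Eu_eq_zero hq).2.1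
  have hXv : ∀ q ∈ Ω, pd Ev (cX Φ) q = 0 := fun q hq => (hΦ.x_component hq).2.2.1
  have hVt : ∀ q ∈ Ω, pd Et (cV Φ) q = 0 := fun q hq => (hΦ.u_v_components q hq).2.2.2.1
  have hVx : ∀ q ∈ Ω, pd Ex (cV Φ) q = 0 := fun q hq => (hΦ.u_v_components q hq).2.2.1
  have hVu : ∀ q ∈ Ω, pd Eu (cV Φ) q = 0 := fun q hq => (hΦ.pd_Eu_eq_zero hq).2.2.2
  have hX0 : ∀ q ∈ Ω, pd Ex (cX Φ) q ≠ 0 := fun q hq => (hΦ.x_component hq).2.2.2.1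
  obtain ⟨T, hT, hTq⟩ := exists_factor hΩ hc tT (e := Et) rfl sT fun w hw q hq => by
    change w.1 = 0 at hw
    rw [pd_total, hw, (hΦ.pd_Ex_Ev_eq_zero hq).1, (hΦ.pd_Ey_eq_zero hq).1,
      (hΦ.pd_Eu_eq_zero hq).1, (hΦ.pd_Ex_Ev_eq_zero hq).2.1]
    ring
  obtain ⟨Y, hY, hYq⟩ := exists_factor hΩ hc yT (e := Ey) rfl sY fun w hw q hq => by
    change w.2.2.1 = 0 at hw
    rw [pd_total, hw, (hΦ.pd_Ex_Ev_eq_zero hq).2.2.1, (hΦ.x_component hq).1,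
      (hΦ.pd_Eu_eq_zero hq).2.2.1, (hΦ.pd_Ex_Ev_eq_zero hq).2.2.2.1]
    ring
  obtain ⟨X₀, hX₀, hXq⟩ := exists_factor hΩ hc tT (e := Et) rfl
    (f := fun q => cX Φ q - pd Ex (cX Φ) q * xT q) (sX.sub (sXx.mul sx)) fun w hw q hq => by
    change w.1 = 0 at hw
    rw [pd_sub hΩ sX (sXx.mul sx) hq, pd_mul hΩ sXx sx hq, pd_clm, pd_total w (cX Φ),
      pd_total w (pd Ex (cX Φ)), hw, hΦ.pd_Ex_pd_Ex_cX hq, hXy q hq, hXu q hq, hXv q hq,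
      pd_pd_eq_zero hΩ sX hXy Ex q hq, pd_pd_eq_zero hΩ sX hXu Ex q hq,
      pd_pd_eq_zero hΩ sX hXv Ex q hq]
    have : xT w = w.2.1 := rfl
    rw [this]
    ring
  obtain ⟨V₀, hV₀, hVq⟩ := exists_factor hΩ hc yT (e := Ey) rfl
    (f := fun q => cV Φ q - pd Ev (cV Φ) q * vT q) (sV.sub (sVv.mul sv)) fun w hw q hq => by
    change w.2.2.1 = 0 at hw
    rw [pd_sub hΩ sV (sVv.mul sv) hq, pd_mul hΩ sVv sv hq, pd_clm, pd_total w (cV Φ),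
      pd_total w (pd Ev (cV Φ)), hw, (hΦ.u_v_components q hq).2.1, hVt q hq, hVx q hq, hVu q hq,
      pd_pd_eq_zero hΩ sV hVt Ev q hq, pd_pd_eq_zero hΩ sV hVx Ev q hq,
      pd_pd_eq_zero hΩ sV hVu Ev q hq]
    have : vT w = w.2.2.2.2 := rfl
    rw [this]
    ring
  have hI := isOpen_image_tT hΩ
  have hJ := isOpen_image_yT hΩ
  have hdT : ∀ q ∈ Ω, deriv T (tT q) = pd Ex (cX Φ) q * pd Ex (cX Φ) q := fun q hq => by
    rw [deriv_of_factor hΩ hI (e := Et) rfl hT hTq q hq, (hΦ.x_component hq).2.2.2.2]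
  have hddT : ∀ q ∈ Ω, deriv (deriv T) (tT q) = 2 * (pd Ex (cX Φ) q * pd Et (pd Ex (cX Φ)) q) :=
    fun q hq => by
    rw [deriv_of_factor hΩ hI (e := Et) rfl ((contDiffOn_infty_iff_deriv_of_isOpen hI).1 hT).2
      hdT q hq, pd_mul hΩ sXx sXx hq]
    ring
  have hdY : ∀ q ∈ Ω, deriv Y (yT q) = pd Ey (cY Φ) q := deriv_of_factor hΩ hJ rfl hY hYq
  have hdX₀ : ∀ q ∈ Ω, deriv X₀ (tT q) = pd Et (cX Φ) q - xT q * pd Et (pd Ex (cX Φ)) q :=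
    fun q hq => by
    rw [deriv_of_factor hΩ hI (e := Et) rfl hX₀ hXq q hq, pd_sub hΩ sX (sXx.mul sx) hq,
      pd_mul hΩ sXx sx hq, pd_clm]
    have : xT Et = 0 := rfl
    rw [this]
    ring
  -- x̃_x is continuous and never zero on the connected set Ω, so its sign is constant.
  obtain ⟨ε, hε, hεX⟩ : ∃ ε : ℝ, (ε = 1 ∨ ε = -1) ∧
      ∀ q ∈ Ω, pd Ex (cX Φ) q = ε * |pd Ex (cX Φ) q| := by
    rcases hc.isPreconnected.eq_or_eq_neg_of_sq_eq sXx.continuousOn sXx.continuousOn.abs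
      (fun q _ => by simp) (fun {q} hq => abs_ne_zero.2 (hX0 q hq)) with h | h
    · exact ⟨1, Or.inl rfl, fun q hq => by rw [one_mul]; exact h hq⟩
    · exact ⟨-1, Or.inr rfl, fun q hq => by rw [neg_one_mul]; exact h hq⟩
  refine ⟨ε, T, X₀, Y, V₀, hε, hT, hX₀, hY, hV₀, fun t x y u v hq => ?_⟩
  set q : Total := (t, x, y, u, v) with hqdef
  have hpos : 0 < deriv T t := by
    rw [show deriv T t = _ from hdT q hq]
    exact mul_self_pos.2 (hX0 q hq)
  have hY0 : deriv Y y ≠ 0 := by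
    rw [show deriv Y y = _ from hdY q hq]
    exact (hΦ.x_component hq).2.1
  have hroot : deriv T t ^ (1 / 2 : ℝ) = |pd Ex (cX Φ) q| := by
    rw [← Real.sqrt_eq_rpow, show deriv T t = _ from hdT q hq, Real.sqrt_mul_self_eq_abs]
  have hεε : ε * ε = 1 := by rcases hε with h | h <;> rw [h] <;> norm_num
  have hs0 : |pd Ex (cX Φ) q| ≠ 0 := abs_ne_zero.2 (hX0 q hq)
  have hεq := hεX q hq
  have hTq' : cT Φ q = T t := (hTq q hq).symm
  have hYq' : cY Φ q = Y y := (hYq q hq).symm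
  have hXq' : cX Φ q = ε * |pd Ex (cX Φ) q| * x + X₀ t := by
    have : X₀ t = cX Φ q - pd Ex (cX Φ) q * x := hXq q hq
    rw [this, ← hεq]
    ring
  have hVq' : cV Φ q = v / deriv Y y + V₀ y := by
    have h1 : V₀ y = cV Φ q - pd Ev (cV Φ) q * v := hVq q hq
    have h2 := hΦ.pd_Ev_mul_pd_Ey hq
    rw [← hdY q hq] at h2
    change _ * deriv Y y = 1 at h2
    rw [h1, eq_one_div_of_mul_eq_one_left h2]
    ring
  have hUq' : cU Φ q = ε / |pd Ex (cX Φ) q| * u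
      - ε * deriv (deriv T) t / (4 * |pd Ex (cX Φ) q| ^ 3) * x - deriv X₀ t / (2 * deriv T t) := by
    have h1 : u = _ := (hΦ.u_v_components q hq).2.2.2.2
    have h2 : deriv X₀ t = pd Et (cX Φ) q - x * pd Et (pd Ex (cX Φ)) q := hdX₀ q hq
    rw [h2, show deriv (deriv T) t = _ from hddT q hq, show deriv T t = _ from hdT q hq]
    have h0 := hX0 q hq
    -- Since x̃_x = ε T_t^{1/2} and ε² = 1, the coefficients of (*) become powers of 1/x̃_x, and the
    -- formula for u solves for ũ.
    have ha : ε / |pd Ex (cX Φ) q| = 1 / pd Ex (cX Φ) q := by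
      rw [div_eq_div_iff hs0 h0, one_mul]
      nth_rewrite 1 [hεq]
      linear_combination |pd Ex (cX Φ) q| * hεε
    have hb : ε / |pd Ex (cX Φ) q| ^ 3 = 1 / pd Ex (cX Φ) q ^ 3 := by
      have : |pd Ex (cX Φ) q| ^ 3 = |pd Ex (cX Φ) q| * pd Ex (cX Φ) q ^ 2 := by
        rw [pow_succ', sq_abs]
      rw [this, ← div_div, ha, div_div]
      ring
    rw [ha, show ε * (2 * (pd Ex (cX Φ) q * pd Et (pd Ex (cX Φ)) q)) / (4 * |pd Ex (cX Φ) q| ^ 3)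
      = ε / |pd Ex (cX Φ) q| ^ 3 * (pd Ex (cX Φ) q * pd Et (pd Ex (cX Φ)) q / 2) by
        field_simp; ring, hb, h1]
    field_simp
    ring
  refine ⟨hpos, hY0, ?_⟩
  rw [rpow_three_halves hpos, hroot, ← hTq', ← hXq', ← hYq', ← hUq', ← hVq']
  rfl

theorem IsPointSymmetry.mono (hΦ : IsPointSymmetry Ω Φ) {Ω' : Set Total} (hΩ' : IsOpen Ω')
    (h : Ω' ⊆ Ω) : IsPointSymmetry Ω' Φ where
  isOpen := hΩ'
  smooth := hΦ.smooth.mono h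
  jacobian_ne_zero p hp := hΦ.jacobian_ne_zero p (h hp)
  solves_iff D D' u v u' v' hD hD' hu hv hu' hv' hg :=
    hΦ.solves_iff D D' u v u' v' hD hD' hu hv hu' hv' fun z hz => h (hg z hz)

end

end BLP

/-- The complete point-symmetry pseudogroup of the Boiti–Leon–Pempinelli system consists exactly of
the transformations of the stated form: on an arbitrary open set this holds near every point, and
on a convex open set the form is global. -/
theorem theorem1 (Ω : Set BLP.Total) (hΩ : IsOpen Ω) (Φ : BLP.Total → BLP.Total) :
    (BLP.IsPointSymmetry Ω Φ ↔
      ∀ p ∈ Ω, ∃ Ω' : Set BLP.Total, IsOpen Ω' ∧ p ∈ Ω' ∧ Ω' ⊆ Ω ∧ BLP.HasForm Ω' Φ) ∧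
    (Convex ℝ Ω → (BLP.IsPointSymmetry Ω Φ ↔ BLP.HasForm Ω Φ)) := by
  refine ⟨⟨fun hΦ p hp => ?_, BLP.isPointSymmetry_of_locally_hasForm hΩ⟩, fun hc =>
    ⟨fun hΦ => hΦ.hasForm hc, fun h => BLP.isPointSymmetry_of_locally_hasForm hΩ fun p hp =>
      ⟨Ω, hΩ, hp, subset_rfl, h⟩⟩⟩
  obtain ⟨r, hr, hball⟩ := Metric.isOpen_iff.1 hΩ p hp
  exact ⟨Metric.ball p r, Metric.isOpen_ball, Metric.mem_ball_self hr, hball,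
    (hΦ.mono Metric.isOpen_ball hball).hasForm (convex_ball p r)⟩
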